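/- Let $\mathfrak g=\mathfrak g_{\bar 0}\oplus\mathfrak g_{\bar 1}$ be a basic simple finite-dimensional Lie superalgebra over $\mathbb C$: it is simple, $\mathfrak g_{\bar 0}$ is a reductive Lie algebra, and $\mathfrak g$ carries an even, invariant, supersymmetric, non-degenerate bilinear form $(\cdot|\cdot)$. Let $e,x,f\in\mathfrak g_{\bar 0}$ be a minimal $sl_2$-triple: $f\neq0$, $[x,e]=e$, $[x,f]=-f$, $[e,f]=x$, and $\operatorname{ad}x$ is diagonalizable on $\mathfrak g$ with eigenvalues in $\tfrac12\mathbb Z$ and eigenspaces $\mathfrak g_j$ such that $\mathfrak g_j=0$ for $|j|>1$ and $\mathfrak g_{-1}=\mathbb Cf$. Let $\mathfrak g^\natural$ be the centralizer of $\mathfrak s=\operatorname{span}\{e,x,f\}$ in $\mathfrak g_{\bar 0}$. Assume that * $\mathfrak g_{\bar 0}=\mathfrak s\oplus\mathfrak g^\natural$, and $\mathfrak g^\natural$ is not abelian; * the form is normalized by $(\theta|\theta)=2$, where $\pm\theta$ are the roots of $\mathfrak s$; equivalently, $(x|x)=\tfrac12$; * with respect to a Cartan subalgebra $\mathfrak h$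 of $\mathfrak g_{\bar 0}$ (a subspace of $\mathfrak g_{\bar 0}$ which equals its own centralizer in $\mathfrak g_{\bar 0}$ and whose elements are ad-diagonalizable on $\mathfrak g$), the scalar products $(\alpha|\beta)$ of the roots of $\mathfrak g$ are all real. A conjugate linear involution $\phi$ of $\mathfrak g$ (a conjugate linear, parity preserving automorphism with $\phi^2=\mathrm{id}$) is called *almost compact* if $\phi(e)=e$, $\phi(x)=x$, $\phi(f)=f$, and $\phi$ is a compact involution of $\mathfrak g^\natural$, that is, the real Lie algebra $\{a\in\mathfrak g^\natural\mid\phi(a)=a\}$ leaves invariant, under the adjoint action on $\mathfrak g$, some positive definite real inner product on $\mathfrak g$. Then there exists an almost compact conjugate linear involution $\phi$ of $\mathfrak g$ such that the symmetric bilinear form $\langle u,v\rangle=(e|[u,v])$ on $\mathfrak g_{-1/2}$ is real valued and positive definite on the real vector space $\mathfrak r=\{u\in\mathfrak g_{-1/2}\mid\phi(u)=-u\}$. -/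

import Mathlib

/-- A complex Lie superalgebra structure on a complex vector space `L`:
a `ℤ/2`-grading `L = part 0 ⊕ part 1` and an even bilinear bracket which is super-antisymmetric
and satisfies the super Jacobi identity. -/
structure LieSuperalgebra (L : Type*) [AddCommGroup L] [Module ℂ L] where
  /-- `part 0` is the even part and `part 1` is the odd part. -/
  part : ZMod 2 → Submodule ℂ L
  isCompl : IsCompl (part 0) (part 1)
  bracket : L →ₗ[ℂ] L →ₗ[ℂ] L
  bracket_mem : ∀ {i j : ZMod 2} {a b : L}, a ∈ part i → b ∈ part j →
    bracket a b ∈ part (i + j)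
  skew : ∀ {i j : ZMod 2} {a b : L}, a ∈ part i → b ∈ part j →
    bracket a b = -((-1 : ℂ) ^ (i.val * j.val) • bracket b a)
  jacobi : ∀ {i j : ZMod 2} {a b : L}, a ∈ part i → b ∈ part j → ∀ c : L,
    bracket a (bracket b c) =
      bracket (bracket a b) c + (-1 : ℂ) ^ (i.val * j.val) • bracket b (bracket a c)

namespace LieSuperalgebra

variable {L : Type*} [AddCommGroup L] [Module ℂ L] (g : LieSuperalgebra L)

/-- The even part. -/
abbrev even : Submodule ℂ L := g.part 0

/-- The odd part. -/
abbrev odd : Submodule ℂ L := g.part 1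

theorem bracket_even_mem {a b : L} (ha : a ∈ g.part 0) (hb : b ∈ g.part 0) :
    g.bracket a b ∈ g.part 0 := by
  have h := g.bracket_mem ha hb
  rwa [add_zero] at h

theorem bracket_self_of_even {a : L} (ha : a ∈ g.part 0) : g.bracket a a = 0 := by
  have h := g.skew ha ha
  simp only [ZMod.val_zero, mul_zero, pow_zero, one_smul] at h
  have h2 : (2 : ℂ) • g.bracket a a = 0 := by
    rw [two_smul]
    exact add_eq_zero_iff_eq_neg.mpr h
  exact (smul_eq_zero.mp h2).resolve_left two_ne_zero

/-- The even part is a Lie algebra. -/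
instance instLieRingEven : LieRing (g.part 0) where
  bracket a b := ⟨g.bracket a b, g.bracket_even_mem a.2 b.2⟩
  add_lie a b c := Subtype.ext (by simp [map_add])
  lie_add a b c := Subtype.ext (by simp [map_add])
  lie_self a := Subtype.ext (g.bracket_self_of_even a.2)
  leibniz_lie a b c := Subtype.ext (by
    have h := g.jacobi a.2 b.2 (c : L)
    simpa using h)

instance instLieAlgebraEven : LieAlgebra ℂ (g.part 0) where
  lie_smul t a b := Subtype.ext (map_smul (g.bracket (a : L)) t (b : L))

/-- A graded ideal: a `ℤ/2`-graded subspace stable under bracketing with all elements. -/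
def IsGradedIdeal (I : Submodule ℂ L) : Prop :=
  I = (I ⊓ g.even) ⊔ (I ⊓ g.odd) ∧ ∀ a : L, ∀ b ∈ I, g.bracket a b ∈ I

/-- A simple Lie superalgebra: the bracket is non-zero and the only graded ideals are `0` and the
whole algebra. -/
def IsSimple : Prop :=
  g.bracket ≠ 0 ∧ ∀ I : Submodule ℂ L, g.IsGradedIdeal I → I = ⊥ ∨ I = ⊤

/-- An even, supersymmetric, invariant, non-degenerate bilinear form. -/
structure IsInvariantForm (B : LinearMap.BilinForm ℂ L) : Prop where
  even_odd : ∀ a ∈ g.even, ∀ b ∈ g.odd, B a b = 0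
  supersymm : ∀ {i j : ZMod 2} {a b : L}, a ∈ g.part i → b ∈ g.part j →
    B a b = (-1 : ℂ) ^ (i.val * j.val) * B b a
  invariant : ∀ a b c : L, B (g.bracket a b) c = B a (g.bracket b c)
  nondegenerate : B.Nondegenerate

/-- A basic simple Lie superalgebra, together with its bilinear form: the superalgebra is simple,
its even part is reductive (the radical is the center), and `B` is an even invariant
non-degenerate supersymmetric form. -/
structure IsBasicSimple (B : LinearMap.BilinForm ℂ L) : Prop where
  simple : g.IsSimple
  reductive : LieAlgebra.radical ℂ (g.part 0) = LieAlgebra.center ℂ (g.part 0)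
  form : g.IsInvariantForm B

/-- The eigenspace `g_c = {a | [x, a] = c a}` of `ad x`. -/
def gr (x : L) (c : ℂ) : Submodule ℂ L := Module.End.eigenspace (g.bracket x) c

/-- An `sl₂`-triple of even elements, normalized by `[x, e] = e`, `[x, f] = -f`, `[e, f] = x`. -/
structure IsSl2Triple (e x f : L) : Prop where
  e_mem : e ∈ g.even
  x_mem : x ∈ g.even
  f_mem : f ∈ g.even
  f_ne_zero : f ≠ 0
  x_e : g.bracket x e = e
  x_f : g.bracket x f = -f
  e_f : g.bracket e f = x

/-- A minimal (Dynkin) datum: an `sl₂`-triple such that `ad x` is diagonalizable with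
eigenvalues in `½ℤ`, with `g_j = 0` for `|j| > 1` and `g_{-1} = ℂ f`. -/
structure IsMinimalDatum (e x f : L) : Prop where
  triple : g.IsSl2Triple e x f
  diagonalizable : ⨆ n : ℤ, g.gr x ((n : ℂ) / 2) = ⊤
  gr_eq_bot : ∀ n : ℤ, 2 < |n| → g.gr x ((n : ℂ) / 2) = ⊥
  gr_neg_one : g.gr x (-1) = Submodule.span ℂ {f}

/-- The centralizer `g^♮` in the even part of the subalgebra spanned by `e, x, f`. -/
def natural (e x f : L) : Submodule ℂ L :=
  g.even ⊓ (LinearMap.ker (g.bracket e) ⊓ LinearMap.ker (g.bracket x)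
    ⊓ LinearMap.ker (g.bracket f))

/-- The even part is the direct sum of `span {e, x, f}` and its centralizer. -/
def EvenDecomposes (e x f : L) : Prop :=
  Disjoint (Submodule.span ℂ {e, x, f}) (g.natural e x f) ∧
    Submodule.span ℂ {e, x, f} ⊔ g.natural e x f = g.even

/-- A Cartan subalgebra of the (reductive) even part: a subspace of the even part which is its own
centralizer in the even part (in particular it is commutative) and whose elements are
ad-diagonalizable. -/
structure IsCartan (H : Submodule ℂ L) : Prop where
  le_even : H ≤ g.even
  self_centralizing : ∀ y ∈ g.even, (y ∈ H ↔ ∀ h ∈ H, g.bracket h y = 0)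
  diagonalizable : ∀ h ∈ H, ⨆ c : ℂ, Module.End.eigenspace (g.bracket h) c = ⊤

/-- The roots of the superalgebra with respect to `H`. -/
def IsRoot (H : Submodule ℂ L) (α : Module.Dual ℂ H) : Prop :=
  α ≠ 0 ∧ ∃ v : L, v ≠ 0 ∧ ∀ h : H, g.bracket h v = α h • v

/-- All the scalar products `(α|β)` of roots are real. Here `(α|β) = (a|b)`, where `a, b ∈ H`
represent the linear functions `α, β` on `H` with respect to the bilinear form. -/
def RealRoots (B : LinearMap.BilinForm ℂ L) (H : Submodule ℂ L) : Prop :=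
  ∀ α β : Module.Dual ℂ H, g.IsRoot H α → g.IsRoot H β →
    ∀ a b : H, (∀ h : H, B a h = α h) → (∀ h : H, B b h = β h) → (B a b).im = 0

/-- A conjugate linear involution of the Lie superalgebra: a conjugate linear, parity preserving
automorphism of the bracket with square the identity. -/
structure IsConjInvolution (φ : L →ₛₗ[starRingEnd ℂ] L) : Prop where
  involutive : ∀ a : L, φ (φ a) = a
  map_part : ∀ (i : ZMod 2), ∀ a ∈ g.part i, φ a ∈ g.part i
  map_bracket : ∀ a b : L, φ (g.bracket a b) = g.bracket (φ a) (φ b)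

/-- The fixed points of `φ` in the subspace `A` are a compact Lie algebra (compactly embedded
in the superalgebra): there is a positive definite real inner product on `L` which is invariant
under the adjoint action of these fixed points. -/
def IsCompactOn (φ : L →ₛₗ[starRingEnd ℂ] L) (A : Submodule ℂ L) : Prop :=
  ∃ Q : LinearMap.BilinForm ℝ L,
    (∀ a b : L, Q a b = Q b a) ∧ (∀ a : L, a ≠ 0 → 0 < Q a a) ∧
    ∀ u ∈ A, φ u = u → ∀ a b : L, Q (g.bracket u a) b + Q a (g.bracket u b) = 0

/-- An almost compact conjugate linear involution: it fixes `e, x, f` and it is a compact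
conjugate linear involution of `g^♮`. -/
structure IsAlmostCompact (e x f : L) (φ : L →ₛₗ[starRingEnd ℂ] L) : Prop where
  conjInvolution : g.IsConjInvolution φ
  map_e : φ e = e
  map_x : φ x = x
  map_f : φ f = f
  compact : g.IsCompactOn φ (g.natural e x f)

/-- The bilinear form `⟨u, v⟩ = (e|[u, v])`. -/
def halfForm (B : LinearMap.BilinForm ℂ L) (e u v : L) : ℂ := B e (g.bracket u v)

end LieSuperalgebra

/-- A complex valued function of two variables is a (real valued, symmetric) positive definite
form on the set `r`. -/
def IsPosDefOn {L : Type*} [Zero L] (b : L → L → ℂ) (r : Set L) : Prop :=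
  (∀ u ∈ r, ∀ v ∈ r, (b u v).im = 0) ∧ (∀ u ∈ r, ∀ v ∈ r, b u v = b v u) ∧
    ∀ u ∈ r, u ≠ 0 → 0 < (b u u).re

/-! Write V for `g_{-1/2}` and ⟨u, v⟩ = (e|[u, v]). By minimality [u, v] = 2⟨u, v⟩ f on V. The
bracket [[e, u], v] has an x-component ⟨u, v⟩ x, and the remainder T(u, v) lies in `g^♮`. Simplicity
makes V and [e, V] exhaust the odd part, `g^♮` act faithfully on V, and the T(u, v) span `g^♮`. All
brackets are thus governed by the form on V and the tensor ⟨T(u, v)w, z⟩, which behaves like the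
curvature tensor of a symmetric space: antisymmetric in each pair, symmetric under exchange of
pairs, subject to a cyclic identity coming from Jacobi, and invariant under every T(u, v).

It therefore suffices to find a basis uᵢ of V, dual to its permutation u_{star i}, in which the
tensor satisfies t(star i, star j, star k, star l) = conj t(i, j, k, l). In such a basis the
conjugate linear map fixing e, x, f and sending uᵢ to -u_{star i} extends to g, because it
conjugates the Gram matrix of a spanning family (`gram_adaptedFamily`, `exists_semilinear_of_gram`).
It is multiplicative because it is so on the generators e, f, V. On its real form of `g^♮` the
matrices in the basis uᵢ are skew-Hermitian, which gives compactness. On the vectors with φ w = -w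
one has ⟨w, w⟩ = ∑ |⟨w, u_{star i}⟩|², which gives positivity.

The real basis comes from a Kempf–Ness argument. A self-dual basis of weight vectors is rescaled by
exp(yᵢ) with y_{star i} = -yᵢ so that the norm of the tensor is minimal. A minimum exists since the
support of the tensor is stable under `star` (`support_star`). At the minimum the diagonal part of
the moment map vanishes (`exists_balanced`), and its off-diagonal part vanishes for weight reasons
(`mul_conj_eq_zero`). Hence the stabilizer of the tensor is closed under adjoints
(`conj_stabilizes`). The adjoint of T(uᵢ, uⱼ) is then forced to be a multiple of T(u_{star i},
u_{star j}), and one contraction shows that the multiple is 1 (`real_of_balanced`).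

The weight arguments rest on the weights having real scalar products with each other. This follows
from the reality of the root products, because the `sl₂` part contributes only 0 or ±1/2
(`form_weight_real`). Reality makes a Cartan element whose square has trace zero vanish, which
excludes isotropic root vectors (`norm_ne_zero`), and `sl₂` theory then makes root spaces
one-dimensional (`proportional`). -/

/-- The four-tensor `t i j k l = ⟨T(uᵢ, uⱼ) uₖ, uₗ⟩` attached to a weight basis `uᵢ` of the odd
module, where `star` is the duality of indices, `⟨uᵢ, uⱼ⟩ = δ_{j, star i}`, and `m i p` are the
scalar products of the weights. -/
structure IsCurvatureTensor {I : Type*} [Fintype I] [DecidableEq I] (star : I → I)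
    (t : I → I → I → I → ℂ) (m : I → I → ℝ) : Prop where
  star_star : ∀ i, star (star i) = i
  antisymm : ∀ i j k l, t j i k l = -t i j k l
  symm : ∀ i j k l, t k l i j = t i j k l
  cyclic : ∀ i j k l, t i j k l + t i k j l = (if j = star i ∧ l = star k then 1 / 2 else 0)
    + (if k = star i ∧ l = star j then 1 / 2 else 0) - (if k = star j ∧ l = star i then 1 else 0)
  invariant : ∀ p q i j k l, ∑ r, (t p q i (star r) * t r j k l + t p q j (star r) * t i r k l
    + t p q k (star r) * t i j r l + t p q l (star r) * t i j k r) = 0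
  cartan : ∀ i p q, t i (star i) p q = if q = star p then (m i p : ℂ) else 0
  isotropic : ∀ i j, j ≠ star i → (∀ p, m i p + m j p = 0) → ∀ k l, t i j k l = 0

/-! ### Weights and contractions of the curvature tensor -/

namespace IsCurvatureTensor

variable {I : Type*} [Fintype I] [DecidableEq I] {star : I → I} {t : I → I → I → I → ℂ}
  {m : I → I → ℝ} (h : IsCurvatureTensor star t m)
include h

theorem sum_star {M : Type*} [AddCommMonoid M] (F : I → M) : ∑ r, F (star r) = ∑ r, F r :=
  Equiv.sum_comp (Function.Involutive.toPerm star h.star_star) F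

theorem antisymm_right (i j k l : I) : t i j l k = -t i j k l := by
  rw [← h.symm, h.antisymm, h.symm]

theorem star_eq_iff {i j : I} : i = star j ↔ j = star i := by
  constructor <;> rintro rfl <;> rw [h.star_star]

theorem star_inj {i j : I} : star i = star j ↔ i = j :=
  ⟨fun e => by rw [← h.star_star i, e, h.star_star], fun e => e ▸ rfl⟩

theorem self_eq_zero (i k l : I) : t i i k l = 0 := by
  have := h.antisymm i i k l
  linear_combination this / 2

theorem m_coe (i p : I) : (m i p : ℂ) = t i (star i) p (star p) := by
  rw [h.cartan, if_pos rfl]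

theorem m_symm (i p : I) : m i p = m p i := by
  have : (m i p : ℂ) = m p i := by rw [h.m_coe, h.m_coe, h.symm]
  exact_mod_cast this

theorem m_star_left (i p : I) : m (star i) p = -m i p := by
  have : (m (star i) p : ℂ) = -m i p := by
    rw [h.m_coe, h.m_coe, h.star_star, h.antisymm]
  exact_mod_cast this

theorem m_star_right (i p : I) : m i (star p) = -m i p := by
  rw [h.m_symm, h.m_star_left, h.m_symm]

/-- Conservation of weights. -/
theorem weight {i j k l : I} (hne : t i j k l ≠ 0) (p : I) :
    m p i + m p j + m p k + m p l = 0 := by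
  -- T(u_p, u_{star p}) acts diagonally, so invariance collapses to the total weight times the
  -- entry.
  have := h.invariant p (star p) i j k l
  simp only [h.cartan, h.star_inj, Finset.sum_add_distrib, ite_mul, zero_mul, Finset.sum_ite_eq',
    Finset.mem_univ, if_true, ← add_mul] at this
  have := (mul_eq_zero.mp this).resolve_right hne
  exact_mod_cast this

/-- In the cyclic identity with third index `star i`, one of the two terms on the left is a Cartan
entry, so the other is explicit. -/
theorem contract {i j : I} (hij : j ≠ i) (hij' : j ≠ star i) (l : I) :
    t i j (star i) l = if l = star j then 1 / 2 - (m i j : ℂ) else 0 := by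
  have := h.cyclic i j (star i) l
  have h1 : ¬ (star i = star j) := fun e => hij (h.star_inj.mp e).symm
  rw [h.cartan, if_neg (fun e : j = star i ∧ l = star (star i) => hij' e.1),
    if_neg (fun e : star i = star j ∧ l = star i => h1 e.1)] at this
  simp only [true_and] at this
  split_ifs at this ⊢ with h2
  · linear_combination this
  · linear_combination this

/-- The cyclic identity at (i, i, star i, star i) has vanishing first term. The exceptional case is
a self-dual index, where all three deltas on the right contribute and cancel. -/
theorem m_self (i : I) : m i i = if star i = i then 0 else -1 / 2 := by
  have h0 := h.cyclic i i (star i) (star i)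
  rw [h.self_eq_zero, ← h.m_coe] at h0
  have : (m i i : ℂ) = if star i = i then 0 else -1 / 2 := by
    by_cases hi : star i = i
    · simp only [hi, and_self, if_true] at h0 ⊢
      linear_combination h0
    · have hi' : ¬ i = star i := fun e => hi e.symm
      simp [hi, hi'] at h0 ⊢
      rw [h0]; norm_num
  split_ifs at this ⊢
  · exact_mod_cast this
  · have h2 : (m i i : ℂ) = ((-1 / 2 : ℝ) : ℂ) := by rw [this]; norm_num
    exact_mod_cast h2

end IsCurvatureTensor

/-! ### Root vectors: non-isotropy and one-dimensional root spaces -/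

/-- The matrix of `T(uᵢ, uⱼ)`. -/
def curvatureMatrix {I : Type*} (star : I → I) (t : I → I → I → I → ℂ) (i j : I) : Matrix I I ℂ :=
  Matrix.of fun a b => t i j b (star a)

namespace IsCurvatureTensor

attribute [local instance] LieRing.ofAssociativeRing

variable {I : Type*} [Fintype I] [DecidableEq I] {star : I → I} {t : I → I → I → I → ℂ}
  {m : I → I → ℝ} (h : IsCurvatureTensor star t m)
include h

local notation "X" => curvatureMatrix star t

theorem matrix_eq_zero_iff {i j : I} : X i j = 0 ↔ ∀ k l, t i j k l = 0 := by
  constructor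
  · intro e k l
    have := congrFun (congrFun e (star l)) k
    simpa [curvatureMatrix, h.star_star] using this
  · intro e
    ext a b
    exact e b (star a)

theorem matrix_antisymm (i j : I) : X j i = -X i j := by
  ext a b
  exact h.antisymm _ _ _ _

theorem matrix_ext {A C : Matrix I I ℂ} (e : ∀ k l, A (star l) k = C (star l) k) : A = C := by
  ext a b
  simpa [h.star_star] using e b (star a)

/-- The commutator of a matrix stabilizing the tensor with the curvature matrices. -/
theorem lie_of_stabilizes {τ : I → I → ℂ} (hskew : ∀ k r, τ (star k) (star r) = -τ r k)
    (hτ : ∀ i j k l, ∑ r, (τ i r * t r j k l + τ j r * t i r k l + τ k r * t i j r l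
      + τ l r * t i j k r) = 0) (i j : I) :
    ⁅Matrix.of fun a b => τ b a, X i j⁆ = ∑ r, (τ i r • X r j + τ j r • X i r) := by
  apply h.matrix_ext
  intro k l
  rw [Ring.lie_def, Matrix.sub_apply, Matrix.mul_apply, Matrix.mul_apply, Matrix.sum_apply]
  simp only [curvatureMatrix, Matrix.of_apply, h.star_star, Matrix.add_apply, Matrix.smul_apply,
    smul_eq_mul]
  have h1 : ∑ r, τ r (star l) * t i j k (star r) = -∑ r, τ l r * t i j k r := by
    rw [← h.sum_star, ← Finset.sum_neg_distrib]
    refine Finset.sum_congr rfl fun r _ => ?_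
    rw [hskew, h.star_star, neg_mul]
  rw [h1]
  have h2 := hτ i j k l
  simp only [Finset.sum_add_distrib] at h2 ⊢
  have h3 : ∑ r, t i j r l * τ k r = ∑ r, τ k r * t i j r l :=
    Finset.sum_congr rfl fun r _ => mul_comm _ _
  rw [h3]
  linear_combination -h2

theorem lie_matrix (p q i j : I) :
    ⁅X p q, X i j⁆ = ∑ r, (t p q i (star r) • X r j + t p q j (star r) • X i r) :=
  h.lie_of_stabilizes (τ := fun i r => t p q i (star r))
    (fun k r => by rw [h.star_star, h.antisymm_right]) (h.invariant p q) i j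

theorem cartan_matrix (i : I) : X i (star i) = Matrix.diagonal fun p => (m i p : ℂ) := by
  ext a b
  rw [curvatureMatrix, Matrix.of_apply, h.cartan, Matrix.diagonal_apply]
  by_cases hab : a = b
  · simp [hab]
  · rw [if_neg hab, if_neg]
    exact fun e => hab (h.star_inj.mp e)

theorem matrix_eq_zero_of_weight {i j : I} (hij : j ≠ star i) (hw : ∀ p, m p i + m p j = 0) :
    X i j = 0 :=
  h.matrix_eq_zero_iff.mpr
    (h.isotropic i j hij fun p => by rw [h.m_symm i, h.m_symm j]; exact hw p)

/-- The commutator of two curvature matrices of opposite weights. -/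
theorem lie_of_opposite {k l i j : I} (hw : ∀ p, m p k + m p l + m p i + m p j = 0) :
    ⁅X k l, X i j⁆ = -t k l i j • (X i (star i) + X j (star j)) := by
  rw [h.lie_matrix, Finset.sum_add_distrib]
  have h1 : ∑ r, t k l i (star r) • X r j = t k l i j • X (star j) j := by
    rw [Finset.sum_eq_single (star j)]
    · rw [h.star_star]
    · intro r _ hr
      by_cases h0 : t k l i (star r) = 0
      · rw [h0, zero_smul]
      · rw [h.matrix_eq_zero_of_weight (fun e => hr (h.star_eq_iff.mp e)), smul_zero]
        intro p
        have e1 := h.weight h0 p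
        have e2 := hw p
        rw [h.m_star_right] at e1
        linarith
    · simp
  have h2 : ∑ r, t k l j (star r) • X i r = -t k l i j • X i (star i) := by
    rw [Finset.sum_eq_single (star i)]
    · rw [h.star_star, h.antisymm_right]
    · intro r _ hr
      by_cases h0 : t k l j (star r) = 0
      · rw [h0, zero_smul]
      · rw [h.matrix_eq_zero_of_weight hr, smul_zero]
        intro p
        have e1 := h.weight h0 p
        have e2 := hw p
        rw [h.m_star_right] at e1
        linarith
    · simp
  rw [h1, h2, h.matrix_antisymm j (star j)]
  module

/-- The Cartan elements `X p (star p)` act on `X i j` through its weight. -/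
theorem lie_cartan (p i j : I) :
    ⁅X p (star p), X i j⁆ = ((m p i : ℂ) + m p j) • X i j := by
  rw [h.lie_matrix]
  simp only [h.cartan, h.star_inj, Finset.sum_add_distrib, ite_smul, zero_smul,
    Finset.sum_ite_eq', Finset.mem_univ, if_true, ← add_smul]

theorem exists_ne_zero {i j : I} (hX : X i j ≠ 0) : ∃ k l, t i j k l ≠ 0 := by
  by_contra! hc
  exact hX (h.matrix_eq_zero_iff.mpr hc)

/-- The quantity is the value of the weight of X i j on its dual Cartan element D. If it were zero,
D would commute with some X k l of opposite weight, whereas [X k l, X i j] is a nonzero multiple of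
D. Then tr(D²) = 0. Since D is a real diagonal matrix, D = 0, and `isotropic` kills X i j. -/
theorem norm_ne_zero {i j : I} (hX : X i j ≠ 0) (hij : j ≠ star i) :
    m i i + 2 * m i j + m j j ≠ 0 := by
  intro hN
  obtain ⟨k, l, hkl⟩ := h.exists_ne_zero hX
  have hw := h.weight hkl
  set D := X i (star i) + X j (star j) with hD
  have hDX : ⁅D, X k l⁆ = 0 := by
    rw [hD, add_lie, h.lie_cartan, h.lie_cartan, ← add_smul]
    have e1 := hw i
    have e2 := hw j
    have e3 := h.m_symm j i
    have : ((m i k : ℂ) + m i l + (m j k + m j l)) = 0 := by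
      have : m i k + m i l + (m j k + m j l) = 0 := by linarith
      exact_mod_cast this
    rw [this, zero_smul]
  have hcomm : ⁅X k l, X i j⁆ = -t k l i j • D :=
    h.lie_of_opposite (fun p => by linarith [hw p])
  have htr : Matrix.trace (D * ⁅X k l, X i j⁆) = 0 := by
    have : D * ⁅X k l, X i j⁆ = ⁅D, X k l⁆ * X i j + (X k l * (D * X i j) - D * X i j * X k l) := by
      simp only [Ring.lie_def]; noncomm_ring
    rw [this, hDX, zero_mul, zero_add, Matrix.trace_sub, Matrix.trace_mul_comm, sub_self]
  rw [hcomm, Matrix.mul_smul, Matrix.trace_smul, smul_eq_mul, hD, h.cartan_matrix,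
    h.cartan_matrix, Matrix.diagonal_add, Matrix.diagonal_mul_diagonal, Matrix.trace_diagonal,
    mul_eq_zero, neg_eq_zero, h.symm] at htr
  have hsum : ∑ p, (m i p + m j p) * (m i p + m j p) = 0 := by
    have := htr.resolve_left hkl
    exact_mod_cast this
  rw [Finset.sum_eq_zero_iff_of_nonneg (fun p _ => mul_self_nonneg _)] at hsum
  refine hX (h.matrix_eq_zero_iff.mpr (h.isotropic i j hij fun p => ?_))
  exact mul_self_eq_zero.mp (hsum p (Finset.mem_univ p))

theorem ne_of_matrix_ne_zero {i j : I} (hX : X i j ≠ 0) : j ≠ i := by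
  rintro rfl
  exact hX (h.matrix_eq_zero_iff.mpr fun k l => h.self_eq_zero j k l)

/-- When neither index is self-dual, the norm in `norm_ne_zero` equals 2 m i j - 1. When one of them
is self-dual, its weight is zero and the value is 1/2. -/
theorem contraction_ne_zero {i j : I} (hX : X i j ≠ 0) (hij : j ≠ star i) :
    (1 / 2 : ℝ) - m i j ≠ 0 := by
  have hN := h.norm_ne_zero hX hij
  have hi := h.m_self i
  have hj := h.m_self j
  split_ifs at hi with hi'
  · have : m i j = 0 := by
      have e1 := h.m_star_left i j
      rw [hi'] at e1
      linarith
    rw [this]; norm_num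
  · split_ifs at hj with hj'
    · have : m i j = 0 := by
        have e1 := h.m_star_right i j
        rw [hj'] at e1
        linarith
      rw [this]; norm_num
    · intro e
      apply hN
      rw [hi, hj]
      linarith

theorem contract_star {i j : I} (hX : X i j ≠ 0) (hij : j ≠ star i) :
    t i j (star i) (star j) = ((1 / 2 - m i j : ℝ) : ℂ) := by
  rw [h.contract (h.ne_of_matrix_ne_zero hX) hij, if_pos rfl]
  push_cast
  ring

theorem matrix_star_ne_zero {i j : I} (hX : X i j ≠ 0) (hij : j ≠ star i) :
    X (star i) (star j) ≠ 0 := by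
  intro e
  have h1 := h.matrix_eq_zero_iff.mp e i j
  rw [h.symm, h.contract_star hX hij] at h1
  exact h.contraction_ne_zero hX hij (by exact_mod_cast h1)

/-- Root spaces are one-dimensional. -/
theorem proportional {i j k l : I} (hX : X i j ≠ 0) (hij : j ≠ star i)
    (hw : ∀ p, m p k + m p l = m p i + m p j) :
    X k l = (t (star i) (star j) k l / ((1 / 2 - m i j : ℝ) : ℂ)) • X i j := by
  have hs : ((1 / 2 - m i j : ℝ) : ℂ) ≠ 0 := by
    exact_mod_cast h.contraction_ne_zero hX hij
  set s : ℂ := ((1 / 2 - m i j : ℝ) : ℂ) with hsdef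
  have hN : ((m i i + 2 * m i j + m j j : ℝ) : ℂ) ≠ 0 := by
    exact_mod_cast h.norm_ne_zero hX hij
  set N : ℂ := ((m i i + 2 * m i j + m j j : ℝ) : ℂ) with hNdef
  set D := X i (star i) + X j (star j) with hD
  set Y := X (star i) (star j) with hY
  have hDX : ∀ a b, (∀ p, m p a + m p b = m p i + m p j) → ⁅D, X a b⁆ = N • X a b := by
    intro a b hab
    rw [hD, add_lie, h.lie_cartan, h.lie_cartan, ← add_smul, hNdef]
    congr 1
    have e1 := hab i
    have e2 := hab j
    have e3 := h.m_symm j i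
    have : m i a + m i b + (m j a + m j b) = m i i + 2 * m i j + m j j := by linarith
    exact_mod_cast this
  have hDY : ⁅D, Y⁆ = -N • Y := by
    rw [hD, hY, add_lie, h.lie_cartan, h.lie_cartan, ← add_smul, hNdef]
    congr 1
    simp only [h.m_star_right]
    rw [h.m_symm j i]
    push_cast
    ring
  have hYX : ⁅Y, X i j⁆ = -s • D := by
    rw [hY, h.lie_of_opposite, h.symm, h.contract_star hX hij]
    intro p
    simp only [h.m_star_right]; ring
  have hYZ : ⁅Y, X k l⁆ = -t (star i) (star j) k l • D := by
    rw [hY, h.lie_of_opposite]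
    · congr 1
      simp only [hD, h.cartan_matrix, Matrix.diagonal_add]
      congr 1
      ext p
      have := hw p
      rw [h.m_symm p, h.m_symm p, h.m_symm p, h.m_symm p] at this
      exact_mod_cast this
    · intro p
      have := hw p
      simp only [h.m_star_right]; linarith
  have hD0 : D ≠ 0 := by
    intro e
    have := hDX i j (fun _ => rfl)
    rw [e, zero_lie] at this
    exact (smul_ne_zero hN hX) this.symm
  -- X i j and its opposite Y, suitably scaled, span a copy of `sl₂` with Cartan direction D.
  have htriple : IsSl2Triple ((2 / N) • D) ((2 / (N * s)) • X i j) Y := by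
    refine ⟨smul_ne_zero (div_ne_zero two_ne_zero hN) hD0, ?_, ?_, ?_⟩
    · rw [smul_lie, ← lie_skew, hYX, ← neg_smul, neg_neg, smul_smul]
      congr 1
      field_simp
    · rw [smul_lie, lie_smul, hDX i j (fun _ => rfl), two_nsmul, ← two_smul ℂ]
      simp only [smul_smul]
      congr 1
      field_simp
    · rw [smul_lie, hDY, two_nsmul, ← two_smul ℂ, ← neg_smul, smul_smul]
      congr 1
      field_simp
  by_contra hne
  set Z := X k l - (t (star i) (star j) k l / s) • X i j with hZ
  have hZ0 : Z ≠ 0 := sub_ne_zero.mpr hne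
  -- The coefficient in Z is chosen so that Y kills Z. In the reversed triple Z would be a highest
  -- weight vector of weight -2, impossible in finite dimension.
  have hprim : IsSl2Triple.HasPrimitiveVectorWith htriple.symm Z (-2 : ℂ) := by
    refine ⟨hZ0, ?_, ?_⟩
    · rw [neg_lie, smul_lie, hZ, lie_sub, lie_smul, hDX k l hw, hDX i j (fun _ => rfl)]
      simp only [smul_sub, smul_smul, neg_sub]
      match_scalars <;> field_simp
    · rw [hZ, lie_sub, lie_smul, hYX, hYZ, smul_smul, ← sub_smul]
      convert zero_smul ℂ D
      field_simp
      ring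
  obtain ⟨n, hn⟩ := hprim.exists_nat
  have hn' : ((n + 2 : ℕ) : ℂ) = 0 := by push_cast; rw [← hn]; ring
  exact absurd (Nat.cast_eq_zero.mp hn') (by omega)

/-- By one-dimensionality X (star k) (star l), which has the weight of X i j, is a multiple of it.
The coefficient is t(star i, star j, star k, star l) up to a nonzero factor, and it cannot be zero
since X (star k) (star l) is not zero. -/
theorem support_star {i j k l : I} (hne : t i j k l ≠ 0) :
    t (star i) (star j) (star k) (star l) ≠ 0 := by
  by_cases hij : j = star i
  · subst hij
    rw [h.cartan] at hne ⊢
    by_cases hl : l = star k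
    · subst hl
      rw [if_pos rfl] at hne ⊢
      rw [h.m_star_left, h.m_star_right, neg_neg]
      exact hne
    · exact absurd (if_neg hl) hne
  · have hX : X i j ≠ 0 := fun e => hne (h.matrix_eq_zero_iff.mp e k l)
    have hkl : l ≠ star k := by
      rintro rfl
      rw [← h.symm, h.cartan, if_neg hij] at hne
      exact hne rfl
    have hX' : X k l ≠ 0 := fun e => hne (by rw [← h.symm]; exact h.matrix_eq_zero_iff.mp e i j)
    have hp := h.proportional (k := star k) (l := star l) hX hij (fun p => by
      have := h.weight hne p
      simp only [h.m_star_right]; linarith)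
    intro e
    rw [e, zero_div, zero_smul] at hp
    exact h.matrix_star_ne_zero hX' hkl hp

/-- If both were nonzero they would be proportional, with a nonzero ratio. The cyclic identity makes
the entry t(j, k, star i, star k) vanish, because X j (star i) has weight zero and is killed by
`isotropic`. The corresponding entry of X i k is the nonzero contraction. -/
theorem matrix_eq_zero_or {i j k : I} (hij : i ≠ j) (hw : ∀ p, m p i = m p j) :
    X i k = 0 ∨ X j k = 0 := by
  by_contra! hc
  obtain ⟨hi, hj⟩ := hc
  have hw' : ∀ p, m p j + m p (star i) = 0 := fun p => by
    rw [h.m_star_right, hw p]; ring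
  have hw'' : ∀ p, m p i + m p (star j) = 0 := fun p => by
    rw [h.m_star_right, hw p]; ring
  have hji : star i ≠ star j := fun e => hij (h.star_inj.mp e)
  by_cases hk : k = star i
  · exact hj (h.matrix_eq_zero_of_weight (hk ▸ hji) (hk ▸ hw'))
  by_cases hk' : k = star j
  · exact hi (h.matrix_eq_zero_of_weight (hk' ▸ hji.symm) (hk' ▸ hw''))
  have hki := h.ne_of_matrix_ne_zero hi
  have hc := h.cyclic j k (star i) (star k)
  have h0 : t j (star i) k (star k) = 0 :=
    h.matrix_eq_zero_iff.mp (h.matrix_eq_zero_of_weight hji hw') _ _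
  rw [h0, if_neg (fun e => hk' e.1), if_neg (fun e => hji e.1),
    if_neg (fun e => hki (h.star_inj.mp e.1).symm)] at hc
  have hp := h.proportional hi hk (k := j) (l := k) (fun p => by rw [hw p])
  set c := t (star i) (star k) j k / ((1 / 2 - m i k : ℝ) : ℂ)
  have hcc : c ≠ 0 := by
    intro e
    rw [e, zero_smul] at hp
    exact hj hp
  have he := congrFun (congrFun hp k) (star i)
  rw [Matrix.smul_apply, curvatureMatrix, Matrix.of_apply, curvatureMatrix, Matrix.of_apply,
    h.contract_star hi hk, smul_eq_mul] at he
  have : c * ((1 / 2 - m i k : ℝ) : ℂ) = 0 := by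
    rw [← he]; linear_combination hc
  rcases mul_eq_zero.mp this with e | e
  · exact hcc e
  · exact h.contraction_ne_zero hi hk (by exact_mod_cast e)

theorem matrix_star_eq_zero {i j : I} (hX : X i j = 0) (hij : j ≠ star i) :
    X (star i) (star j) = 0 := by
  by_contra hne
  have := h.matrix_star_ne_zero hne (fun e => hij (h.star_inj.mp e))
  rw [h.star_star, h.star_star] at this
  exact this hX

end IsCurvatureTensor

/-! ### Minimizing a sum of exponentials -/

/-- A sum of exponentials of linear functions, whose support is symmetric under negation, attains
its minimum. -/
theorem exists_forall_sum_exp_le {J E : Type*} [Fintype J] [AddCommGroup E] [Module ℝ E]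
    (c : J → ℝ) (hc : ∀ j, 0 ≤ c j) (ℓ : E →ₗ[ℝ] J → ℝ)
    (hsymm : ∀ j, c j ≠ 0 → ∃ j', c j' ≠ 0 ∧ ∀ v, ℓ v j' = -ℓ v j) :
    ∃ v₀, ∀ v, ∑ j, c j * Real.exp (ℓ v₀ j) ≤ ∑ j, c j * Real.exp (ℓ v j) := by
  classical
  let S := {j : J // c j ≠ 0}
  let r : E →ₗ[ℝ] S → ℝ := LinearMap.pi fun j => LinearMap.proj (j : J) ∘ₗ ℓ
  let G : (S → ℝ) → ℝ := fun z => ∑ j : S, c j * Real.exp (z j)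
  have hG : ∀ v, ∑ j, c j * Real.exp (ℓ v j) = G (r v) := by
    intro v
    have : ∀ j, c j = 0 → c j * Real.exp (ℓ v j) = 0 := fun j hj => by rw [hj, zero_mul]
    rw [← Finset.sum_subset (Finset.subset_univ (Finset.univ.filter fun j => c j ≠ 0))
      (fun j _ hj => this j (by simpa using hj))]
    exact (Finset.sum_subtype _ (by simp) _)
  have hcont : Continuous G := by fun_prop
  let R : Submodule ℝ (S → ℝ) := LinearMap.range r
  let K : Set (S → ℝ) := (R : Set (S → ℝ)) ∩ {z | G z ≤ G 0}
  have hclosed : IsClosed K :=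
    (Submodule.closed_of_finiteDimensional R).inter (isClosed_le hcont continuous_const)
  have hpos : ∀ j : S, 0 < c j := fun j => lt_of_le_of_ne (hc j) (Ne.symm j.2)
  -- A sublevel set bounds every exponent from above. Symmetry of the support turns this into a
  -- bound from below, so the sublevel set is compact in the range of the linear map.
  have hupper : ∀ z, G z ≤ G 0 → ∀ j : S, z j ≤ Real.log (G 0 / c j) := by
    intro z hz j
    have h1 : c j * Real.exp (z j) ≤ G 0 := by
      refine le_trans ?_ hz
      exact Finset.single_le_sum (f := fun j : S => c j * Real.exp (z j))
        (fun i _ => mul_nonneg (hc i) (Real.exp_pos _).le) (Finset.mem_univ j)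
    have h2 : Real.exp (z j) ≤ G 0 / c j := by
      rw [le_div_iff₀ (hpos j)]; linarith
    exact (Real.le_log_iff_exp_le (lt_of_lt_of_le (Real.exp_pos _) h2)).mpr h2
  have hbdd : Bornology.IsBounded K := by
    rw [isBounded_iff_forall_norm_le]
    refine ⟨∑ j : S, |Real.log (G 0 / c j)|, ?_⟩
    rintro z ⟨⟨v, rfl⟩, hz⟩
    have hle : ∀ j : S, |Real.log (G 0 / c j)| ≤ ∑ j : S, |Real.log (G 0 / c j)| := fun j =>
      Finset.single_le_sum (f := fun j : S => |Real.log (G 0 / c j)|)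
        (fun i _ => abs_nonneg _) (Finset.mem_univ j)
    rw [pi_norm_le_iff_of_nonneg (Finset.sum_nonneg fun i _ => abs_nonneg _)]
    intro j
    rw [Real.norm_eq_abs, abs_le']
    refine ⟨(hupper _ hz j).trans ((le_abs_self _).trans (hle j)), ?_⟩
    obtain ⟨j', hj', hneg⟩ := hsymm j j.2
    have : -(r v j) = r v ⟨j', hj'⟩ := (hneg v).symm
    rw [this]
    exact (hupper _ hz ⟨j', hj'⟩).trans ((le_abs_self _).trans (hle _))
  obtain ⟨z, ⟨⟨v₀, rfl⟩, hz⟩, hmin⟩ := (Metric.isCompact_of_isClosed_isBounded hclosed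
    hbdd).exists_isMinOn ⟨0, R.zero_mem, le_refl (G 0)⟩ hcont.continuousOn
  refine ⟨v₀, fun v => ?_⟩
  rw [hG, hG]
  by_cases hv : G (r v) ≤ G 0
  · exact hmin ⟨⟨v, rfl⟩, hv⟩
  · exact le_trans hz (not_le.mp hv).le

/-- This is the vanishing of the derivative along the line v₀ + s w. -/
theorem sum_mul_exp_mul_eq_zero_of_min {J E : Type*} [Fintype J] [AddCommGroup E] [Module ℝ E]
    (c : J → ℝ) (ℓ : E →ₗ[ℝ] J → ℝ) (v₀ : E)
    (hmin : ∀ v, ∑ j, c j * Real.exp (ℓ v₀ j) ≤ ∑ j, c j * Real.exp (ℓ v j)) (w : E) :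
    ∑ j, c j * Real.exp (ℓ v₀ j) * ℓ w j = 0 := by
  let F : ℝ → ℝ := fun s => ∑ j, c j * Real.exp (ℓ v₀ j + s * ℓ w j)
  have hd : HasDerivAt F (∑ j, c j * Real.exp (ℓ v₀ j) * ℓ w j) 0 := by
    refine HasDerivAt.fun_sum fun j _ => ?_
    have h1 : HasDerivAt (fun s : ℝ => ℓ v₀ j + s * ℓ w j) (1 * ℓ w j) 0 :=
      ((hasDerivAt_id (0 : ℝ)).mul_const _).const_add _
    have h2 := (h1.exp).const_mul (c j)
    simpa [mul_assoc] using h2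
  refine IsLocalMin.hasDerivAt_eq_zero (Filter.Eventually.of_forall fun s => ?_) hd
  have := hmin (v₀ + s • w)
  simpa [F] using this

theorem sum_four_swap {I M : Type*} [Fintype I] [AddCommMonoid M] (F : I → I → I → I → M) :
    ∑ i, ∑ j, ∑ k, ∑ l, F i j k l = ∑ k, ∑ l, ∑ i, ∑ j, F i j k l := by
  calc ∑ i, ∑ j, ∑ k, ∑ l, F i j k l = ∑ i, ∑ k, ∑ j, ∑ l, F i j k l :=
        Finset.sum_congr rfl fun i _ => Finset.sum_comm
    _ = ∑ k, ∑ i, ∑ j, ∑ l, F i j k l := Finset.sum_comm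
    _ = ∑ k, ∑ i, ∑ l, ∑ j, F i j k l :=
        Finset.sum_congr rfl fun k _ => Finset.sum_congr rfl fun i _ => Finset.sum_comm
    _ = ∑ k, ∑ l, ∑ i, ∑ j, F i j k l := Finset.sum_congr rfl fun k _ => Finset.sum_comm

/-! ### Matrices acting on tensors, and adjoints of stabilizing matrices -/

section Double

open Matrix Kronecker ComplexOrder

variable {J : Type*} [Fintype J] [DecidableEq J]

/-- The action of a matrix on the tensor square. -/
def Matrix.double (b : Matrix J J ℂ) : Matrix (J × J) (J × J) ℂ :=
  b ⊗ₖ (1 : Matrix J J ℂ) + (1 : Matrix J J ℂ) ⊗ₖ b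

omit [Fintype J] in
theorem Matrix.double_conjTranspose (b : Matrix J J ℂ) : (double b)ᴴ = double bᴴ := by
  simp [double, conjTranspose_add, conjTranspose_kronecker]

theorem Matrix.double_commutator (a b : Matrix J J ℂ) :
    double a * double b - double b * double a = double (a * b - b * a) := by
  simp only [double, add_mul, mul_add, ← mul_kronecker_mul, one_mul, mul_one]
  ext ⟨i, j⟩ ⟨k, l⟩
  simp only [Matrix.add_apply, Matrix.sub_apply, kroneckerMap_apply]
  ring

theorem Matrix.double_mulVec (b : Matrix J J ℂ) (v : J × J → ℂ) (i j : J) :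
    (double b *ᵥ v) (i, j) = ∑ r, (b i r * v (r, j) + b j r * v (i, r)) := by
  rw [double, add_mulVec, Pi.add_apply, mulVec, mulVec, dotProduct, dotProduct,
    Fintype.sum_prod_type, Fintype.sum_prod_type, Finset.sum_add_distrib]
  simp [kroneckerMap_apply, one_apply, Finset.sum_ite_eq]

/-- If the moment map vanishes at `v` and `b` stabilizes `v`, so does the adjoint of `b`. -/
theorem Matrix.conjTranspose_mulVec_eq_zero {K : Type*} [Fintype K] (b : Matrix K K ℂ) (v : K → ℂ)
    (hb : b *ᵥ v = 0) (hmoment : Star.star v ⬝ᵥ ((b * bᴴ - bᴴ * b) *ᵥ v) = 0) : bᴴ *ᵥ v = 0 := by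
  -- Since b v = 0, the pairing of v with [b, bᴴ] v is exactly the squared norm of bᴴ v.
  rw [sub_mulVec, ← mulVec_mulVec, ← mulVec_mulVec, hb, mulVec_zero, sub_zero,
    dotProduct_mulVec] at hmoment
  rw [← dotProduct_star_self_eq_zero, star_mulVec, conjTranspose_conjTranspose]
  exact hmoment

end Double

/-! ### Rescaling to a critical point of the norm -/

namespace IsCurvatureTensor

variable {I : Type*} [Fintype I] [DecidableEq I] {star : I → I} {t : I → I → I → I → ℂ}
  {m : I → I → ℝ} (h : IsCurvatureTensor star t m)
include h

/-- Rescaling the weight basis. -/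
theorem rescale (y : I → ℝ) (hy : ∀ i, y (star i) = -y i) :
    IsCurvatureTensor star
      (fun i j k l => (Real.exp (y i + y j + y k + y l) : ℂ) * t i j k l) m where
  star_star := h.star_star
  antisymm i j k l := by rw [h.antisymm, add_comm (y j), mul_neg]
  symm i j k l := by
    rw [h.symm]
    congr 3
    ring
  cyclic i j k l := by
    have e : y i + y k + y j + y l = y i + y j + y k + y l := by ring
    rw [e, ← mul_add, h.cyclic]
    -- Each delta pairs the four indices into two dual pairs, whose exponents cancel.
    have hE : ∀ c : ℂ, ∀ P : Prop, [Decidable P] → (P → y i + y j + y k + y l = 0) →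
        (Real.exp (y i + y j + y k + y l) : ℂ) * (if P then c else 0) = if P then c else 0 := by
      intro c P _ hP
      split_ifs with hp
      · rw [hP hp, Real.exp_zero, Complex.ofReal_one, one_mul]
      · rw [mul_zero]
    rw [mul_sub, mul_add, hE, hE, hE]
    · rintro ⟨rfl, rfl⟩; rw [hy, hy]; ring
    · rintro ⟨rfl, rfl⟩; rw [hy, hy]; ring
    · rintro ⟨rfl, rfl⟩; rw [hy, hy]; ring
  invariant p q i j k l := by
    have := h.invariant p q i j k l
    rw [← mul_eq_zero_of_right (Real.exp (y p + y q + y i + y j + y k + y l) : ℂ) this,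
      Finset.mul_sum]
    refine Finset.sum_congr rfl fun r _ => ?_
    have e : ∀ a b : ℝ, y p + y q + y i + y j + y k + y l = a + b →
        (Real.exp (y p + y q + y i + y j + y k + y l) : ℂ) = Real.exp a * Real.exp b := by
      intro a b hab
      rw [hab, Real.exp_add, Complex.ofReal_mul]
    rw [mul_add, mul_add, mul_add]
    congr 1
    congr 1
    congr 1
    · rw [e (y p + y q + y i + y (star r)) (y r + y j + y k + y l) (by rw [hy]; ring)]; ring
    · rw [e (y p + y q + y j + y (star r)) (y i + y r + y k + y l) (by rw [hy]; ring)]; ring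
    · rw [e (y p + y q + y k + y (star r)) (y i + y j + y r + y l) (by rw [hy]; ring)]; ring
    · rw [e (y p + y q + y l + y (star r)) (y i + y j + y k + y r) (by rw [hy]; ring)]; ring
  cartan i p q := by
    rw [h.cartan]
    split_ifs with hq
    · rw [hq, hy, hy]
      have : y i + -y i + y p + -y p = 0 := by ring
      rw [this, Real.exp_zero, Complex.ofReal_one, one_mul]
    · rw [mul_zero]
  isotropic i j hij hm k l := by rw [h.isotropic i j hij hm, mul_zero]

/-- After rescaling the weight basis, the moment map of the torus vanishes. -/
theorem exists_balanced : ∃ y : I → ℝ, (∀ i, y (star i) = -y i) ∧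
    ∀ w : I → ℝ, (∀ i, w (star i) = -w i) →
      ∑ i, ∑ j, ∑ k, ∑ l, Complex.normSq
        ((Real.exp (y i + y j + y k + y l) : ℂ) * t i j k l) * w i = 0 := by
  -- Exponents are parametrized by antisymmetrizing arbitrary vectors, which leaves the minimization
  -- unconstrained. An already antisymmetric w is doubled by this. The factor 2 in `ℓ` comes from
  -- squaring the modulus.
  let odd : (I → ℝ) →ₗ[ℝ] I → ℝ := LinearMap.id - LinearMap.funLeft ℝ ℝ star
  have hodd : ∀ y i, odd y i = y i - y (star i) := fun y i => rfl
  let ℓ : (I → ℝ) →ₗ[ℝ] (I × I × I × I) → ℝ := LinearMap.pi fun J =>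
    (2 : ℝ) • ((LinearMap.proj J.1 : (I → ℝ) →ₗ[ℝ] ℝ) + LinearMap.proj J.2.1 + LinearMap.proj J.2.2.1
      + LinearMap.proj J.2.2.2) ∘ₗ odd
  have hℓ : ∀ y i j k l, ℓ y (i, j, k, l) = 2 * (odd y i + odd y j + odd y k + odd y l) :=
    fun y i j k l => rfl
  have hodd' : ∀ y i, odd y (star i) = -odd y i := by
    intro y i
    rw [hodd, hodd, h.star_star]; ring
  let c : I × I × I × I → ℝ := fun J => Complex.normSq (t J.1 J.2.1 J.2.2.1 J.2.2.2)
  obtain ⟨v₀, hv₀⟩ := exists_forall_sum_exp_le c (fun J => Complex.normSq_nonneg _) ℓ (by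
    rintro ⟨i, j, k, l⟩ hne
    refine ⟨(star i, star j, star k, star l), ?_, fun v => ?_⟩
    · exact Complex.normSq_eq_zero.not.mpr (h.support_star (Complex.normSq_eq_zero.not.mp hne))
    · rw [hℓ, hℓ]; simp only [hodd']; ring)
  refine ⟨odd v₀, hodd' v₀, fun w hw => ?_⟩
  have key := sum_mul_exp_mul_eq_zero_of_min c ℓ v₀ hv₀ w
  simp only [Fintype.sum_prod_type] at key
  have hw2 : ∀ i, odd w i = 2 * w i := fun i => by rw [hodd, hw]; ring
  have hterm : ∀ i j k l, c (i, j, k, l) * Real.exp (ℓ v₀ (i, j, k, l)) * ℓ w (i, j, k, l) =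
      4 * (Complex.normSq ((Real.exp (odd v₀ i + odd v₀ j + odd v₀ k + odd v₀ l) : ℂ)
        * t i j k l) * (w i + w j + w k + w l)) := by
    intro i j k l
    rw [hℓ, hℓ, Complex.normSq_mul, Complex.normSq_ofReal, ← Real.exp_add, ← two_mul]
    simp only [hw2, c]
    ring
  set t' : I → I → I → I → ℂ := fun i j k l =>
    (Real.exp (odd v₀ i + odd v₀ j + odd v₀ k + odd v₀ l) : ℂ) * t i j k l with ht'
  have h' : IsCurvatureTensor star t' m := h.rescale (odd v₀) (hodd' v₀)
  have hn1 : ∀ i j k l, Complex.normSq (t' j i k l) = Complex.normSq (t' i j k l) :=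
      fun i j k l => by
    rw [h'.antisymm, Complex.normSq_neg]
  have hn2 : ∀ i j k l, Complex.normSq (t' i j l k) = Complex.normSq (t' i j k l) :=
      fun i j k l => by
    rw [h'.antisymm_right, Complex.normSq_neg]
  simp only [hterm, ← Finset.mul_sum, mul_add, Finset.sum_add_distrib] at key
  -- The symmetries of the tensor make the four slots contribute equally, so the derivative is a
  -- multiple of the first-slot sum.
  have e2 : ∑ i, ∑ j, ∑ k, ∑ l, Complex.normSq (t' i j k l) * w j =
      ∑ i, ∑ j, ∑ k, ∑ l, Complex.normSq (t' i j k l) * w i := by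
    rw [Finset.sum_comm]
    refine Finset.sum_congr rfl fun j _ => Finset.sum_congr rfl fun i _ =>
      Finset.sum_congr rfl fun k _ => Finset.sum_congr rfl fun l _ => ?_
    rw [hn1]
  have e3 : ∑ i, ∑ j, ∑ k, ∑ l, Complex.normSq (t' i j k l) * w k =
      ∑ i, ∑ j, ∑ k, ∑ l, Complex.normSq (t' i j k l) * w i := by
    rw [sum_four_swap]
    refine Finset.sum_congr rfl fun k _ => Finset.sum_congr rfl fun l _ =>
      Finset.sum_congr rfl fun i _ => Finset.sum_congr rfl fun j _ => ?_
    rw [h'.symm]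
  have e4 : ∑ i, ∑ j, ∑ k, ∑ l, Complex.normSq (t' i j k l) * w l =
      ∑ i, ∑ j, ∑ k, ∑ l, Complex.normSq (t' i j k l) * w k := by
    refine Finset.sum_congr rfl fun i _ => Finset.sum_congr rfl fun j _ => ?_
    rw [Finset.sum_comm]
    refine Finset.sum_congr rfl fun l _ => Finset.sum_congr rfl fun k _ => ?_
    rw [hn2]
  simp only [ht'] at e2 e3 e4
  linarith

end IsCurvatureTensor

open Matrix in
theorem Matrix.double_double_mulVec {J : Type*} [Fintype J] [DecidableEq J] (b : Matrix J J ℂ)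
    (t : J → J → J → J → ℂ) (i j k l : J) :
    (double (double b) *ᵥ fun x => t x.1.1 x.1.2 x.2.1 x.2.2) ((i, j), (k, l)) =
      ∑ r, (b i r * t r j k l + b j r * t i r k l + b k r * t i j r l + b l r * t i j k r) := by
  rw [double_mulVec, Finset.sum_add_distrib]
  have h1 := double_mulVec b (fun x => t x.1 x.2 k l) i j
  have h2 := double_mulVec b (fun x => t i j x.1 x.2) k l
  rw [mulVec, dotProduct] at h1 h2
  rw [h1, h2, ← Finset.sum_add_distrib]
  exact Finset.sum_congr rfl fun r _ => by ring

/-! ### From a vanishing moment map to a real tensor -/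

namespace IsCurvatureTensor

variable {I : Type*} [Fintype I] [DecidableEq I] {star : I → I} {t : I → I → I → I → ℂ}
  {m : I → I → ℝ} (h : IsCurvatureTensor star t m)
include h

local notation "X" => curvatureMatrix star t

/-- The moment map is diagonal. -/
theorem mul_conj_eq_zero {i r : I} (hir : r ≠ i) (j k l : I) :
    starRingEnd ℂ (t i j k l) * t r j k l = 0 := by
  by_contra hne
  obtain ⟨h1, h2⟩ := mul_ne_zero_iff.mp hne
  rw [map_ne_zero] at h1
  rcases h.matrix_eq_zero_or (k := j) hir (fun p => by
    have e1 := h.weight h1 p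
    have e2 := h.weight h2 p
    linarith) with e | e
  · exact h2 (h.matrix_eq_zero_iff.mp e k l)
  · exact h1 (h.matrix_eq_zero_iff.mp e k l)

/-- Off-diagonal entries of c pair to zero by `mul_conj_eq_zero`, so only the diagonal, and hence
the torus moment map, is seen. -/
theorem sum_moment (c : I → I → ℂ) (w : I → ℝ) (hc : ∀ i, c i i = w i)
    (hw : ∑ i, ∑ j, ∑ k, ∑ l, Complex.normSq (t i j k l) * w i = 0) :
    ∑ i, ∑ j, ∑ k, ∑ l, starRingEnd ℂ (t i j k l) * ∑ r, c i r * t r j k l = 0 := by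
  have : ∀ i j k l, starRingEnd ℂ (t i j k l) * ∑ r, c i r * t r j k l =
      ((Complex.normSq (t i j k l) * w i : ℝ) : ℂ) := by
    intro i j k l
    rw [Finset.mul_sum, Finset.sum_eq_single i]
    · rw [hc, Complex.ofReal_mul, Complex.normSq_eq_conj_mul_self]
      ring
    · intro r _ hr
      rw [mul_left_comm, h.mul_conj_eq_zero hr, mul_zero]
    · simp
  simp only [this]
  exact_mod_cast hw

theorem sum_moment_all (c : I → I → ℂ) (w : I → ℝ) (hc : ∀ i, c i i = w i)
    (hw : ∑ i, ∑ j, ∑ k, ∑ l, Complex.normSq (t i j k l) * w i = 0) :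
    ∑ i, ∑ j, ∑ k, ∑ l, starRingEnd ℂ (t i j k l) * ∑ r, (c i r * t r j k l + c j r * t i r k l
      + c k r * t i j r l + c l r * t i j k r) = 0 := by
  have e1 := h.sum_moment c w hc hw
  have e2 : ∑ i, ∑ j, ∑ k, ∑ l, starRingEnd ℂ (t i j k l) * ∑ r, c j r * t i r k l = 0 := by
    rw [Finset.sum_comm, ← e1]
    refine Finset.sum_congr rfl fun j _ => Finset.sum_congr rfl fun i _ =>
      Finset.sum_congr rfl fun k _ => Finset.sum_congr rfl fun l _ => ?_
    rw [h.antisymm j i, map_neg, neg_mul, ← mul_neg, ← Finset.sum_neg_distrib]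
    congr 1
    refine Finset.sum_congr rfl fun r _ => ?_
    rw [h.antisymm r i]; ring
  have e3 : ∑ i, ∑ j, ∑ k, ∑ l, starRingEnd ℂ (t i j k l) * ∑ r, c k r * t i j r l = 0 := by
    rw [sum_four_swap, ← e1]
    refine Finset.sum_congr rfl fun k _ => Finset.sum_congr rfl fun l _ =>
      Finset.sum_congr rfl fun i _ => Finset.sum_congr rfl fun j _ => ?_
    rw [h.symm k l i j]
    congr 1
    refine Finset.sum_congr rfl fun r _ => ?_
    rw [h.symm r l i j]
  have e4 : ∑ i, ∑ j, ∑ k, ∑ l, starRingEnd ℂ (t i j k l) * ∑ r, c l r * t i j k r = 0 := by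
    rw [← e3]
    refine Finset.sum_congr rfl fun i _ => Finset.sum_congr rfl fun j _ => ?_
    rw [Finset.sum_comm]
    refine Finset.sum_congr rfl fun l _ => Finset.sum_congr rfl fun k _ => ?_
    rw [h.antisymm_right i j l k, map_neg, neg_mul, ← mul_neg, ← Finset.sum_neg_distrib]
    congr 1
    refine Finset.sum_congr rfl fun r _ => ?_
    rw [h.antisymm_right i j r k]; ring
  simp only [Finset.sum_add_distrib, mul_add, e1, e2, e3, e4, add_zero]

open Matrix in
/-- If the moment map of the torus vanishes, the infinitesimal stabilizer of the tensor is closed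
under taking adjoints. -/
theorem conj_stabilizes (hbal : ∀ w : I → ℝ, (∀ i, w (star i) = -w i) →
      ∑ i, ∑ j, ∑ k, ∑ l, Complex.normSq (t i j k l) * w i = 0) (p q i j k l : I) :
    ∑ r, (starRingEnd ℂ (t p q (star i) r) * t r j k l
      + starRingEnd ℂ (t p q (star j) r) * t i r k l + starRingEnd ℂ (t p q (star k) r) * t i j r l
      + starRingEnd ℂ (t p q (star l) r) * t i j k r) = 0 := by
  let b : Matrix I I ℂ := Matrix.of fun i r => t p q i (star r)
  let v : (I × I) × (I × I) → ℂ := fun x => t x.1.1 x.1.2 x.2.1 x.2.2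
  have hb : double (double b) *ᵥ v = 0 := by
    ext ⟨⟨i, j⟩, ⟨k, l⟩⟩
    rw [double_double_mulVec]
    exact h.invariant p q i j k l
  have hskew : ∀ i r, b (star i) (star r) = -b r i := by
    intro i r
    simp only [b, Matrix.of_apply, h.star_star]
    rw [h.antisymm_right]
  -- These are the diagonal entries of [b, bᴴ]. They are odd under `star` because b is skew for the
  -- symmetric form, so the balance condition applies to them.
  let w : I → ℝ := fun i => ∑ r, (Complex.normSq (b i r) - Complex.normSq (b r i))
  have hw : ∀ i, w (star i) = -w i := by
    intro i
    simp only [w]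
    rw [← h.sum_star, ← Finset.sum_neg_distrib]
    refine Finset.sum_congr rfl fun r _ => ?_
    rw [hskew, hskew, Complex.normSq_neg, Complex.normSq_neg]
    ring
  have hc : ∀ i, (b * bᴴ - bᴴ * b) i i = w i := by
    intro i
    simp only [w, Matrix.sub_apply, Matrix.mul_apply, conjTranspose_apply, Complex.ofReal_sum,
      Complex.ofReal_sub, Complex.normSq_eq_conj_mul_self]
    rw [← Finset.sum_sub_distrib]
    refine Finset.sum_congr rfl fun r _ => ?_
    rw [mul_comm (b i r)]
    rfl
  have key := Matrix.conjTranspose_mulVec_eq_zero _ v hb (by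
    rw [double_conjTranspose, double_conjTranspose, double_commutator, double_commutator,
      dotProduct, Fintype.sum_prod_type, Fintype.sum_prod_type]
    simp only [Fintype.sum_prod_type]
    rw [← h.sum_moment_all (b * bᴴ - bᴴ * b) w hc (hbal w hw)]
    refine Finset.sum_congr rfl fun i _ => Finset.sum_congr rfl fun j _ =>
      Finset.sum_congr rfl fun k _ => Finset.sum_congr rfl fun l _ => ?_
    rw [double_double_mulVec]
    rfl)
  rw [double_conjTranspose, double_conjTranspose] at key
  have := congrFun key ((i, j), (k, l))
  rw [double_double_mulVec, Pi.zero_apply] at this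
  rw [← neg_eq_zero, ← this, ← Finset.sum_neg_distrib]
  refine Finset.sum_congr rfl fun r _ => ?_
  have hbs : ∀ i, bᴴ i r = -starRingEnd ℂ (t p q (star i) r) := by
    intro i
    rw [conjTranspose_apply, ← map_neg, ← h.antisymm_right]
    rfl
  simp only [hbs]
  ring

attribute [local instance] LieRing.ofAssociativeRing

theorem real_of_balanced (hbal : ∀ w : I → ℝ, (∀ i, w (star i) = -w i) →
      ∑ i, ∑ j, ∑ k, ∑ l, Complex.normSq (t i j k l) * w i = 0) (i j k l : I) :
    t (star i) (star j) (star k) (star l) = starRingEnd ℂ (t i j k l) := by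
  by_cases hij : j = star i
  · subst hij
    rw [h.cartan, h.cartan, h.m_star_left, h.m_star_right, neg_neg]
    by_cases hl : l = star k
    · rw [if_pos hl, if_pos (by rw [hl]), Complex.conj_ofReal]
    · rw [if_neg hl, if_neg (fun e => hl (h.star_inj.mp e)), map_zero]
  by_cases hX : X i j = 0
  · rw [h.matrix_eq_zero_iff.mp hX, h.matrix_eq_zero_iff.mp (h.matrix_star_eq_zero hX hij),
      map_zero]
  have hX' := h.matrix_star_ne_zero hX hij
  have hij' : star j ≠ star (star i) := fun e => hij (h.star_inj.mp e)
  -- Y is minus the entrywise conjugate of the transpose of b, where b is the coefficient matrix of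
  -- T(uᵢ, uⱼ) with rows as source indices; Y uses the transposed index convention. The previous
  -- lemma makes it stabilize the tensor. The goal is Y = X (star i) (star j).
  let τ : I → I → ℂ := fun a r => starRingEnd ℂ (t i j (star a) r)
  let Y : Matrix I I ℂ := Matrix.of fun a b => τ b a
  have hlie := h.lie_of_stabilizes (τ := τ) (fun k r => by
    simp only [τ, h.star_star]
    rw [h.antisymm_right, map_neg]) (h.conj_stabilizes hbal i j)
  have hτ : ∀ a r, τ a r ≠ 0 → ∀ p, m p r = m p a - m p i - m p j := by
    intro a r hne p
    have := h.weight ((map_ne_zero _).mp hne) p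
    rw [h.m_star_right] at this
    linarith
  have hYp : ∀ p, (⁅Y, X p (star p)⁆ : Matrix I I ℂ) = ((m p i + m p j : ℝ) : ℂ) • Y := by
    intro p
    ext a b
    rw [Ring.lie_def, h.cartan_matrix, Matrix.sub_apply, Matrix.mul_diagonal,
      Matrix.diagonal_mul, Matrix.smul_apply, smul_eq_mul]
    by_cases h0 : τ b a = 0
    · simp [Y, h0]
    · have := hτ b a h0 p
      simp only [Y, Matrix.of_apply]
      rw [this]
      push_cast
      ring
  -- Expanding the same commutator by invariance gives only matrices whose weight is that of X (star
  -- i) (star j), hence multiples of it.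
  have hspan : ∀ p, ∃ c : ℂ, (⁅Y, X p (star p)⁆ : Matrix I I ℂ) = c • X (star i) (star j) := by
    intro p
    have hmem : ⁅Y, X p (star p)⁆ ∈ Submodule.span ℂ {X (star i) (star j)} := by
      rw [hlie p (star p)]
      refine Submodule.sum_mem _ fun r _ => Submodule.add_mem _ ?_ ?_
      · by_cases h0 : τ p r = 0
        · rw [h0, zero_smul]; exact Submodule.zero_mem _
        · refine Submodule.smul_mem _ _ (Submodule.mem_span_singleton.mpr ⟨_,
            (h.proportional hX' hij' fun a => ?_).symm⟩)
          have := hτ p r h0 a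
          simp only [h.m_star_right]; linarith
      · by_cases h0 : τ (star p) r = 0
        · rw [h0, zero_smul]; exact Submodule.zero_mem _
        · refine Submodule.smul_mem _ _ (Submodule.mem_span_singleton.mpr ⟨_,
            (h.proportional hX' hij' fun a => ?_).symm⟩)
          have := hτ (star p) r h0 a
          simp only [h.m_star_right] at this ⊢; linarith
    obtain ⟨c, hc⟩ := Submodule.mem_span_singleton.mp hmem
    exact ⟨c, hc.symm⟩
  have hN := h.norm_ne_zero hX hij
  obtain ⟨ci, hci⟩ := hspan i
  obtain ⟨cj, hcj⟩ := hspan j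
  rw [hYp] at hci hcj
  -- Adding the cases p = i and p = j makes the coefficient of Y the norm of the weight, which is
  -- nonzero.
  have hNY : ((m i i + 2 * m i j + m j j : ℝ) : ℂ) • Y = (ci + cj) • X (star i) (star j) := by
    rw [add_smul, ← hci, ← hcj, ← add_smul, h.m_symm j i]
    congr 1
    push_cast
    ring
  set N : ℂ := ((m i i + 2 * m i j + m j j : ℝ) : ℂ) with hNdef
  have hN' : N ≠ 0 := by rw [hNdef]; exact_mod_cast hN
  have hY : ∀ a b, N * starRingEnd ℂ (t i j (star a) b)
      = (ci + cj) * t (star i) (star j) a (star b) := fun a b => congrFun (congrFun hNY b) a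
  -- At this entry both sides reduce to the real nonzero contraction 1/2 - m i j, which fixes the
  -- factor.
  have h1 := hY i (star j)
  rw [h.contract_star hX hij, Complex.conj_ofReal, h.star_star, h.symm,
    h.contract_star hX hij] at h1
  have hs : ((1 / 2 - m i j : ℝ) : ℂ) ≠ 0 := by
    exact_mod_cast h.contraction_ne_zero hX hij
  have hcN : N = ci + cj := mul_right_cancel₀ hs h1
  have h2 := hY (star k) l
  rw [← hcN, h.star_star] at h2
  exact (mul_left_cancel₀ hN' h2).symm

/-- A weight basis can be rescaled so that the tensor becomes real. -/
theorem exists_real : ∃ y : I → ℝ, (∀ i, y (star i) = -y i) ∧ ∀ i j k l,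
    (Real.exp (y (star i) + y (star j) + y (star k) + y (star l)) : ℂ)
        * t (star i) (star j) (star k) (star l) =
      starRingEnd ℂ ((Real.exp (y i + y j + y k + y l) : ℂ) * t i j k l) := by
  obtain ⟨y, hy, hbal⟩ := h.exists_balanced
  exact ⟨y, hy, (h.rescale y hy).real_of_balanced hbal⟩

end IsCurvatureTensor

/-! ### The grading of the superalgebra by `ad x` -/

namespace LieSuperalgebra

variable {L : Type*} [AddCommGroup L] [Module ℂ L] {g : LieSuperalgebra L}

section Basic

variable (g) in
theorem exists_even_odd (y : L) : ∃ y₀ ∈ g.even, ∃ y₁ ∈ g.odd, y = y₀ + y₁ := by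
  have : y ∈ g.part 0 ⊔ g.part 1 := by rw [g.isCompl.sup_eq_top]; trivial
  obtain ⟨y₀, h₀, y₁, h₁, rfl⟩ := Submodule.mem_sup.mp this
  exact ⟨y₀, h₀, y₁, h₁, rfl⟩

theorem eq_zero_of_even_odd {y : L} (h₀ : y ∈ g.even) (h₁ : y ∈ g.odd) : y = 0 :=
  Submodule.disjoint_def.mp g.isCompl.disjoint y h₀ h₁

theorem eq_zero_of_add_eq_zero {y₀ y₁ : L} (h₀ : y₀ ∈ g.even) (h₁ : y₁ ∈ g.odd)
    (h : y₀ + y₁ = 0) : y₀ = 0 ∧ y₁ = 0 := by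
  have e : y₀ = -y₁ := eq_neg_of_add_eq_zero_left h
  have h2 : y₀ = 0 := eq_zero_of_even_odd h₀ (e ▸ g.odd.neg_mem h₁)
  exact ⟨h2, by rw [h2, zero_add] at h; exact h⟩

theorem even_odd_mem {a b : L} (ha : a ∈ g.even) (hb : b ∈ g.odd) : g.bracket a b ∈ g.odd := by
  simpa using g.bracket_mem ha hb

theorem odd_even_mem {a b : L} (ha : a ∈ g.odd) (hb : b ∈ g.even) : g.bracket a b ∈ g.odd := by
  simpa using g.bracket_mem ha hb

theorem odd_odd_mem {a b : L} (ha : a ∈ g.odd) (hb : b ∈ g.odd) : g.bracket a b ∈ g.even := by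
  have := g.bracket_mem ha hb
  rwa [show (1 : ZMod 2) + 1 = 0 from rfl] at this

theorem skew_even {a : L} (ha : a ∈ g.even) (b : L) : g.bracket a b = -g.bracket b a := by
  obtain ⟨b₀, h₀, b₁, h₁, rfl⟩ := g.exists_even_odd b
  have e0 := g.skew ha h₀
  have e1 := g.skew ha h₁
  simp only [ZMod.val_zero, zero_mul, pow_zero, one_smul] at e0 e1
  rw [map_add, map_add, LinearMap.add_apply, e0, e1]
  abel

theorem skew_even_right {b : L} (hb : b ∈ g.even) (a : L) : g.bracket a b = -g.bracket b a := by
  rw [skew_even hb, neg_neg]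

theorem skew_odd {a b : L} (ha : a ∈ g.odd) (hb : b ∈ g.odd) : g.bracket a b = g.bracket b a := by
  have := g.skew ha hb
  simpa [ZMod.val_one] using this

theorem jacobi_even {a : L} (ha : a ∈ g.even) (b c : L) : g.bracket a (g.bracket b c) =
    g.bracket (g.bracket a b) c + g.bracket b (g.bracket a c) := by
  obtain ⟨b₀, h₀, b₁, h₁, rfl⟩ := g.exists_even_odd b
  have e0 := g.jacobi ha h₀ c
  have e1 := g.jacobi ha h₁ c
  simp only [ZMod.val_zero, zero_mul, pow_zero, one_smul] at e0 e1
  simp only [map_add, LinearMap.add_apply, e0, e1]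
  abel

theorem jacobi_odd {a b : L} (ha : a ∈ g.odd) (hb : b ∈ g.odd) (c : L) :
    g.bracket a (g.bracket b c) =
      g.bracket (g.bracket a b) c - g.bracket b (g.bracket a c) := by
  have := g.jacobi ha hb c
  simpa [ZMod.val_one, sub_eq_add_neg] using this

theorem mem_gr {x y : L} {c : ℂ} : y ∈ g.gr x c ↔ g.bracket x y = c • y :=
  Module.End.mem_eigenspace_iff

theorem gr_add {x y z : L} (hx : x ∈ g.even) {a b : ℂ} (hy : y ∈ g.gr x a) (hz : z ∈ g.gr x b) :
    g.bracket y z ∈ g.gr x (a + b) := by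
  rw [mem_gr] at *
  rw [jacobi_even hx, hy, hz, map_smul, map_smul, LinearMap.smul_apply, add_smul]

variable {B : LinearMap.BilinForm ℂ L}

theorem IsInvariantForm.symm_even (h : g.IsInvariantForm B) {a : L} (ha : a ∈ g.even) (b : L) :
    B a b = B b a := by
  obtain ⟨b₀, h₀, b₁, h₁, rfl⟩ := g.exists_even_odd b
  have e0 := h.supersymm ha h₀
  have e1 := h.supersymm ha h₁
  simp only [ZMod.val_zero, zero_mul, pow_zero, one_mul] at e0 e1
  rw [map_add, map_add, LinearMap.add_apply, e0, e1]

theorem IsInvariantForm.odd_even (h : g.IsInvariantForm B) {a b : L} (ha : a ∈ g.odd)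
    (hb : b ∈ g.even) : B a b = 0 := by
  rw [← h.symm_even hb, h.even_odd b hb a ha]

theorem IsInvariantForm.antisymm_odd (h : g.IsInvariantForm B) {a b : L} (ha : a ∈ g.odd)
    (hb : b ∈ g.odd) : B a b = -B b a := by
  have := h.supersymm ha hb
  simpa [ZMod.val_one] using this

theorem IsInvariantForm.eq_zero (h : g.IsInvariantForm B) {a : L} (ha : ∀ b, B a b = 0) : a = 0 :=
  h.nondegenerate.1 a ha

theorem IsInvariantForm.even_skew (h : g.IsInvariantForm B) {a : L} (ha : a ∈ g.even) (b c : L) :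
    B (g.bracket a b) c = -B b (g.bracket a c) := by
  rw [skew_even ha, map_neg, LinearMap.neg_apply, h.invariant]

theorem IsInvariantForm.gr_orthogonal (h : g.IsInvariantForm B) {x y z : L} (hx : x ∈ g.even)
    {a b : ℂ} (hy : y ∈ g.gr x a) (hz : z ∈ g.gr x b) (hab : a + b ≠ 0) : B y z = 0 := by
  rw [mem_gr] at *
  have := h.even_skew hx y z
  rw [hy, hz, map_smul, map_smul, LinearMap.smul_apply, smul_eq_mul, smul_eq_mul] at this
  have h2 : (a + b) * B y z = 0 := by linear_combination this
  exact (mul_eq_zero.mp h2).resolve_left hab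

end Basic

/-- The standing assumptions: a simple Lie superalgebra with an invariant form and a minimal
datum, such that the even part is `span {e, x, f} ⊕ g^♮`. -/
structure IsMinimalSetting (g : LieSuperalgebra L) (B : LinearMap.BilinForm ℂ L) (e x f : L) :
    Prop where
  simple : g.IsSimple
  form : g.IsInvariantForm B
  minimal : g.IsMinimalDatum e x f
  decomposes : g.EvenDecomposes e x f
  norm : B x x = 1 / 2

/-- The curvature map `T(u, v) = [[e, u], v] - ⟨u, v⟩ x`. -/
noncomputable def curvature (g : LieSuperalgebra L) (B : LinearMap.BilinForm ℂ L) (e x : L) :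
    L →ₗ[ℂ] L →ₗ[ℂ] L :=
  LinearMap.mk₂ ℂ (fun u v => g.bracket (g.bracket e u) v - g.halfForm B e u v • x)
    (fun a b c => by simp only [halfForm, map_add, LinearMap.add_apply, add_smul]; abel)
    (fun r a b => by
      simp only [halfForm, map_smul, LinearMap.smul_apply, smul_eq_mul, mul_smul, smul_sub])
    (fun a b c => by simp only [halfForm, map_add, add_smul]; abel)
    (fun r a b => by simp only [halfForm, map_smul, smul_eq_mul, mul_smul, smul_sub])

theorem curvature_apply (B : LinearMap.BilinForm ℂ L) (e x u v : L) : curvature g B e x u v =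
    g.bracket (g.bracket e u) v - g.halfForm B e u v • x := rfl

namespace IsMinimalSetting

variable {B : LinearMap.BilinForm ℂ L} {e x f : L} (S : IsMinimalSetting g B e x f)
include S

theorem e_mem : e ∈ g.even := S.minimal.triple.e_mem
theorem x_mem : x ∈ g.even := S.minimal.triple.x_mem
theorem f_mem : f ∈ g.even := S.minimal.triple.f_mem
theorem x_e : g.bracket x e = e := S.minimal.triple.x_e
theorem x_f : g.bracket x f = -f := S.minimal.triple.x_f
theorem e_f : g.bracket e f = x := S.minimal.triple.e_f
theorem e_x : g.bracket e x = -e := by rw [skew_even S.e_mem, S.x_e]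
theorem f_x : g.bracket f x = f := by rw [skew_even S.f_mem, S.x_f, neg_neg]
theorem f_e : g.bracket f e = -x := by rw [skew_even S.f_mem, S.e_f]

theorem x_x : g.bracket x x = 0 := g.bracket_self_of_even S.x_mem
theorem e_e : g.bracket e e = 0 := g.bracket_self_of_even S.e_mem
theorem f_f : g.bracket f f = 0 := g.bracket_self_of_even S.f_mem

theorem e_gr : e ∈ g.gr x 1 := by rw [mem_gr, S.x_e, one_smul]
theorem f_gr : f ∈ g.gr x (-1) := by rw [mem_gr, S.x_f, neg_one_smul]

theorem form_e_f : B e f = 1 / 2 := by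
  have := S.form.invariant e f x
  rw [S.e_f, S.f_x, S.norm] at this
  exact this.symm

theorem form_f_e : B f e = 1 / 2 := by rw [S.form.symm_even S.f_mem, S.form_e_f]

theorem form_e_e : B e e = 0 := S.form.gr_orthogonal S.x_mem S.e_gr S.e_gr (by norm_num)
theorem form_f_f : B f f = 0 := S.form.gr_orthogonal S.x_mem S.f_gr S.f_gr (by norm_num)
theorem form_e_x : B e x = 0 := by
  have := S.form.even_skew S.x_mem e x
  rwa [S.x_e, S.x_x, map_zero, neg_zero] at this
theorem form_x_e : B x e = 0 := by rw [S.form.symm_even S.x_mem, S.form_e_x]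
theorem form_f_x : B f x = 0 := by
  have := S.form.even_skew S.x_mem f x
  rw [S.x_f, S.x_x, map_zero, neg_zero, map_neg, LinearMap.neg_apply, neg_eq_zero] at this
  exact this
theorem form_x_f : B x f = 0 := by rw [S.form.symm_even S.x_mem, S.form_f_x]

omit S in
theorem mem_natural {a : L} : a ∈ g.natural e x f ↔
    a ∈ g.even ∧ g.bracket e a = 0 ∧ g.bracket x a = 0 ∧ g.bracket f a = 0 := by
  simp [natural, and_assoc]

omit S in
theorem natural_even {a : L} (ha : a ∈ g.natural e x f) : a ∈ g.even := (mem_natural.mp ha).1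

omit S in
theorem natural_e {a : L} (ha : a ∈ g.natural e x f) : g.bracket a e = 0 := by
  rw [skew_even (natural_even ha), (mem_natural.mp ha).2.1, neg_zero]

omit S in
theorem natural_x {a : L} (ha : a ∈ g.natural e x f) : g.bracket a x = 0 := by
  rw [skew_even (natural_even ha), (mem_natural.mp ha).2.2.1, neg_zero]

omit S in
theorem natural_f {a : L} (ha : a ∈ g.natural e x f) : g.bracket a f = 0 := by
  rw [skew_even (natural_even ha), (mem_natural.mp ha).2.2.2, neg_zero]

omit S in
theorem natural_bracket {a b : L} (ha : a ∈ g.natural e x f) (hb : b ∈ g.natural e x f)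
    (he : e ∈ g.even) (hx : x ∈ g.even) (hf : f ∈ g.even) :
    g.bracket a b ∈ g.natural e x f := by
  rw [mem_natural] at *
  refine ⟨g.bracket_even_mem ha.1 hb.1, ?_, ?_, ?_⟩
  · rw [jacobi_even he, ha.2.1, hb.2.1, map_zero, map_zero, LinearMap.zero_apply, add_zero]
  · rw [jacobi_even hx, ha.2.2.1, hb.2.2.1, map_zero, map_zero, LinearMap.zero_apply, add_zero]
  · rw [jacobi_even hf, ha.2.2.2, hb.2.2.2, map_zero, map_zero, LinearMap.zero_apply, add_zero]

theorem form_x_natural {a : L} (ha : a ∈ g.natural e x f) : B x a = 0 := by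
  have := S.form.invariant e f a
  rw [S.e_f, (mem_natural.mp ha).2.2.2, map_zero] at this
  exact this

theorem form_e_natural {a : L} (ha : a ∈ g.natural e x f) : B e a = 0 := by
  have := S.form.invariant x e a
  rw [S.x_e, (mem_natural.mp ha).2.1, map_zero] at this
  exact this

theorem form_f_natural {a : L} (ha : a ∈ g.natural e x f) : B f a = 0 := by
  have := S.form.invariant x f a
  rw [S.x_f, (mem_natural.mp ha).2.2.2, map_zero, map_neg, LinearMap.neg_apply,
    neg_eq_zero] at this
  exact this

theorem even_decomp {y : L} (hy : y ∈ g.even) : ∃ α β γ : ℂ, ∃ a ∈ g.natural e x f,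
    y = α • e + β • x + γ • f + a := by
  rw [← S.decomposes.2] at hy
  obtain ⟨s, hs, a, ha, rfl⟩ := Submodule.mem_sup.mp hy
  obtain ⟨α, β, γ, rfl⟩ := Submodule.mem_span_triple.mp hs
  exact ⟨α, β, γ, a, ha, rfl⟩

theorem x_even_decomp (α β γ : ℂ) {a : L} (ha : a ∈ g.natural e x f) :
    g.bracket x (α • e + β • x + γ • f + a) = α • e - γ • f := by
  simp only [map_add, map_smul, S.x_e, S.x_x, S.x_f, (mem_natural.mp ha).2.2.1]
  module

/-- On the even part A = `ad x` satisfies A³ = A, since it acts on e, x, f and `g^♮` by 1, 0, -1 and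
0. -/
theorem even_gr_eq_zero {y : L} (hy : y ∈ g.even) {c : ℂ} (hc : c ^ 3 ≠ c) (hyc : y ∈ g.gr x c) :
    y = 0 := by
  have hc' : c ^ 3 - c ≠ 0 := sub_ne_zero.mpr hc
  obtain ⟨α, β, γ, a, ha, rfl⟩ := S.even_decomp hy
  set y := α • e + β • x + γ • f + a with hy'
  have h1 : g.bracket x (g.bracket x (g.bracket x y)) = g.bracket x y := by
    rw [hy', S.x_even_decomp α β γ ha]
    simp only [map_sub, map_smul, S.x_e, S.x_f, map_neg, neg_neg]
  rw [mem_gr] at hyc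
  simp only [hyc, map_smul] at h1
  have h2 : (c ^ 3 - c) • y = 0 := by
    rw [sub_smul, sub_eq_zero, ← h1]
    simp only [smul_smul]
    congr 1
    ring
  exact (smul_eq_zero.mp h2).resolve_left hc'

theorem even_gr_zero {y : L} (hy : y ∈ g.even) (h0 : y ∈ g.gr x 0) :
    ∃ β : ℂ, ∃ a ∈ g.natural e x f, y = β • x + a := by
  obtain ⟨α, β, γ, a, ha, rfl⟩ := S.even_decomp hy
  rw [mem_gr, S.x_even_decomp α β γ ha, zero_smul] at h0
  have h1 : g.bracket x (α • e - γ • f) = 0 := by rw [h0, map_zero]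
  simp only [map_sub, map_smul, S.x_e, S.x_f] at h1
  refine ⟨β, a, ha, ?_⟩
  have h2 : (2 : ℂ) • α • e = 0 := by
    have : (2 : ℂ) • α • e = (α • e - γ • f) + (α • e - γ • (-f)) := by module
    rw [this, h0, h1, add_zero]
  have h3 : α • e = 0 := (smul_eq_zero.mp h2).resolve_left two_ne_zero
  rw [h3, zero_sub, neg_eq_zero] at h0
  rw [h3, h0]
  abel

theorem iSup_gr : ⨆ c : ℂ, g.gr x c = ⊤ :=
  top_le_iff.mp (S.minimal.diagonalizable ▸ iSup_le fun n : ℤ => le_iSup (g.gr x) ((n : ℂ) / 2))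

theorem gr_eq_bot_of_ne {c : ℂ} (hc : ∀ n : ℤ, (n : ℂ) / 2 ≠ c) : g.gr x c = ⊥ := by
  have hd := (Module.End.eigenspaces_iSupIndep (g.bracket x)) c
  have : ⨆ j, ⨆ (_ : j ≠ c), Module.End.eigenspace (g.bracket x) j = ⊤ := by
    rw [← top_le_iff, ← S.minimal.diagonalizable]
    exact iSup_le fun n => le_iSup₂_of_le ((n : ℂ) / 2) (hc n) le_rfl
  rw [this, disjoint_top] at hd
  exact hd

theorem gr_eq_bot {c : ℂ} (hc : ∀ n : ℤ, |n| ≤ 2 → (n : ℂ) / 2 ≠ c) : g.gr x c = ⊥ := by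
  by_cases h : ∃ n : ℤ, (n : ℂ) / 2 = c
  · obtain ⟨n, rfl⟩ := h
    refine S.minimal.gr_eq_bot n ?_
    by_contra hn
    exact hc n (not_lt.mp hn) rfl
  · push Not at h
    exact S.gr_eq_bot_of_ne h

theorem eq_zero_of_gr_orthogonal {z : L} {c : ℂ} (hz : z ∈ g.gr x c)
    (h : ∀ y ∈ g.gr x (-c), B z y = 0) : z = 0 := by
  refine S.form.eq_zero fun y => ?_
  have hle : (⊤ : Submodule ℂ L) ≤ LinearMap.ker (B z) := by
    rw [← S.iSup_gr]
    refine iSup_le fun d w hw => ?_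
    by_cases hd : d = -c
    · exact h w (hd ▸ hw)
    · refine S.form.gr_orthogonal S.x_mem hz hw fun e => hd ?_
      linear_combination e
  exact hle (Submodule.mem_top : y ∈ ⊤)

theorem odd_gr_neg_one {y : L} (hy : y ∈ g.odd) (h : y ∈ g.gr x (-1)) : y = 0 := by
  rw [S.minimal.gr_neg_one] at h
  obtain ⟨c, rfl⟩ := Submodule.mem_span_singleton.mp h
  exact eq_zero_of_even_odd (g.even.smul_mem c S.f_mem) hy

/-- The form pairs `g_1` only with `g_{-1}`, which is spanned by the even element f. -/
theorem odd_gr_one {y : L} (hy : y ∈ g.odd) (h : y ∈ g.gr x 1) : y = 0 := by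
  refine S.eq_zero_of_gr_orthogonal h fun z hz => ?_
  rw [S.minimal.gr_neg_one] at hz
  obtain ⟨c, rfl⟩ := Submodule.mem_span_singleton.mp hz
  exact S.form.odd_even hy (g.even.smul_mem c S.f_mem)

theorem gr_odd {y : L} {c : ℂ} (hc : c ^ 3 ≠ c) (hy : y ∈ g.gr x c) : y ∈ g.odd := by
  obtain ⟨y₀, h₀, y₁, h₁, rfl⟩ := g.exists_even_odd y
  rw [mem_gr] at hy
  have h2 : (g.bracket x y₀ - c • y₀) + (g.bracket x y₁ - c • y₁) = 0 := by
    rw [map_add, smul_add] at hy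
    rw [sub_add_sub_comm, hy, sub_self]
  have h3 := (eq_zero_of_add_eq_zero
    (g.even.sub_mem (g.bracket_even_mem S.x_mem h₀) (g.even.smul_mem c h₀))
    (g.odd.sub_mem (even_odd_mem S.x_mem h₁) (g.odd.smul_mem c h₁)) h2).1
  rw [S.even_gr_eq_zero h₀ hc (mem_gr.mpr (sub_eq_zero.mp h3)), zero_add]
  exact h₁

theorem neg_half_odd {u : L} (hu : u ∈ g.gr x (-1 / 2)) : u ∈ g.odd := S.gr_odd (by norm_num) hu
theorem half_odd {u : L} (hu : u ∈ g.gr x (1 / 2)) : u ∈ g.odd := S.gr_odd (by norm_num) hu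

theorem e_half {u : L} (hu : u ∈ g.gr x (-1 / 2)) : g.bracket e u ∈ g.gr x (1 / 2) := by
  have := gr_add S.x_mem S.e_gr hu
  norm_num at this ⊢
  exact this

theorem f_half {u : L} (hu : u ∈ g.gr x (1 / 2)) : g.bracket f u ∈ g.gr x (-1 / 2) := by
  have := gr_add S.x_mem S.f_gr hu
  norm_num at this ⊢
  exact this

theorem f_neg_half {u : L} (hu : u ∈ g.gr x (-1 / 2)) : g.bracket f u = 0 := by
  have := gr_add S.x_mem S.f_gr hu
  have h2 := S.minimal.gr_eq_bot (-3) (by norm_num)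
  norm_num at this h2
  rwa [h2, Submodule.mem_bot] at this

theorem e_pos_half {u : L} (hu : u ∈ g.gr x (1 / 2)) : g.bracket e u = 0 := by
  have := gr_add S.x_mem S.e_gr hu
  have h2 := S.minimal.gr_eq_bot 3 (by norm_num)
  norm_num at this h2
  rwa [h2, Submodule.mem_bot] at this

theorem f_e_neg_half {u : L} (hu : u ∈ g.gr x (-1 / 2)) :
    g.bracket f (g.bracket e u) = (1 / 2 : ℂ) • u := by
  rw [jacobi_even S.f_mem, S.f_e, S.f_neg_half hu, map_zero, map_neg, LinearMap.neg_apply,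
    mem_gr.mp hu]
  module

theorem e_f_pos_half {u : L} (hu : u ∈ g.gr x (1 / 2)) :
    g.bracket e (g.bracket f u) = (1 / 2 : ℂ) • u := by
  rw [jacobi_even S.e_mem, S.e_f, S.e_pos_half hu, map_zero, mem_gr.mp hu, add_zero]

theorem exists_e_eq {w : L} (hw : w ∈ g.gr x (1 / 2)) :
    ∃ u ∈ g.gr x (-1 / 2), w = g.bracket e u := by
  refine ⟨(2 : ℂ) • g.bracket f w, Submodule.smul_mem _ _ (S.f_half hw), ?_⟩
  rw [map_smul, S.e_f_pos_half hw, smul_smul]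
  norm_num

theorem natural_gr {a u : L} (ha : a ∈ g.natural e x f) {c : ℂ} (hu : u ∈ g.gr x c) :
    g.bracket a u ∈ g.gr x c := by
  have h0 : a ∈ g.gr x 0 := by rw [mem_gr, (mem_natural.mp ha).2.2.1, zero_smul]
  have := gr_add S.x_mem h0 hu
  rwa [zero_add] at this

omit S in
theorem natural_e_bracket {a : L} (ha : a ∈ g.natural e x f) (u : L) :
    g.bracket a (g.bracket e u) = g.bracket e (g.bracket a u) := by
  rw [jacobi_even (natural_even ha), natural_e ha, map_zero, LinearMap.zero_apply, zero_add]

end IsMinimalSetting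

/-! ### Consequences of simplicity -/

theorem bracket_even_odd_eq_zero {i : ZMod 2} {a y₀ y₁ : L} (ha : a ∈ g.part i) (h₀ : y₀ ∈ g.even)
    (h₁ : y₁ ∈ g.odd) (h : g.bracket a (y₀ + y₁) = 0) :
    g.bracket a y₀ = 0 ∧ g.bracket a y₁ = 0 := by
  rw [map_add] at h
  have hi : ∀ i : ZMod 2, i = 0 ∨ i = 1 := by decide
  rcases hi i with rfl | rfl
  · exact eq_zero_of_add_eq_zero (g.bracket_even_mem ha h₀) (even_odd_mem ha h₁) h
  · rw [add_comm] at h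
    exact (eq_zero_of_add_eq_zero (odd_odd_mem ha h₁) (odd_even_mem ha h₀) h).symm

/-- The centralizer of a family of homogeneous elements. -/
def centralizer (g : LieSuperalgebra L) (W : Set L) : Submodule ℂ L where
  carrier := {y | ∀ w ∈ W, g.bracket w y = 0}
  add_mem' ha hb w hw := by rw [map_add, ha w hw, hb w hw, add_zero]
  zero_mem' w _ := map_zero _
  smul_mem' c y hy w hw := by rw [map_smul, hy w hw, smul_zero]

namespace IsMinimalSetting

variable {B : LinearMap.BilinForm ℂ L} {e x f : L} (S : IsMinimalSetting g B e x f)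
include S

/-- An odd element is the sum of elements of `g_{-1/2}`, `g_{1/2}` and `g_0`. -/
theorem odd_decomp [FiniteDimensional ℂ L] {y : L} (hy : y ∈ g.odd) :
    ∃ u ∈ g.gr x (-1 / 2), ∃ w ∈ g.gr x (1 / 2), ∃ n ∈ g.odd ⊓ g.gr x 0, y = u + w + n := by
  have hinv : ∀ z ∈ g.odd, g.bracket x z ∈ g.odd := fun z hz => even_odd_mem S.x_mem hz
  have h1 := Submodule.inf_iSup_genEigenspace (K := ℂ) (k := 1) (p := g.odd) (f := g.bracket x)
    hinv
  have htop : ⨆ μ, Module.End.genEigenspace (g.bracket x) μ 1 = ⊤ := S.iSup_gr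
  rw [htop, inf_top_eq] at h1
  have hle : g.odd ≤ g.gr x (-1 / 2) ⊔ g.gr x (1 / 2) ⊔ (g.odd ⊓ g.gr x 0) := by
    rw [h1]
    refine iSup_le fun c => ?_
    change g.odd ⊓ g.gr x c ≤ _
    by_cases h2 : c = -1 / 2
    · subst h2; exact inf_le_right.trans (le_sup_left.trans le_sup_left)
    by_cases h3 : c = 1 / 2
    · subst h3; exact inf_le_right.trans (le_sup_right.trans le_sup_left)
    by_cases h4 : c = 0
    · subst h4; rw [← h1]; exact le_sup_right
    by_cases h5 : c = 1
    · subst h5; intro z hz; rw [S.odd_gr_one hz.1 hz.2]; exact Submodule.zero_mem _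
    by_cases h6 : c = -1
    · subst h6; intro z hz; rw [S.odd_gr_neg_one hz.1 hz.2]; exact Submodule.zero_mem _
    have : g.gr x c = ⊥ := S.gr_eq_bot fun n hn hnc => by
      rw [abs_le] at hn
      have : n = -2 ∨ n = -1 ∨ n = 0 ∨ n = 1 ∨ n = 2 := by omega
      rcases this with rfl | rfl | rfl | rfl | rfl
      · exact h6 (by rw [← hnc]; norm_num)
      · exact h2 (by rw [← hnc]; norm_num)
      · exact h4 (by rw [← hnc]; norm_num)
      · exact h3 (by rw [← hnc]; norm_num)
      · exact h5 (by rw [← hnc]; norm_num)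
    rw [this, inf_bot_eq]
    exact bot_le
  obtain ⟨uw, huw, n, hn, rfl⟩ := Submodule.mem_sup.mp (hle hy)
  obtain ⟨u, hu, w, hw, rfl⟩ := Submodule.mem_sup.mp huw
  exact ⟨u, hu, w, hw, n, hn, rfl⟩

variable [FiniteDimensional ℂ L]

/-- This centralizer is a graded ideal, and it misses f because [x, f] = -f, so simplicity makes it
zero. Elements of `g^♮` preserve the centralized set; the other components of an arbitrary element
lie in its span or commute with all of it. -/
theorem centralizer_eq_bot :
    g.centralizer ({e, x, f} ∪ (g.gr x (-1 / 2) ∪ g.gr x (1 / 2))) = ⊥ := by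
  set W : Set L := {e, x, f} ∪ (g.gr x (-1 / 2) ∪ g.gr x (1 / 2)) with hW
  have heW : e ∈ W := by simp [hW]
  have hxW : x ∈ W := by simp [hW]
  have hfW : f ∈ W := by simp [hW]
  have huW : ∀ u ∈ g.gr x (-1 / 2), u ∈ W := fun u hu => Or.inr (Or.inl hu)
  have hwW : ∀ u ∈ g.gr x (1 / 2), u ∈ W := fun u hu => Or.inr (Or.inr hu)
  have hcases : ∀ w ∈ W, (w ∈ g.even ∧ (w = e ∨ w = x ∨ w = f)) ∨
      (w ∈ g.odd ∧ (w ∈ g.gr x (-1 / 2) ∨ w ∈ g.gr x (1 / 2))) := by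
    rintro w ((rfl | rfl | rfl) | (hw | hw))
    · exact Or.inl ⟨S.e_mem, Or.inl rfl⟩
    · exact Or.inl ⟨S.x_mem, Or.inr (Or.inl rfl)⟩
    · exact Or.inl ⟨S.f_mem, Or.inr (Or.inr rfl)⟩
    · exact Or.inr ⟨S.neg_half_odd hw, Or.inl hw⟩
    · exact Or.inr ⟨S.half_odd hw, Or.inr hw⟩
  have hhom : ∀ w ∈ W, ∃ i, w ∈ g.part i := fun w hw =>
    (hcases w hw).elim (fun h => ⟨0, h.1⟩) (fun h => ⟨1, h.1⟩)
  have hideal : g.IsGradedIdeal (g.centralizer W) := by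
    refine ⟨le_antisymm ?_ (sup_le inf_le_left inf_le_left), ?_⟩
    · intro y hy
      obtain ⟨y₀, h₀, y₁, h₁, rfl⟩ := g.exists_even_odd y
      refine Submodule.add_mem_sup ⟨fun w hw => ?_, h₀⟩ ⟨fun w hw => ?_, h₁⟩
      · obtain ⟨i, hi⟩ := hhom w hw
        exact (bracket_even_odd_eq_zero hi h₀ h₁ (hy w hw)).1
      · obtain ⟨i, hi⟩ := hhom w hw
        exact (bracket_even_odd_eq_zero hi h₀ h₁ (hy w hw)).2
    · intro a y hy
      obtain ⟨a₀, h₀, a₁, h₁, rfl⟩ := g.exists_even_odd a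
      obtain ⟨α, β, γ, b, hb, rfl⟩ := S.even_decomp h₀
      obtain ⟨u, hu, w, hw, n, hn, rfl⟩ := S.odd_decomp h₁
      have hby : g.bracket b y ∈ g.centralizer W := by
        intro v hv
        rcases hcases v hv with ⟨hv0, rfl | rfl | rfl⟩ | ⟨_, hv1⟩
        · rw [jacobi_even hv0, (mem_natural.mp hb).2.1, hy v hv, map_zero, LinearMap.map_zero,
            LinearMap.zero_apply, zero_add]
        · rw [jacobi_even hv0, (mem_natural.mp hb).2.2.1, hy v hv, map_zero, LinearMap.map_zero,
            LinearMap.zero_apply, zero_add]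
        · rw [jacobi_even hv0, (mem_natural.mp hb).2.2.2, hy v hv, map_zero, LinearMap.map_zero,
            LinearMap.zero_apply, zero_add]
        · have hbv : g.bracket b v ∈ W := hv1.elim (fun h => huW _ (S.natural_gr hb h))
            (fun h => hwW _ (S.natural_gr hb h))
          have := jacobi_even (natural_even hb) v y
          rw [hy v hv, map_zero, hy _ hbv, zero_add] at this
          exact this.symm
      -- An odd n of degree 0 commutes with the whole set: [e, n] and [f, n] are odd of degree ±1,
      -- and brackets with degree ±1/2 are even of half-integral degree.
      have hny : g.bracket n y ∈ g.centralizer W := by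
        have hn0 : n ∈ g.gr x 0 := hn.2
        have hen : g.bracket e n = 0 := S.odd_gr_one (even_odd_mem S.e_mem hn.1) (by
          simpa using gr_add S.x_mem S.e_gr hn0)
        have hfn : g.bracket f n = 0 := S.odd_gr_neg_one (even_odd_mem S.f_mem hn.1) (by
          simpa using gr_add S.x_mem S.f_gr hn0)
        have hxn : g.bracket x n = 0 := by rw [mem_gr.mp hn0, zero_smul]
        intro v hv
        rcases hcases v hv with ⟨hv0, rfl | rfl | rfl⟩ | ⟨hv1, hv2⟩
        · rw [jacobi_even hv0, hen, hy v hv, map_zero, LinearMap.map_zero,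
            LinearMap.zero_apply, zero_add]
        · rw [jacobi_even hv0, hxn, hy v hv, map_zero, LinearMap.map_zero,
            LinearMap.zero_apply, zero_add]
        · rw [jacobi_even hv0, hfn, hy v hv, map_zero, LinearMap.map_zero,
            LinearMap.zero_apply, zero_add]
        · have hnv : g.bracket n v = 0 := by
            have hev := odd_odd_mem hn.1 hv1
            rcases hv2 with h | h
            · have := gr_add S.x_mem hn0 h
              exact S.even_gr_eq_zero hev (by norm_num) this
            · have := gr_add S.x_mem hn0 h
              exact S.even_gr_eq_zero hev (by norm_num) this
          have := jacobi_odd hn.1 hv1 y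
          rw [hy v hv, hnv, map_zero, LinearMap.map_zero, LinearMap.zero_apply, zero_sub] at this
          exact neg_eq_zero.mp this.symm
      simp only [map_add, map_smul, LinearMap.add_apply, LinearMap.smul_apply, hy e heW, hy x hxW,
        hy f hfW, hy u (huW u hu), hy w (hwW w hw), smul_zero, zero_add, add_zero]
      exact Submodule.add_mem _ hby hny
  refine (S.simple.2 _ hideal).resolve_right fun htop => ?_
  have hf : f ∈ g.centralizer W := htop ▸ Submodule.mem_top
  have := hf x hxW
  rw [S.x_f, neg_eq_zero] at this
  exact S.minimal.triple.f_ne_zero this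

/-- Such an element lies in the centralizer above, by parity and degree. Thus the odd part is V ⊕
[e, V]. -/
theorem odd_gr_zero {n : L} (hn : n ∈ g.odd) (hn0 : n ∈ g.gr x 0) : n = 0 := by
  rw [← Submodule.mem_bot ℂ, ← S.centralizer_eq_bot]
  have hW : ∀ v ∈ g.odd, ∀ c : ℂ, c ^ 3 ≠ c → v ∈ g.gr x c → g.bracket v n = 0 := by
    intro v hv c hc hvc
    refine S.even_gr_eq_zero (odd_odd_mem hv hn) hc ?_
    simpa using gr_add S.x_mem hvc hn0
  rintro v ((rfl | rfl | rfl) | (hv | hv))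
  · exact S.odd_gr_one (even_odd_mem S.e_mem hn) (by simpa using gr_add S.x_mem S.e_gr hn0)
  · rw [mem_gr.mp hn0, zero_smul]
  · exact S.odd_gr_neg_one (even_odd_mem S.f_mem hn) (by simpa using gr_add S.x_mem S.f_gr hn0)
  · exact hW v (S.neg_half_odd hv) _ (by norm_num) hv
  · exact hW v (S.half_odd hv) _ (by norm_num) hv

/-- `g^♮` acts faithfully on `g_{-1/2}`. -/
theorem natural_eq_zero {a : L} (ha : a ∈ g.natural e x f)
    (h : ∀ u ∈ g.gr x (-1 / 2), g.bracket a u = 0) : a = 0 := by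
  rw [← Submodule.mem_bot ℂ, ← S.centralizer_eq_bot]
  rintro v ((rfl | rfl | rfl) | (hv | hv))
  · exact (mem_natural.mp ha).2.1
  · exact (mem_natural.mp ha).2.2.1
  · exact (mem_natural.mp ha).2.2.2
  · rw [skew_even_right (natural_even ha), h v hv, neg_zero]
  · obtain ⟨u, hu, rfl⟩ := S.exists_e_eq hv
    rw [skew_even_right (natural_even ha), natural_e_bracket ha, h u hu, map_zero, neg_zero]

theorem odd_decomp' {y : L} (hy : y ∈ g.odd) : ∃ u ∈ g.gr x (-1 / 2), ∃ v ∈ g.gr x (-1 / 2),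
    y = u + g.bracket e v := by
  obtain ⟨u, hu, w, hw, n, hn, rfl⟩ := S.odd_decomp hy
  obtain ⟨v, hv, rfl⟩ := S.exists_e_eq hw
  exact ⟨u, hu, v, hv, by rw [S.odd_gr_zero hn.1 hn.2, add_zero]⟩

theorem exists_decomp (y : L) : ∃ α β γ : ℂ, ∃ a ∈ g.natural e x f, ∃ u ∈ g.gr x (-1 / 2),
    ∃ v ∈ g.gr x (-1 / 2), y = α • e + β • x + γ • f + a + (u + g.bracket e v) := by
  obtain ⟨y₀, h₀, y₁, h₁, rfl⟩ := g.exists_even_odd y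
  obtain ⟨α, β, γ, a, ha, rfl⟩ := S.even_decomp h₀
  obtain ⟨u, hu, v, hv, rfl⟩ := S.odd_decomp' h₁
  exact ⟨α, β, γ, a, ha, u, hu, v, hv, rfl⟩

/-! ### The form on `g_{-1/2}` and the identities of the curvature map -/

omit S [FiniteDimensional ℂ L] in
theorem halfForm_eq (hB : g.IsInvariantForm B) (u v : L) :
    g.halfForm B e u v = B (g.bracket e u) v := (hB.invariant e u v).symm

omit [FiniteDimensional ℂ L] in
theorem halfForm_symm {u v : L} (hu : u ∈ g.gr x (-1 / 2)) (hv : v ∈ g.gr x (-1 / 2)) :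
    g.halfForm B e u v = g.halfForm B e v u := by
  rw [halfForm, halfForm, skew_odd (S.neg_half_odd hu) (S.neg_half_odd hv)]

-- ⟨u, v⟩ = (e.u|v), and `g_{1/2}` pairs nondegenerately with `g_{-1/2}`. The map `ad e` is
-- injective on `g_{-1/2}` because `ad f` inverts it up to 1/2.
omit [FiniteDimensional ℂ L] in
theorem eq_zero_of_halfForm {u : L} (hu : u ∈ g.gr x (-1 / 2))
    (h : ∀ v ∈ g.gr x (-1 / 2), g.halfForm B e u v = 0) : u = 0 := by
  have h1 : g.bracket e u = 0 := by
    refine S.eq_zero_of_gr_orthogonal (S.e_half hu) fun v hv => ?_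
    rw [← halfForm_eq S.form]
    exact h v (by convert hv using 2; norm_num)
  have h2 := S.f_e_neg_half hu
  rw [h1, map_zero] at h2
  exact (smul_eq_zero.mp h2.symm).resolve_left (by norm_num)

omit [FiniteDimensional ℂ L] in
theorem bracket_neg_half {u v : L} (hu : u ∈ g.gr x (-1 / 2)) (hv : v ∈ g.gr x (-1 / 2)) :
    g.bracket u v = (2 * g.halfForm B e u v) • f := by
  have h1 := gr_add S.x_mem hu hv
  norm_num at h1
  rw [S.minimal.gr_neg_one] at h1
  obtain ⟨c, hc⟩ := Submodule.mem_span_singleton.mp h1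
  rw [halfForm, ← hc, map_smul, S.form_e_f, smul_eq_mul]
  congr 1
  ring

omit [FiniteDimensional ℂ L] in
theorem e_neg_half_bracket {u v : L} (hu : u ∈ g.gr x (-1 / 2)) (hv : v ∈ g.gr x (-1 / 2)) :
    g.bracket (g.bracket e u) v + g.bracket (g.bracket e v) u = (2 * g.halfForm B e u v) • x := by
  have h1 := jacobi_even S.e_mem u v
  rw [S.bracket_neg_half hu hv, map_smul, S.e_f,
    skew_odd (S.neg_half_odd hu) (S.half_odd (S.e_half hv))] at h1
  exact h1.symm

-- The even degree-0 part is ℂx ⊕ `g^♮`, and pairing with x identifies the subtracted term as the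
-- x-component.
omit [FiniteDimensional ℂ L] in
theorem curvature_mem {u v : L} (hu : u ∈ g.gr x (-1 / 2)) (hv : v ∈ g.gr x (-1 / 2)) :
    curvature g B e x u v ∈ g.natural e x f := by
  have hev : g.bracket (g.bracket e u) v ∈ g.even :=
    odd_odd_mem (S.half_odd (S.e_half hu)) (S.neg_half_odd hv)
  have hgr := gr_add S.x_mem (S.e_half hu) hv
  norm_num at hgr
  obtain ⟨β, a, ha, hβ⟩ := S.even_gr_zero hev hgr
  have h1 := S.form.invariant x (g.bracket e u) v
  rw [mem_gr.mp (S.e_half hu), hβ, map_add, map_smul (B x), S.norm, S.form_x_natural ha, map_smul,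
    LinearMap.smul_apply, ← halfForm_eq S.form, smul_eq_mul, smul_eq_mul] at h1
  have h2 : g.halfForm B e u v = β := by linear_combination 2 * h1
  rw [curvature_apply, hβ, h2, add_sub_cancel_left]
  exact ha

omit S [FiniteDimensional ℂ L] in
theorem e_bracket_eq (u v : L) : g.bracket (g.bracket e u) v =
    g.halfForm B e u v • x + curvature g B e x u v := by
  rw [curvature_apply]; abel

omit [FiniteDimensional ℂ L] in
theorem curvature_antisymm {u v : L} (hu : u ∈ g.gr x (-1 / 2)) (hv : v ∈ g.gr x (-1 / 2)) :
    curvature g B e x v u = -curvature g B e x u v := by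
  have h1 := S.e_neg_half_bracket hu hv
  rw [e_bracket_eq (B := B) (x := x) u v, e_bracket_eq (B := B) (x := x) v u,
    S.halfForm_symm hv hu] at h1
  rw [eq_neg_iff_add_eq_zero]
  have : curvature g B e x v u + curvature g B e x u v =
    (g.halfForm B e u v • x + curvature g B e x u v + (g.halfForm B e u v • x
      + curvature g B e x v u)) - (2 * g.halfForm B e u v) • x := by module
  rw [this, h1, sub_self]

-- This is the Jacobi identity for [e, u], v, w, after [v, w] = 2⟨v, w⟩ f and [[e, u], f] = -u/2.
omit [FiniteDimensional ℂ L] in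
theorem curvature_cyclic {u v w : L} (hu : u ∈ g.gr x (-1 / 2)) (hv : v ∈ g.gr x (-1 / 2))
    (hw : w ∈ g.gr x (-1 / 2)) :
    g.bracket (curvature g B e x u v) w + g.bracket (curvature g B e x u w) v =
      (1 / 2 * g.halfForm B e u v) • w + (1 / 2 * g.halfForm B e u w) • v
        - g.halfForm B e v w • u := by
  have h1 := jacobi_odd (S.half_odd (S.e_half hu)) (S.neg_half_odd hv) w
  have h2 : g.bracket (g.bracket e u) f = (-1 / 2 : ℂ) • u := by
    rw [skew_even_right S.f_mem, S.f_e_neg_half hu]; module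
  have hTw := natural_even (S.curvature_mem hu hw)
  rw [S.bracket_neg_half hv hw, map_smul, h2, e_bracket_eq (B := B) (x := x) u v,
    e_bracket_eq (B := B) (x := x) u w, map_add,
    map_add, LinearMap.add_apply, map_smul, map_smul, LinearMap.smul_apply, mem_gr.mp hw,
    skew_even_right S.x_mem, mem_gr.mp hv, skew_even_right hTw v] at h1
  have : g.bracket (curvature g B e x u v) w + g.bracket (curvature g B e x u w) v =
    (g.halfForm B e u v • (-1 / 2 : ℂ) • w + g.bracket (curvature g B e x u v) w
      - (g.halfForm B e u w • -((-1 / 2 : ℂ) • v) + -g.bracket (curvature g B e x u w) v))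
    + (1 / 2 * g.halfForm B e u v) • w + (1 / 2 * g.halfForm B e u w) • v := by module
  rw [this, ← h1]
  module

-- T is thus dual to the action of `g^♮` on V. Pair symmetry of the four-tensor, and the
-- nondegeneracy used to show that the T(u, v) span, both come from here.
omit [FiniteDimensional ℂ L] in
theorem form_curvature {a : L} (ha : a ∈ g.natural e x f) (u v : L) :
    B a (curvature g B e x u v) = g.halfForm B e (g.bracket a u) v := by
  rw [curvature_apply, map_sub, map_smul, ← S.form.invariant, natural_e_bracket ha,
    S.form.symm_even (natural_even ha), S.form_x_natural ha, smul_zero, sub_zero,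
    halfForm_eq S.form]

omit [FiniteDimensional ℂ L] in
theorem halfForm_skew {a : L} (ha : a ∈ g.natural e x f) (u v : L) :
    g.halfForm B e (g.bracket a u) v = -g.halfForm B e u (g.bracket a v) := by
  rw [halfForm_eq S.form, halfForm_eq S.form, ← natural_e_bracket ha,
    S.form.even_skew (natural_even ha)]

omit [FiniteDimensional ℂ L] in
theorem bracket_curvature {a : L} (ha : a ∈ g.natural e x f) (u v : L) :
    g.bracket a (curvature g B e x u v) = curvature g B e x (g.bracket a u) v
      + curvature g B e x u (g.bracket a v) := by
  rw [curvature_apply, curvature_apply, curvature_apply, map_sub, map_smul, natural_x ha,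
    jacobi_even (natural_even ha), natural_e_bracket ha, S.halfForm_skew ha]
  module

theorem form_natural_eq_zero {a : L} (ha : a ∈ g.natural e x f)
    (h : ∀ u ∈ g.gr x (-1 / 2), ∀ v ∈ g.gr x (-1 / 2), B a (curvature g B e x u v) = 0) :
    a = 0 := by
  refine S.natural_eq_zero ha fun u hu => S.eq_zero_of_halfForm (S.natural_gr ha hu) fun v hv => ?_
  rw [← S.form_curvature ha]
  exact h u hu v hv

end IsMinimalSetting

end LieSuperalgebra

/-! ### Simultaneous diagonalization and self-dual weight bases -/

theorem Module.End.maxGenEigenspace_eq_eigenspace_of_iSup_eq_top {V : Type*} [AddCommGroup V]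
    [Module ℂ V] (A : Module.End ℂ V) (h : ⨆ c : ℂ, Module.End.eigenspace A c = ⊤) (c : ℂ) :
    A.maxGenEigenspace c = A.eigenspace c := by
  have hle : ∀ d, A.eigenspace d ≤ A.maxGenEigenspace d := fun d =>
    (A.genEigenspace d).monotone le_top
  refine le_antisymm ?_ (hle c)
  have hind := A.independent_maxGenEigenspace c
  have htop : A.eigenspace c ⊔ ⨆ d, ⨆ (_ : d ≠ c), A.eigenspace d = ⊤ := by
    rw [← top_le_iff, ← h]
    refine iSup_le fun d => ?_
    by_cases hd : d = c
    · subst hd; exact le_sup_left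
    · exact le_sup_of_le_right (le_iSup₂_of_le d hd le_rfl)
  calc A.maxGenEigenspace c = (A.eigenspace c ⊔ ⨆ d, ⨆ (_ : d ≠ c), A.eigenspace d)
        ⊓ A.maxGenEigenspace c := by rw [htop, top_inf_eq]
    _ = A.eigenspace c ⊔ (⨆ d, ⨆ (_ : d ≠ c), A.eigenspace d) ⊓ A.maxGenEigenspace c :=
        sup_inf_assoc_of_le _ (hle c)
    _ ≤ A.eigenspace c ⊔ ⊥ := by
        refine sup_le_sup_left ?_ _
        refine (inf_le_inf_right _ (iSup₂_mono fun d _ => hle d)).trans ?_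
        rw [inf_comm]
        exact hind.le_bot
    _ = A.eigenspace c := sup_bot_eq _

/-- Commuting diagonalizable endomorphisms are simultaneously diagonalizable. -/
theorem Module.End.span_joint_eigenvectors {ι V : Type*} [AddCommGroup V] [Module ℂ V]
    [FiniteDimensional ℂ V] (A : ι → Module.End ℂ V) (hcomm : ∀ i j, Commute (A i) (A j))
    (hdiag : ∀ i, ⨆ c : ℂ, Module.End.eigenspace (A i) c = ⊤) :
    Submodule.span ℂ {y | ∃ χ : ι → ℂ, ∀ i, A i y = χ i • y} = ⊤ := by
  have hss := fun i => (A i).maxGenEigenspace_eq_eigenspace_of_iSup_eq_top (hdiag i)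
  have h := Module.End.iSup_iInf_maxGenEigenspace_eq_top_of_iSup_maxGenEigenspace_eq_top_of_commute
    A (fun i j _ => hcomm i j) (fun i => by simp only [hss]; exact hdiag i)
  rw [← top_le_iff, ← h]
  refine iSup_le fun χ y hy => Submodule.subset_span ⟨χ, fun i => ?_⟩
  have := (Submodule.mem_iInf _).mp hy i
  rw [hss] at this
  exact Module.End.mem_eigenspace_iff.mp this

/-- Simultaneous diagonalization on an invariant subspace. -/
theorem Module.End.le_span_joint_eigenvectors {ι V : Type*} [AddCommGroup V] [Module ℂ V]
    [FiniteDimensional ℂ V] (A : ι → Module.End ℂ V) (p : Submodule ℂ V)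
    (hp : ∀ i, ∀ y ∈ p, A i y ∈ p) (hcomm : ∀ i j, ∀ y ∈ p, A i (A j y) = A j (A i y))
    (hdiag : ∀ i, ⨆ c : ℂ, Module.End.eigenspace (A i) c = ⊤) :
    p ≤ Submodule.span ℂ {y | y ∈ p ∧ ∃ χ : ι → ℂ, ∀ i, A i y = χ i • y} := by
  have h := Module.End.span_joint_eigenvectors (fun i => (A i).restrict (hp i))
    (fun i j => LinearMap.ext fun y => Subtype.ext (hcomm i j y y.2))
    (fun i => Module.End.genEigenspace_restrict_eq_top (k := 1) (hp i) (hdiag i))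
  intro y hy
  have hy' : (⟨y, hy⟩ : p) ∈ Submodule.span ℂ
      {z : p | ∃ χ : ι → ℂ, ∀ i, (A i).restrict (hp i) z = χ i • z} := h ▸ Submodule.mem_top
  have := Submodule.mem_map_of_mem (f := p.subtype) hy'
  rw [Submodule.map_span] at this
  refine Submodule.span_mono ?_ this
  rintro _ ⟨z, ⟨χ, hχ⟩, rfl⟩
  exact ⟨z.2, χ, fun i => congrArg Subtype.val (hχ i)⟩

/-- A self-dual family of joint eigenvectors in the subspace `p`. -/
structure IsWeightFamily {ι E I : Type*} [AddCommGroup E] [Module ℂ E] [DecidableEq I]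
    (p : Submodule ℂ E) (b : LinearMap.BilinForm ℂ E) (A : ι → Module.End ℂ E)
    (u : I → E) (star : I → I) (χ : I → ι → ℂ) : Prop where
  mem : ∀ i, u i ∈ p
  star_star : ∀ i, star (star i) = i
  dual : ∀ i j, b (u i) (u j) = if j = star i then 1 else 0
  weight : ∀ i k, A k (u i) = χ i k • u i

namespace IsWeightFamily

variable {ι E I : Type*} [AddCommGroup E] [Module ℂ E] [DecidableEq I] {p : Submodule ℂ E}
  {b : LinearMap.BilinForm ℂ E} {A : ι → Module.End ℂ E} {u : I → E} {star : I → I}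
  {χ : I → ι → ℂ}

theorem form_sum_left [Fintype I] (h : IsWeightFamily p b A u star χ) (c : I → ℂ) (j : I) :
    b (∑ i, c i • u i) (u (star j)) = c j := by
  simp only [map_sum, LinearMap.sum_apply, map_smul, LinearMap.smul_apply, h.dual, smul_eq_mul]
  rw [Finset.sum_eq_single j]
  · rw [if_pos rfl, mul_one]
  · intro i _ hij
    rw [if_neg, mul_zero]
    intro e
    exact hij (by rw [← h.star_star i, ← e, h.star_star])
  · simp

theorem linearIndependent [Fintype I] (h : IsWeightFamily p b A u star χ) :
    LinearIndependent ℂ u := by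
  rw [Fintype.linearIndependent_iff]
  intro c hc j
  rw [← h.form_sum_left c j, hc, map_zero, LinearMap.zero_apply]

theorem weight_star (h : IsWeightFamily p b A u star χ)
    (hskew : ∀ k, ∀ y ∈ p, ∀ z ∈ p, b (A k y) z = -b y (A k z)) (i : I) (k : ι) :
    χ (star i) k = -χ i k := by
  have := hskew k _ (h.mem i) _ (h.mem (star i))
  rw [h.weight, h.weight, map_smul, map_smul, LinearMap.smul_apply, h.dual, if_pos rfl] at this
  simp only [smul_eq_mul, mul_one] at this
  rw [this, neg_neg]

theorem extend_one (h : IsWeightFamily p b A u star χ) {v : E} {ψ : ι → ℂ} (hv : v ∈ p)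
    (hvw : ∀ k, A k v = ψ k • v) (h1 : b v v = 1) (h2 : ∀ i, b v (u i) = 0)
    (h3 : ∀ i, b (u i) v = 0) :
    IsWeightFamily p b A (fun o : Option I => o.elim v u) (Option.map star)
      (fun o => o.elim ψ χ) where
  mem o := by cases o with
    | none => exact hv
    | some i => exact h.mem i
  star_star o := by cases o with
    | none => rfl
    | some i => simp [h.star_star]
  dual o o' := by
    cases o <;> cases o' <;> simp [h1, h2, h3, h.dual]
  weight o k := by cases o with
    | none => exact hvw k
    | some i => exact h.weight i k

theorem extend_two (h : IsWeightFamily p b A u star χ) {v v' : E} {ψ ψ' : ι → ℂ} (hv : v ∈ p)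
    (hv' : v' ∈ p) (hvw : ∀ k, A k v = ψ k • v) (hvw' : ∀ k, A k v' = ψ' k • v')
    (h1 : b v v = 0) (h1' : b v' v' = 0) (h12 : b v v' = 1) (h21 : b v' v = 1)
    (h2 : ∀ i, b v (u i) = 0) (h3 : ∀ i, b (u i) v = 0)
    (h2' : ∀ i, b v' (u i) = 0) (h3' : ∀ i, b (u i) v' = 0) :
    IsWeightFamily p b A (fun o : I ⊕ Bool => o.elim u (fun c => bif c then v else v'))
      (Sum.map star not) (fun o => o.elim χ (fun c => bif c then ψ else ψ')) where
  mem o := by rcases o with i | (_ | _); exacts [h.mem i, hv', hv]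
  star_star o := by rcases o with i | (_ | _) <;> simp [h.star_star]
  dual o o' := by
    rcases o with i | (_ | _) <;> rcases o' with i' | (_ | _) <;>
      simp [h1, h2, h3, h1', h2', h3', h12, h21, h.dual]
  weight o k := by rcases o with i | (_ | _); exacts [h.weight i k, hvw' k, hvw k]

end IsWeightFamily

/-- The existence of a self-dual basis of joint eigenvectors. -/
theorem exists_isWeightFamily {ι E : Type*} [AddCommGroup E] [Module ℂ E] [FiniteDimensional ℂ E]
    (p : Submodule ℂ E) (b : LinearMap.BilinForm ℂ E) (A : ι → Module.End ℂ E)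
    (hsymm : ∀ y ∈ p, ∀ z ∈ p, b y z = b z y)
    (hnondeg : ∀ y ∈ p, (∀ z ∈ p, b y z = 0) → y = 0)
    (hskew : ∀ k, ∀ y ∈ p, ∀ z ∈ p, b (A k y) z = -b y (A k z))
    (hspan : p ≤ Submodule.span ℂ {y | y ∈ p ∧ ∃ χ : ι → ℂ, ∀ k, A k y = χ k • y}) :
    ∃ (I : Type) (_ : Fintype I) (_ : DecidableEq I) (u : I → E) (star : I → I) (χ : I → ι → ℂ),
      IsWeightFamily p b A u star χ ∧ p ≤ Submodule.span ℂ (Set.range u) := by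
  by_contra hcon
  -- If no family spans, every family can be enlarged, contradicting the dimension bound on
  -- independent vectors.
  have key : ∀ n : ℕ, ∃ (I : Type) (_ : Fintype I) (_ : DecidableEq I) (u : I → E) (star : I → I)
      (χ : I → ι → ℂ), IsWeightFamily p b A u star χ ∧ n ≤ Fintype.card I := by
    intro n
    induction n with
    | zero => exact ⟨Empty, inferInstance, inferInstance, Empty.elim, Empty.elim, Empty.elim,
        ⟨fun i => i.elim, fun i => i.elim, fun i => i.elim, fun i => i.elim⟩, Nat.zero_le _⟩
    | succ n ih =>
      obtain ⟨I, _, _, u, star, χ, h, hn⟩ := ih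
      have hnot : ¬ p ≤ Submodule.span ℂ (Set.range u) := fun hle =>
        hcon ⟨I, inferInstance, inferInstance, u, star, χ, h, hle⟩
      -- The orthogonal projection away from the family. It preserves weights because dual members
      -- carry opposite weights.
      let π : E → E := fun w => w - ∑ i, b w (u (star i)) • u i
      have hsum : ∀ w, ∑ i, b w (u (star i)) • u i ∈ Submodule.span ℂ (Set.range u) := fun w =>
        Submodule.sum_mem _ fun i _ => Submodule.smul_mem _ _ (Submodule.subset_span ⟨i, rfl⟩)
      have hπp : ∀ w ∈ p, π w ∈ p := fun w hw =>
        p.sub_mem hw (p.sum_mem fun i _ => p.smul_mem _ (h.mem i))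
      have hπu : ∀ w, ∀ i, b (π w) (u i) = 0 := by
        intro w i
        have := h.form_sum_left (fun i => b w (u (star i))) (star i)
        rw [h.star_star] at this
        simp only [π, map_sub, LinearMap.sub_apply, this, sub_self]
      have hπu' : ∀ w ∈ p, ∀ i, b (u i) (π w) = 0 := fun w hw i => by
        rw [hsymm _ (h.mem i) _ (hπp w hw), hπu]
      have hπw : ∀ w ∈ p, ∀ ψ : ι → ℂ, (∀ k, A k w = ψ k • w) → ∀ k, A k (π w) = ψ k • π w := by
        intro w hw ψ hψ k
        simp only [π, map_sub, map_sum, map_smul, h.weight, hψ, smul_sub, Finset.smul_sum]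
        congr 1
        refine Finset.sum_congr rfl fun i _ => ?_
        have := hskew k w hw _ (h.mem (star i))
        rw [hψ, h.weight, map_smul, map_smul, LinearMap.smul_apply, h.weight_star hskew] at this
        rw [smul_smul, smul_smul]
        congr 1
        simp only [smul_eq_mul] at this
        linear_combination -this
      obtain ⟨w, ⟨hw, ψ, hψ⟩, hw0⟩ : ∃ w ∈ {y | y ∈ p ∧ ∃ χ : ι → ℂ, ∀ k, A k y = χ k • y},
          π w ≠ 0 := by
        by_contra! hall
        refine hnot (hspan.trans (Submodule.span_le.mpr fun w hw => ?_))
        have := sub_eq_zero.mp (hall w hw)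
        rw [this]
        exact hsum w
      obtain ⟨w', ⟨hw', ψ', hψ'⟩, hw0'⟩ :
          ∃ w' ∈ {y | y ∈ p ∧ ∃ χ : ι → ℂ, ∀ k, A k y = χ k • y}, b (π w) w' ≠ 0 := by
        by_contra! hall
        refine hw0 (hnondeg _ (hπp w hw) fun z hz => ?_)
        have : Submodule.span ℂ {y | y ∈ p ∧ ∃ χ : ι → ℂ, ∀ k, A k y = χ k • y} ≤
            LinearMap.ker (b (π w)) := Submodule.span_le.mpr hall
        exact this (hspan hz)
      have hvv' : b (π w) (π w') ≠ 0 := by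
        have : b (π w) (π w') = b (π w) w' := by
          change b (π w) (w' - ∑ i, b w' (u (star i)) • u i) = _
          simp only [map_sub, map_sum, map_smul, hπu, smul_zero, Finset.sum_const_zero, sub_zero]
        rw [this]
        exact hw0'
      have hone : ∀ w ∈ p, ∀ ψ : ι → ℂ, (∀ k, A k w = ψ k • w) → b (π w) (π w) ≠ 0 →
          ∃ (I : Type) (_ : Fintype I) (_ : DecidableEq I) (u : I → E) (star : I → I)
            (χ : I → ι → ℂ), IsWeightFamily p b A u star χ ∧ n + 1 ≤ Fintype.card I := by
        intro w hw ψ hψ hne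
        obtain ⟨r, hr⟩ := IsAlgClosed.exists_pow_nat_eq (b (π w) (π w)) (n := 2) (by norm_num)
        have hr0 : r ≠ 0 := by rintro rfl; exact hne (by rw [← hr]; norm_num)
        refine ⟨Option I, inferInstance, inferInstance, _, _, _, h.extend_one (v := r⁻¹ • π w)
          (p.smul_mem _ (hπp w hw)) (ψ := ψ) (fun k => ?_) ?_ (fun i => ?_) (fun i => ?_), ?_⟩
        · rw [map_smul, hπw w hw ψ hψ, smul_comm]
        · rw [map_smul, map_smul, LinearMap.smul_apply, ← hr, smul_eq_mul, smul_eq_mul]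
          field_simp
        · rw [map_smul, LinearMap.smul_apply, hπu, smul_zero]
        · rw [map_smul, hπu' w hw, smul_zero]
        · rw [Fintype.card_option]; omega
      -- A non-isotropic vector is normalized and becomes self-dual. If both vectors are isotropic,
      -- they form a hyperbolic pair exchanged by `star`.
      by_cases hc1 : b (π w) (π w) = 0
      · by_cases hc2 : b (π w') (π w') = 0
        · refine ⟨I ⊕ Bool, inferInstance, inferInstance, _, _, _, h.extend_two (v := π w)
            (v' := (b (π w) (π w'))⁻¹ • π w') (ψ := ψ) (ψ' := ψ') (hπp w hw)
            (p.smul_mem _ (hπp w' hw')) (hπw w hw ψ hψ) (fun k => ?_) hc1 ?_ ?_ ?_ (hπu w)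
            (hπu' w hw) (fun i => ?_) (fun i => ?_), ?_⟩
          · rw [map_smul, hπw w' hw' ψ' hψ', smul_comm]
          · rw [map_smul, map_smul, LinearMap.smul_apply, hc2, smul_zero, smul_zero]
          · rw [map_smul, smul_eq_mul, inv_mul_cancel₀ hvv']
          · rw [map_smul, LinearMap.smul_apply, hsymm _ (hπp w' hw') _ (hπp w hw), smul_eq_mul,
              inv_mul_cancel₀ hvv']
          · rw [map_smul, LinearMap.smul_apply, hπu, smul_zero]
          · rw [map_smul, hπu' w' hw', smul_zero]
          · rw [Fintype.card_sum, Fintype.card_bool]; omega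
        · exact hone w' hw' ψ' hψ' hc2
      · exact hone w hw ψ hψ hc1
  obtain ⟨I, _, _, u, star, χ, h, hn⟩ := key (Module.finrank ℂ E + 1)
  have := h.linearIndependent.fintype_card_le_finrank
  omega

/-! ### The Cartan subalgebra and reality of the odd weights -/

namespace LieSuperalgebra

variable {L : Type*} [AddCommGroup L] [Module ℂ L] {g : LieSuperalgebra L}

namespace IsMinimalSetting

variable {B : LinearMap.BilinForm ℂ L} {e x f : L} (S : IsMinimalSetting g B e x f)
include S

omit S in
theorem span_bracket_natural {s a : L} (hs : s ∈ Submodule.span ℂ {e, x, f})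
    (ha : a ∈ g.natural e x f) : g.bracket s a = 0 := by
  obtain ⟨α, β, γ, rfl⟩ := Submodule.mem_span_triple.mp hs
  have h := mem_natural.mp ha
  simp [h.2.1, h.2.2.1, h.2.2.2]

theorem span_form_natural {s a : L} (hs : s ∈ Submodule.span ℂ {e, x, f})
    (ha : a ∈ g.natural e x f) : B s a = 0 := by
  obtain ⟨α, β, γ, rfl⟩ := Submodule.mem_span_triple.mp hs
  simp [S.form_e_natural ha, S.form_x_natural ha, S.form_f_natural ha]

theorem span_even {s : L} (hs : s ∈ Submodule.span ℂ {e, x, f}) : s ∈ g.even := by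
  refine (Submodule.span_le.mpr ?_ : Submodule.span ℂ {e, x, f} ≤ g.even) hs
  rintro _ (rfl | rfl | rfl)
  exacts [S.e_mem, S.x_mem, S.f_mem]

omit S in
theorem natural_bracket_span {s a : L} (hs : s ∈ Submodule.span ℂ {e, x, f})
    (ha : a ∈ g.natural e x f) : g.bracket a s = 0 := by
  rw [skew_even (natural_even ha), span_bracket_natural hs ha, neg_zero]

theorem span_bracket {s s' : L} (hs : s ∈ Submodule.span ℂ {e, x, f})
    (hs' : s' ∈ Submodule.span ℂ {e, x, f}) : g.bracket s s' ∈ Submodule.span ℂ {e, x, f} := by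
  obtain ⟨α, β, γ, rfl⟩ := Submodule.mem_span_triple.mp hs
  obtain ⟨α', β', γ', rfl⟩ := Submodule.mem_span_triple.mp hs'
  refine Submodule.mem_span_triple.mpr ⟨β * α' - α * β', α * γ' - γ * α', γ * β' - β * γ', ?_⟩
  simp only [map_add, map_smul, LinearMap.add_apply, LinearMap.smul_apply, S.e_e, S.e_x, S.e_f,
    S.x_e, S.x_x, S.x_f, S.f_e, S.f_x, S.f_f]
  module

/-- The vectors u and [e, u] span a copy of the two-dimensional `sl₂`-module, on which a traceless s
squares to a scalar. -/
theorem span_sq_neg_half {s u : L} (hs : s ∈ Submodule.span ℂ {e, x, f})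
    (hu : u ∈ g.gr x (-1 / 2)) : g.bracket s (g.bracket s u) = (B s s / 2) • u ∧
      g.bracket s (g.bracket s (g.bracket e u)) = (B s s / 2) • g.bracket e u := by
  obtain ⟨α, β, γ, rfl⟩ := Submodule.mem_span_triple.mp hs
  have hB : B (α • e + β • x + γ • f) (α • e + β • x + γ • f) = α * γ + β ^ 2 / 2 := by
    simp only [map_add, map_smul, LinearMap.add_apply, LinearMap.smul_apply, S.form_e_e,
      S.form_e_f, S.form_e_x, S.form_f_e, S.form_f_f, S.form_f_x, S.form_x_e, S.form_x_f, S.norm,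
      smul_eq_mul]
    ring
  have h1 : g.bracket (α • e + β • x + γ • f) u = α • g.bracket e u - (β / 2) • u := by
    simp only [map_add, map_smul, LinearMap.add_apply, LinearMap.smul_apply, S.f_neg_half hu,
      mem_gr.mp hu]
    module
  have h2 : g.bracket (α • e + β • x + γ • f) (g.bracket e u) =
      (β / 2) • g.bracket e u + (γ / 2) • u := by
    simp only [map_add, map_smul, LinearMap.add_apply, LinearMap.smul_apply,
      S.e_pos_half (S.e_half hu), mem_gr.mp (S.e_half hu), S.f_e_neg_half hu]
    module
  rw [hB]
  constructor
  · rw [h1, map_sub, map_smul, map_smul, h1, h2]; module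
  · rw [h2, map_add, map_smul, map_smul, h1, h2]; module

variable [FiniteDimensional ℂ L]

theorem span_sq_odd {s v : L} (hs : s ∈ Submodule.span ℂ {e, x, f}) (hv : v ∈ g.odd) :
    g.bracket s (g.bracket s v) = (B s s / 2) • v := by
  obtain ⟨u, hu, w, hw, rfl⟩ := S.odd_decomp' hv
  rw [map_add, map_add, (S.span_sq_neg_half hs hu).1, (S.span_sq_neg_half hs hw).2, smul_add]

variable {H : Submodule ℂ L} (hH : g.IsCartan H)
include hH

omit S [FiniteDimensional ℂ L] in
theorem cartan_comm {y z : L} (hy : y ∈ H) (hz : z ∈ H) : g.bracket y z = 0 :=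
  (hH.self_centralizing z (hH.le_even hz)).mp hz y hy

-- The two summands commute with each other, so [y, z] = 0 splits into a relation in each. Hence the
-- components of y again centralize H.
omit [FiniteDimensional ℂ L] in
theorem cartan_split {y : L} (hy : y ∈ H) : ∃ s ∈ Submodule.span ℂ {e, x, f},
    ∃ a ∈ g.natural e x f, s ∈ H ∧ a ∈ H ∧ y = s + a := by
  have hdec : ∀ z ∈ H, ∃ s ∈ Submodule.span ℂ {e, x, f}, ∃ a ∈ g.natural e x f, s + a = z :=
    fun z hz => Submodule.mem_sup.mp (S.decomposes.2.symm ▸ hH.le_even hz)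
  obtain ⟨s, hs, a, ha, rfl⟩ := hdec y hy
  have hsH : s ∈ H := by
    rw [hH.self_centralizing s (S.span_even hs)]
    intro z hz
    obtain ⟨s', hs', a', ha', rfl⟩ := hdec z hz
    have h1 := cartan_comm hH hz hy
    simp only [map_add, LinearMap.add_apply, span_bracket_natural hs' ha,
      natural_bracket_span hs ha', add_zero, zero_add] at h1 ⊢
    have h2 : g.bracket s' s = -g.bracket a' a := eq_neg_of_add_eq_zero_left h1
    exact Submodule.disjoint_def.mp S.decomposes.1 _ (S.span_bracket hs' hs)
      (h2 ▸ Submodule.neg_mem _ (natural_bracket ha' ha S.e_mem S.x_mem S.f_mem))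
  exact ⟨s, hs, a, ha, hsH, by simpa using H.sub_mem hy hsH, rfl⟩

omit S in
theorem cartan_weight_span : (⊤ : Submodule ℂ L) ≤ Submodule.span ℂ
    {y | y ∈ (⊤ : Submodule ℂ L) ∧ ∃ γ : H → ℂ, ∀ h : H, g.bracket h y = γ h • y} :=
  Module.End.le_span_joint_eigenvectors (fun h : H => g.bracket h) ⊤ (fun _ _ _ => trivial)
    (fun h h' y _ => by
      rw [jacobi_even (hH.le_even h.2), cartan_comm hH h.2 h'.2, map_zero, LinearMap.zero_apply,
        zero_add])
    (fun h => hH.diagonalizable h h.2)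

/-- By invariance h₀ is orthogonal to every nonzero weight vector. The even part of a zero weight
vector lies in H, and its odd part is orthogonal to h₀ by parity. -/
theorem cartan_eq_zero {h₀ : L} (h0 : h₀ ∈ H) (h : ∀ h ∈ H, B h₀ h = 0) : h₀ = 0 := by
  refine S.form.eq_zero fun y => ?_
  have hle := cartan_weight_span hH
  have : Submodule.span ℂ
      {y | y ∈ (⊤ : Submodule ℂ L) ∧ ∃ γ : H → ℂ, ∀ h : H, g.bracket h y = γ h • y} ≤
        LinearMap.ker (B h₀) := by
    refine Submodule.span_le.mpr ?_
    rintro z ⟨-, γ, hγ⟩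
    change B h₀ z = 0
    by_cases hγ0 : ∀ h, γ h = 0
    · obtain ⟨z₀, hz₀, z₁, hz₁, rfl⟩ := g.exists_even_odd z
      rw [map_add, S.form.even_odd _ (hH.le_even h0) _ hz₁, add_zero]
      refine h z₀ ((hH.self_centralizing z₀ hz₀).mpr fun k hk => ?_)
      have := hγ ⟨k, hk⟩
      rw [hγ0, zero_smul] at this
      exact (bracket_even_odd_eq_zero (hH.le_even hk) hz₀ hz₁ this).1
    · push Not at hγ0
      obtain ⟨k, hk⟩ := hγ0
      have h1 := S.form.invariant h₀ k z
      rw [cartan_comm hH h0 k.2, hγ, map_zero, LinearMap.zero_apply, map_smul, smul_eq_mul] at h1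
      exact (mul_eq_zero.mp h1.symm).resolve_left hk
  exact this (hle (Submodule.mem_top : y ∈ ⊤))

theorem exists_representative (β : Module.Dual ℂ H) : ∃ a : H, ∀ h : H, B a h = β h := by
  let Φ : H →ₗ[ℂ] Module.Dual ℂ H := B.compl₁₂ H.subtype H.subtype
  have hinj : Function.Injective Φ := by
    rw [← LinearMap.ker_eq_bot, LinearMap.ker_eq_bot']
    intro a ha
    refine Subtype.ext (S.cartan_eq_zero hH a.2 fun h hh => ?_)
    exact LinearMap.congr_fun ha ⟨h, hh⟩
  have hsurj : Function.Surjective Φ :=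
    (LinearMap.injective_iff_surjective_of_finrank_eq_finrank
      (Subspace.dual_finrank_eq (K := ℂ) (V := H)).symm).mp hinj
  obtain ⟨a, ha⟩ := hsurj β
  exact ⟨a, fun h => LinearMap.congr_fun ha h⟩

omit S in
/-- A weight of `H ∩ g^♮` on the odd part extends to a weight of `H`. -/
theorem exists_extension {u : L} (hu : u ∈ g.odd) (hu0 : u ≠ 0)
    {χ : ↥(H ⊓ g.natural e x f) → ℂ}
    (hχ : ∀ z : ↥(H ⊓ g.natural e x f), g.bracket z u = χ z • u) :
    ∃ β : Module.Dual ℂ H, ∃ v ∈ g.odd, v ≠ 0 ∧ (∀ h : H, g.bracket h v = β h • v) ∧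
      ∀ z : ↥(H ⊓ g.natural e x f), β ⟨z, z.2.1⟩ = χ z := by
  let W : Submodule ℂ L := g.odd ⊓
    ⨅ z : ↥(H ⊓ g.natural e x f), Module.End.eigenspace (g.bracket z) (χ z)
  have hW : ∀ {v}, v ∈ W ↔ v ∈ g.odd ∧ ∀ z : ↥(H ⊓ g.natural e x f),
      g.bracket z v = χ z • v := by
    intro v
    simp only [W, Submodule.mem_inf, Submodule.mem_iInf, Module.End.mem_eigenspace_iff]
  have hcomm : ∀ h h' : H, ∀ y, g.bracket h (g.bracket h' y) = g.bracket h' (g.bracket h y) :=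
    fun h h' y => by
      rw [jacobi_even (hH.le_even h.2), cartan_comm hH h.2 h'.2, map_zero, LinearMap.zero_apply,
        zero_add]
  have hle := Module.End.le_span_joint_eigenvectors (fun h : H => g.bracket h) W
    (fun h y hy => by
      rw [hW] at hy ⊢
      refine ⟨even_odd_mem (hH.le_even h.2) hy.1, fun z => ?_⟩
      rw [hcomm ⟨z, z.2.1⟩ h, hy.2, map_smul])
    (fun h h' y _ => hcomm h h' y) (fun h => hH.diagonalizable h h.2)
  obtain ⟨v, ⟨hvW, γ, hγ⟩, hv0⟩ : ∃ v ∈ {y | y ∈ W ∧ ∃ γ : H → ℂ, ∀ h : H,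
      g.bracket h y = γ h • y}, v ≠ 0 := by
    by_contra! hall
    have h1 : Submodule.span ℂ {y | y ∈ W ∧ ∃ γ : H → ℂ, ∀ h : H, g.bracket h y = γ h • y} ≤ ⊥ :=
      Submodule.span_le.mpr hall
    exact hu0 ((Submodule.mem_bot ℂ).mp (h1 (hle (hW.mpr ⟨hu, hχ⟩))))
  refine ⟨{ toFun := γ, map_add' := fun a b => ?_, map_smul' := fun c a => ?_ }, v,
    (hW.mp hvW).1, hv0, hγ, fun z => ?_⟩
  · refine smul_left_injective ℂ hv0 ?_
    change γ (a + b) • v = (γ a + γ b) • v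
    rw [← hγ, add_smul, ← hγ, ← hγ, Submodule.coe_add, map_add, LinearMap.add_apply]
  · refine smul_left_injective ℂ hv0 ?_
    change γ (c • a) • v = (c • γ a) • v
    rw [← hγ, smul_assoc, ← hγ, Submodule.coe_smul, map_smul, LinearMap.smul_apply]
  · refine smul_left_injective ℂ hv0 ?_
    change γ ⟨z, z.2.1⟩ • v = χ z • v
    rw [← hγ, ← (hW.mp hvW).2 z]

/-- The scalar products of the weights of `H ∩ g^♮` on the odd part are real. -/
theorem form_weight_real (hreal : g.RealRoots B H) {u u' : L} (hu : u ∈ g.odd) (hu0 : u ≠ 0)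
    (hu' : u' ∈ g.odd) (hu0' : u' ≠ 0) {χ χ' : ↥(H ⊓ g.natural e x f) → ℂ}
    (hχ : ∀ z : ↥(H ⊓ g.natural e x f), g.bracket z u = χ z • u)
    (hχ' : ∀ z : ↥(H ⊓ g.natural e x f), g.bracket z u' = χ' z • u')
    (t t' : ↥(H ⊓ g.natural e x f)) (ht : ∀ z : ↥(H ⊓ g.natural e x f), B z t = χ z)
    (ht' : ∀ z : ↥(H ⊓ g.natural e x f), B z t' = χ' z) : (χ' t).im = 0 := by
  -- Roots are nonzero by definition, so identically zero weights must be treated apart.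
  by_cases hz : ∀ z, χ z = 0
  · rw [← ht', S.form.symm_even (hH.le_even t.2.1), ht, hz]; rfl
  by_cases hz' : ∀ z, χ' z = 0
  · rw [hz']; rfl
  obtain ⟨β, v, hv, hv0, hβ, hβχ⟩ := exists_extension hH hu hu0 hχ
  obtain ⟨β', v', hv', hv0', hβ', hβχ'⟩ := exists_extension hH hu' hu0' hχ'
  obtain ⟨a, ha⟩ := S.exists_representative hH β
  obtain ⟨b, hb⟩ := S.exists_representative hH β'
  have hr : g.IsRoot H β := ⟨fun h0 => hz fun z => by rw [← hβχ, h0]; rfl, v, hv0, hβ⟩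
  have hr' : g.IsRoot H β' := ⟨fun h0 => hz' fun z => by rw [← hβχ', h0]; rfl, v', hv0', hβ'⟩
  have hab := hreal β β' hr hr' a b ha hb
  obtain ⟨s, hs, n, hn, hsH, hnH, has⟩ := S.cartan_split hH a.2
  obtain ⟨s', hs', n', hn', hsH', hnH', hbs⟩ := S.cartan_split hH b.2
  have hns : ∀ {s n : L}, s ∈ Submodule.span ℂ {e, x, f} → n ∈ g.natural e x f → B n s = 0 :=
    fun hs hn => by rw [S.form.symm_even (natural_even hn), S.span_form_natural hs hn]
  have e1 : B a b = B s s' + B n n' := by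
    rw [has, hbs]
    simp only [map_add, LinearMap.add_apply, S.span_form_natural hs hn', hns hs' hn]
    ring
  have e2 : B n n' = χ' t := by
    have h1 : B n n' = B a n' := by
      rw [has, map_add, LinearMap.add_apply, S.span_form_natural hs hn', zero_add]
    have h2 : B n' t = B b t := by
      rw [hbs, map_add, LinearMap.add_apply, S.span_form_natural hs' t.2.2, zero_add]
    rw [h1, ha ⟨n', hnH'⟩, hβχ ⟨n', hnH', hn'⟩, ← ht, h2, hb ⟨t, t.2.1⟩, hβχ']
  -- On the odd part s' squares to (s'|s')/2, so each odd weight takes on s' a square root of this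
  -- number.
  have hsq : ∀ {β : Module.Dual ℂ H} {v : L}, v ∈ g.odd → v ≠ 0 →
      (∀ h : H, g.bracket h v = β h • v) → (β ⟨s', hsH'⟩) ^ 2 = B s' s' / 2 := by
    intro β v hv hv0 hβ
    have h1 := S.span_sq_odd hs' hv
    have h2 := hβ ⟨s', hsH'⟩
    change g.bracket s' v = _ at h2
    rw [h2, map_smul, h2, smul_smul] at h1
    rw [sq]
    exact smul_left_injective ℂ hv0 h1
  have e3 : B s s' = β ⟨s', hsH'⟩ := by
    rw [← ha ⟨s', hsH'⟩, has, map_add, LinearMap.add_apply, hns hs' hn, add_zero]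
  have e4 : B s' s' = β' ⟨s', hsH'⟩ := by
    rw [← hb ⟨s', hsH'⟩, hbs, map_add, LinearMap.add_apply, hns hs' hn', add_zero]
  have h5 := hsq hv hv0 hβ
  have h6 := hsq hv' hv0' hβ'
  rw [← e3] at h5
  rw [← e4] at h6
  -- With q = (s'|s') = β'(s'), one gets q² = q/2, so q is 0 or 1/2. Then (s|s')² = q/2 forces
  -- (s|s') to be 0 or ±1/2.
  have h7 : (B s s').im = 0 := by
    have h8 : B s' s' = 0 ∨ B s' s' = 1 / 2 := by
      have : B s' s' * (B s' s' - 1 / 2) = 0 := by linear_combination h6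
      rcases mul_eq_zero.mp this with h | h
      · exact Or.inl h
      · exact Or.inr (sub_eq_zero.mp h)
    rcases h8 with h | h
    · rw [h, zero_div] at h5
      rw [pow_eq_zero_iff two_ne_zero] at h5
      rw [h5]; rfl
    · rw [h] at h5
      have : (B s s' - 1 / 2) * (B s s' + 1 / 2) = 0 := by linear_combination h5
      rcases mul_eq_zero.mp this with h | h
      · rw [sub_eq_zero.mp h]; norm_num
      · rw [eq_neg_of_add_eq_zero_left h]; norm_num
  rw [e1, Complex.add_im, h7, zero_add, e2] at hab
  exact hab

end IsMinimalSetting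

/-! ### The curvature tensor in a weight basis, and the real basis -/

/-- A basis of `g_{-1/2}` which is dual to its permutation by `star`, and in which the curvature
tensor is real for the real structure `uᵢ ↦ u_{star i}`. -/
structure IsRealBasis (g : LieSuperalgebra L) (B : LinearMap.BilinForm ℂ L) (e x : L) {I : Type*}
    [Fintype I] [DecidableEq I] (u : I → L) (star : I → I) : Prop where
  mem : ∀ i, u i ∈ g.gr x (-1 / 2)
  star_star : ∀ i, star (star i) = i
  dual : ∀ i j, g.halfForm B e (u i) (u j) = if j = star i then 1 else 0
  span : g.gr x (-1 / 2) ≤ Submodule.span ℂ (Set.range u)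
  real : ∀ i j k l, g.halfForm B e
    (g.bracket (curvature g B e x (u (star i)) (u (star j))) (u (star k))) (u (star l)) =
      starRingEnd ℂ (g.halfForm B e (g.bracket (curvature g B e x (u i) (u j)) (u k)) (u l))

theorem halfForm_compr (B : LinearMap.BilinForm ℂ L) (e u v : L) :
    g.halfForm B e u v = (g.bracket.compr₂ (B e)) u v := rfl

theorem halfForm_smul_left (B : LinearMap.BilinForm ℂ L) (e : L) (c : ℂ) (u v : L) :
    g.halfForm B e (c • u) v = c * g.halfForm B e u v := by
  rw [halfForm_compr, map_smul, LinearMap.smul_apply, smul_eq_mul, ← halfForm_compr]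

theorem halfForm_smul_right (B : LinearMap.BilinForm ℂ L) (e : L) (c : ℂ) (u v : L) :
    g.halfForm B e u (c • v) = c * g.halfForm B e u v := by
  rw [halfForm_compr, map_smul, smul_eq_mul, ← halfForm_compr]

theorem halfForm_sum_left (B : LinearMap.BilinForm ℂ L) (e : L) {I : Type*} [Fintype I]
    (c : I → ℂ) (u : I → L) (v : L) :
    g.halfForm B e (∑ i, c i • u i) v = ∑ i, c i * g.halfForm B e (u i) v := by
  simp only [halfForm_compr, map_sum, LinearMap.sum_apply, map_smul, LinearMap.smul_apply,
    smul_eq_mul]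

theorem halfForm_sum_right (B : LinearMap.BilinForm ℂ L) (e : L) {I : Type*} [Fintype I]
    (c : I → ℂ) (u : I → L) (v : L) :
    g.halfForm B e v (∑ i, c i • u i) = ∑ i, c i * g.halfForm B e v (u i) := by
  simp only [halfForm_compr, map_sum, map_smul, smul_eq_mul]

namespace IsMinimalSetting

variable {B : LinearMap.BilinForm ℂ L} {e x f : L} (S : IsMinimalSetting g B e x f)
  [FiniteDimensional ℂ L]
include S

omit S [FiniteDimensional ℂ L] in
/-- Expansion of a vector in a self-dual basis. -/
theorem expand {I : Type*} [Fintype I] [DecidableEq I] {u : I → L} {star : I → I}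
    (hstar : ∀ i, star (star i) = i)
    (hdual : ∀ i j, g.halfForm B e (u i) (u j) = if j = star i then 1 else 0)
    (hspan : g.gr x (-1 / 2) ≤ Submodule.span ℂ (Set.range u)) {v : L}
    (hv : v ∈ g.gr x (-1 / 2)) : v = ∑ i, g.halfForm B e v (u (star i)) • u i := by
  obtain ⟨c, rfl⟩ := (Submodule.mem_span_range_iff_exists_fun ℂ).mp (hspan hv)
  refine Finset.sum_congr rfl fun j _ => ?_
  rw [halfForm_sum_left]
  congr 1
  simp only [hdual]
  rw [Finset.sum_eq_single j]
  · rw [if_pos rfl, mul_one]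
  · intro i _ hij
    rw [if_neg, mul_zero]
    intro h
    exact hij (by rw [← hstar i, ← h, hstar])
  · simp

/-- The basis consists of weight vectors for H ∩ `g^♮`. The element T(uᵢ, u_{star i}) represents the
weight of uᵢ under the form, so the Cartan entries are scalar products of weights. -/
theorem exists_curvature_tensor {H : Submodule ℂ L} (hH : g.IsCartan H)
    (hreal : g.RealRoots B H) : ∃ (I : Type) (_ : Fintype I) (_ : DecidableEq I) (u : I → L)
      (star : I → I) (m : I → I → ℝ), (∀ i, u i ∈ g.gr x (-1 / 2)) ∧
      (∀ i j, g.halfForm B e (u i) (u j) = if j = star i then 1 else 0) ∧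
      g.gr x (-1 / 2) ≤ Submodule.span ℂ (Set.range u) ∧
      IsCurvatureTensor star (fun i j k l => g.halfForm B e
        (g.bracket (curvature g B e x (u i) (u j)) (u k)) (u l)) m := by
  let N := H ⊓ g.natural e x f
  let A : N → Module.End ℂ L := fun z => g.bracket z
  let b : LinearMap.BilinForm ℂ L := g.bracket.compr₂ (B e)
  obtain ⟨I, _, _, u, star, χ, hu, hspan⟩ := exists_isWeightFamily (g.gr x (-1 / 2)) b A
    (fun y hy z hz => S.halfForm_symm hy hz)
    (fun y hy h => S.eq_zero_of_halfForm hy h)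
    (fun z y _ w _ => S.halfForm_skew z.2.2 y w)
    (Module.End.le_span_joint_eigenvectors A (g.gr x (-1 / 2))
      (fun z y hy => S.natural_gr z.2.2 hy)
      (fun z w y _ => by
        change g.bracket z (g.bracket w y) = g.bracket w (g.bracket z y)
        rw [jacobi_even (hH.le_even z.2.1), cartan_comm hH z.2.1 w.2.1, map_zero,
          LinearMap.zero_apply, zero_add])
      (fun z => hH.diagonalizable z z.2.1))
  have hV := hu.mem
  have hdual : ∀ i j, g.halfForm B e (u i) (u j) = if j = star i then 1 else 0 := hu.dual
  have hw : ∀ i (z : N), g.bracket z (u i) = χ i z • u i := hu.weight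
  have hu0 : ∀ i, u i ≠ 0 := fun i h0 => by
    have := hdual i (star i)
    rw [h0, if_pos rfl, halfForm, map_zero, LinearMap.zero_apply, map_zero] at this
    exact zero_ne_one this
  have hχstar : ∀ i z, χ (star i) z = -χ i z :=
    hu.weight_star (fun z y _ w _ => S.halfForm_skew z.2.2 y w)
  have hTnat : ∀ i j, curvature g B e x (u i) (u j) ∈ g.natural e x f :=
    fun i j => S.curvature_mem (hV i) (hV j)
  -- An element of `g^♮` of weight zero commutes with H, so it belongs to H.
  have hTN : ∀ i j, (∀ z, χ i z + χ j z = 0) → curvature g B e x (u i) (u j) ∈ N := by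
    intro i j hij
    refine ⟨(hH.self_centralizing _ (natural_even (hTnat i j))).mpr fun h hh => ?_, hTnat i j⟩
    obtain ⟨s, hs, a, ha, -, haH, rfl⟩ := S.cartan_split hH hh
    have h1 := hw i ⟨a, haH, ha⟩
    have h2 := hw j ⟨a, haH, ha⟩
    simp only at h1 h2
    rw [map_add, LinearMap.add_apply, span_bracket_natural hs (hTnat i j), zero_add,
      S.bracket_curvature ha, h1, h2, map_smul, map_smul, LinearMap.smul_apply, ← add_smul, hij,
      zero_smul]
  have hBT : ∀ (z : N) i j, B z (curvature g B e x (u i) (u j)) =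
      χ i z * if j = star i then 1 else 0 := by
    intro z i j
    rw [S.form_curvature z.2.2, hw, halfForm_smul_left, hdual]
  have hX : ∀ i, ∃ z : N, (z : L) = curvature g B e x (u i) (u (star i)) := fun i =>
    ⟨⟨_, hTN i (star i) fun z => by rw [hχstar, add_neg_cancel]⟩, rfl⟩
  choose X hX using hX
  have hBX : ∀ (z : N) i, B z (X i) = χ i z := fun z i => by
    rw [hX, hBT, if_pos rfl, mul_one]
  have him : ∀ i p, ((((χ p (X i)).re : ℝ) : ℂ)) = χ p (X i) := by
    intro i p
    have := S.form_weight_real hH hreal (S.neg_half_odd (hV i)) (hu0 i) (S.neg_half_odd (hV p))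
      (hu0 p) (hw i) (hw p) (X i) (X p) (fun z => hBX z i) (fun z => hBX z p)
    exact Complex.ext rfl this.symm
  have hantisymm : ∀ i j k l, g.halfForm B e (g.bracket (curvature g B e x (u j) (u i)) (u k)) (u l)
      = -g.halfForm B e (g.bracket (curvature g B e x (u i) (u j)) (u k)) (u l) := by
    intro i j k l
    rw [S.curvature_antisymm (hV i) (hV j), halfForm, halfForm, map_neg, LinearMap.neg_apply,
      map_neg, LinearMap.neg_apply, map_neg]
  have hform : ∀ i j k l, g.halfForm B e (g.bracket (curvature g B e x (u i) (u j)) (u k)) (u l) =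
      B (curvature g B e x (u i) (u j)) (curvature g B e x (u k) (u l)) :=
    fun i j k l => (S.form_curvature (hTnat i j) _ _).symm
  refine ⟨I, inferInstance, inferInstance, u, star, fun i p => (χ p (X i)).re, hV, hdual, hspan,
    ⟨hu.star_star, hantisymm, fun i j k l => ?_, fun i j k l => ?_, fun p q i j k l => ?_,
    fun i p q => ?_, fun i j hij hm k l => ?_⟩⟩
  · rw [hform, hform, S.form.symm_even (natural_even (hTnat k l))]
  · have h1 := congrArg (fun y => g.halfForm B e y (u l)) (S.curvature_cyclic (hV i) (hV j) (hV k))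
    simp only [halfForm_compr, map_add, map_sub, map_smul, LinearMap.add_apply,
      LinearMap.sub_apply, LinearMap.smul_apply, smul_eq_mul] at h1
    simp only [← halfForm_compr] at h1
    rw [h1]
    have hite : ∀ (P Q : Prop) [Decidable P] [Decidable Q] (c : ℂ),
        (c * if P then 1 else 0) * (if Q then 1 else 0) = if P ∧ Q then c else 0 := by
      intro P Q _ _ c
      by_cases hP : P <;> by_cases hQ : Q <;> simp [hP, hQ]
    have hite1 := hite (k = star j) (l = star i) 1
    rw [one_mul] at hite1
    rw [hdual, hdual, hdual, hdual, hdual, hdual, hite, hite, hite1]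
  · have hexp : ∀ i, g.bracket (curvature g B e x (u p) (u q)) (u i) = ∑ r, g.halfForm B e
        (g.bracket (curvature g B e x (u p) (u q)) (u i)) (u (star r)) • u r := fun i =>
      expand hu.star_star hdual hspan (S.natural_gr (hTnat p q) (hV i))
    set a := curvature g B e x (u p) (u q) with ha
    have h1 := S.bracket_curvature (hTnat p q) (u i) (u j)
    have h2 := jacobi_even (natural_even (hTnat p q)) (curvature g B e x (u i) (u j)) (u k)
    have h3 := S.halfForm_skew (hTnat p q)
      (g.bracket (curvature g B e x (u i) (u j)) (u k)) (u l)
    rw [← ha] at h1 h2 h3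
    rw [h2, h1] at h3
    have e1 : ∑ r, g.halfForm B e (g.bracket a (u i)) (u (star r)) * g.halfForm B e
        (g.bracket (curvature g B e x (u r) (u j)) (u k)) (u l) =
        g.halfForm B e (g.bracket (curvature g B e x (g.bracket a (u i)) (u j)) (u k)) (u l) := by
      conv_rhs => rw [hexp i]
      simp only [map_sum, LinearMap.sum_apply, map_smul, LinearMap.smul_apply, halfForm_sum_left]
    have e2 : ∑ r, g.halfForm B e (g.bracket a (u j)) (u (star r)) * g.halfForm B e
        (g.bracket (curvature g B e x (u i) (u r)) (u k)) (u l) =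
        g.halfForm B e (g.bracket (curvature g B e x (u i) (g.bracket a (u j))) (u k)) (u l) := by
      conv_rhs => rw [hexp j]
      simp only [map_sum, LinearMap.sum_apply, map_smul, LinearMap.smul_apply, halfForm_sum_left]
    have e3 : ∑ r, g.halfForm B e (g.bracket a (u k)) (u (star r)) * g.halfForm B e
        (g.bracket (curvature g B e x (u i) (u j)) (u r)) (u l) =
        g.halfForm B e (g.bracket (curvature g B e x (u i) (u j)) (g.bracket a (u k))) (u l) := by
      conv_rhs => rw [hexp k]
      simp only [map_sum, map_smul, halfForm_sum_left]
    have e4 : ∑ r, g.halfForm B e (g.bracket a (u l)) (u (star r)) * g.halfForm B e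
        (g.bracket (curvature g B e x (u i) (u j)) (u k)) (u r) =
        g.halfForm B e (g.bracket (curvature g B e x (u i) (u j)) (u k)) (g.bracket a (u l)) := by
      conv_rhs => rw [hexp l]
      rw [halfForm_sum_right]
    simp only [Finset.sum_add_distrib]
    rw [e1, e2, e3, e4]
    simp only [halfForm_compr, map_add, LinearMap.add_apply] at h3 ⊢
    linear_combination h3
  · rw [← hX, hw, halfForm_smul_left, hdual, him]
    split_ifs <;> simp
  -- If the weights of uᵢ and uⱼ add to zero in scalar products, faithfulness makes X i + X j = 0.
  -- Then T(uᵢ, uⱼ) lies in H ∩ `g^♮` and is orthogonal to every X k, so it acts by zero.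
  · have hz : ((X i + X j : N) : L) = 0 := by
      refine S.natural_eq_zero (X i + X j).2.2 fun y hy => ?_
      obtain ⟨c, rfl⟩ := (Submodule.mem_span_range_iff_exists_fun ℂ).mp (hspan hy)
      rw [map_sum]
      refine Finset.sum_eq_zero fun p _ => ?_
      have h1 : χ p (X i) + χ p (X j) = 0 := by
        rw [← him i p, ← him j p, ← Complex.ofReal_add, hm p, Complex.ofReal_zero]
      rw [map_smul, Submodule.coe_add, map_add, LinearMap.add_apply, hw, hw, ← add_smul, h1,
        zero_smul, smul_zero]
    have hχ0 : ∀ z, χ i z + χ j z = 0 := by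
      intro z
      rw [← hBX, ← hBX, ← map_add, ← Submodule.coe_add, hz, map_zero]
    have hmem := hTN i j hχ0
    have h1 := hw k ⟨_, hmem⟩
    simp only at h1
    rw [h1, halfForm_smul_left, hdual]
    split_ifs with hl
    · have h2 := hBT (X k) i j
      rw [if_neg hij, mul_zero] at h2
      rw [mul_one, ← hBX ⟨_, hmem⟩ k, S.form.symm_even (hH.le_even hmem.1), h2]
    · rw [mul_zero]

theorem exists_real_basis {H : Submodule ℂ L} (hH : g.IsCartan H) (hreal : g.RealRoots B H) :
    ∃ (I : Type) (_ : Fintype I) (_ : DecidableEq I) (u : I → L) (star : I → I),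
      IsRealBasis g B e x u star := by
  obtain ⟨I, _, _, u, star, m, hV, hdual, hspan, ht⟩ := S.exists_curvature_tensor hH hreal
  obtain ⟨y, hy, hyr⟩ := ht.exists_real
  have hexp : ∀ i, (Real.exp (y i) : ℂ) ≠ 0 := fun i => by exact_mod_cast (Real.exp_pos _).ne'
  refine ⟨I, inferInstance, inferInstance, fun i => (Real.exp (y i) : ℂ) • u i, star,
    fun i => Submodule.smul_mem _ _ (hV i), ht.star_star, fun i j => ?_, ?_, fun i j k l => ?_⟩
  · rw [halfForm_smul_left, halfForm_smul_right, hdual]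
    split_ifs with hj
    · rw [hj, hy, mul_one, ← Complex.ofReal_mul, ← Real.exp_add, add_neg_cancel, Real.exp_zero,
        Complex.ofReal_one]
    · rw [mul_zero, mul_zero]
  · refine hspan.trans (Submodule.span_le.mpr ?_)
    rintro _ ⟨i, rfl⟩
    rw [SetLike.mem_coe, ← inv_smul_smul₀ (hexp i) (u i)]
    exact Submodule.smul_mem _ _ (Submodule.subset_span ⟨i, rfl⟩)
  · have hs : ∀ i j k l, g.halfForm B e (g.bracket (curvature g B e x ((Real.exp (y i) : ℂ) • u i)
        ((Real.exp (y j) : ℂ) • u j)) ((Real.exp (y k) : ℂ) • u k)) ((Real.exp (y l) : ℂ) • u l) =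
        (Real.exp (y i + y j + y k + y l) : ℂ) *
          g.halfForm B e (g.bracket (curvature g B e x (u i) (u j)) (u k)) (u l) := by
      intro i j k l
      simp only [map_smul, LinearMap.smul_apply, halfForm_smul_left, halfForm_smul_right,
        Real.exp_add, Complex.ofReal_mul]
      ring
    rw [hs, hs]
    exact hyr i j k l

end IsMinimalSetting

end LieSuperalgebra

/-! ### Conjugate linear maps from Gram matrices; Hermitian forms -/

theorem LinearMap.BilinForm.Nondegenerate.exists_eq {L : Type*} [AddCommGroup L] [Module ℂ L]
    [FiniteDimensional ℂ L] {B : LinearMap.BilinForm ℂ L} (hB : B.Nondegenerate)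
    (ψ : Module.Dual ℂ L) : ∃ z, ∀ y, B z y = ψ y :=
  ⟨(B.toDual hB).symm ψ, fun y => by
    rw [← LinearMap.BilinForm.toDual_def hB, LinearEquiv.apply_symm_apply]⟩

/-- Two spanning families with conjugate Gram matrices are related by a conjugate linear map. -/
theorem LinearMap.BilinForm.exists_semilinear_of_gram {L K : Type*} [AddCommGroup L] [Module ℂ L]
    [Fintype K] {B : LinearMap.BilinForm ℂ L} (hB : B.Nondegenerate) (b b' : K → L)
    (hspan : Submodule.span ℂ (Set.range b) = ⊤) (hspan' : Submodule.span ℂ (Set.range b') = ⊤)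
    (hgram : ∀ k l, B (b' k) (b' l) = starRingEnd ℂ (B (b k) (b l))) :
    ∃ φ : L →ₛₗ[starRingEnd ℂ] L, (∀ k, φ (b k) = b' k) ∧
      ∀ y z, B (φ y) (φ z) = starRingEnd ℂ (B y z) := by
  classical
  have hsurj : LinearMap.range (Fintype.linearCombination ℂ b) = ⊤ := by
    rw [Fintype.range_linearCombination, hspan]
  -- The families may be dependent, so φ is defined through a chosen section. Nondegeneracy then
  -- shows that the choice is immaterial.
  obtain ⟨s, hs⟩ := LinearMap.exists_rightInverse_of_surjective _ hsurj
  have hs' : ∀ y, ∑ k, s y k • b k = y := fun y => LinearMap.congr_fun hs y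
  let φ : L →ₛₗ[starRingEnd ℂ] L :=
    { toFun := fun y => ∑ k, starRingEnd ℂ (s y k) • b' k
      map_add' := fun y z => by
        simp only [map_add, Pi.add_apply, add_smul, Finset.sum_add_distrib]
      map_smul' := fun c y => by
        simp only [map_smul, Pi.smul_apply, smul_eq_mul, map_mul, mul_smul, Finset.smul_sum] }
  have hφ : ∀ y, φ y = ∑ k, starRingEnd ℂ (s y k) • b' k := fun y => rfl
  have hform : ∀ y l, B (φ y) (b' l) = starRingEnd ℂ (B y (b l)) := by
    intro y l
    rw [hφ]
    conv_rhs => rw [← hs' y]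
    simp only [map_sum, LinearMap.sum_apply, map_smul, LinearMap.smul_apply, smul_eq_mul, map_mul,
      hgram]
  have hb : ∀ k, φ (b k) = b' k := by
    intro k
    rw [← sub_eq_zero]
    refine hB.1 _ fun y => ?_
    have hle : Submodule.span ℂ (Set.range b') ≤ LinearMap.ker (B (φ (b k) - b' k)) := by
      refine Submodule.span_le.mpr ?_
      rintro _ ⟨l, rfl⟩
      change B (φ (b k) - b' k) (b' l) = 0
      rw [map_sub, LinearMap.sub_apply, hform, hgram, sub_self]
    exact hle (hspan' ▸ Submodule.mem_top : y ∈ Submodule.span ℂ (Set.range b'))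
  refine ⟨φ, hb, fun y z => ?_⟩
  rw [hφ z]
  conv_rhs => rw [← hs' z]
  simp only [map_sum, map_smul, smul_eq_mul, map_mul, hform]

/-- The real part of the Hermitian form `∑ₖ |B(vₖ, ·)|²` attached to a finite family. -/
noncomputable def LinearMap.BilinForm.realForm {L K : Type*} [AddCommGroup L] [Module ℂ L]
    [Fintype K] (B : LinearMap.BilinForm ℂ L) (v : K → L) : LinearMap.BilinForm ℝ L :=
  LinearMap.mk₂ ℝ (fun y z => (∑ k, starRingEnd ℂ (B (v k) y) * B (v k) z).re)
    (fun a b c => by simp only [map_add, add_mul, Finset.sum_add_distrib, Complex.add_re])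
    (fun r a b => by
      have : ∀ k, B (v k) (r • a) = (r : ℂ) * B (v k) a := fun k => by
        rw [← Complex.coe_smul, map_smul, smul_eq_mul]
      simp only [this, map_mul, Complex.conj_ofReal, mul_assoc, ← Finset.mul_sum,
        Complex.re_ofReal_mul, smul_eq_mul])
    (fun a b c => by simp only [map_add, mul_add, Finset.sum_add_distrib, Complex.add_re])
    (fun r a b => by
      have : ∀ k, B (v k) (r • b) = (r : ℂ) * B (v k) b := fun k => by
        rw [← Complex.coe_smul, map_smul, smul_eq_mul]
      simp only [this, mul_left_comm _ (r : ℂ), ← Finset.mul_sum, Complex.re_ofReal_mul,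
        smul_eq_mul])

namespace LinearMap.BilinForm

variable {L K : Type*} [AddCommGroup L] [Module ℂ L] [Fintype K] (B : LinearMap.BilinForm ℂ L)
  (v : K → L)

theorem realForm_apply (y z : L) :
    B.realForm v y z = (∑ k, starRingEnd ℂ (B (v k) y) * B (v k) z).re := rfl

theorem realForm_symm (y z : L) : B.realForm v y z = B.realForm v z y := by
  rw [realForm_apply, realForm_apply, ← Complex.conj_re, map_sum]
  congr 1
  refine Finset.sum_congr rfl fun k _ => ?_
  rw [map_mul, Complex.conj_conj, mul_comm]

theorem realForm_self (y : L) : B.realForm v y y = ∑ k, Complex.normSq (B (v k) y) := by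
  rw [realForm_apply, Complex.re_sum]
  refine Finset.sum_congr rfl fun k _ => ?_
  rw [← Complex.normSq_eq_conj_mul_self, Complex.ofReal_re]

theorem realForm_self_nonneg (y : L) : 0 ≤ B.realForm v y y := by
  rw [realForm_self]
  exact Finset.sum_nonneg fun k _ => Complex.normSq_nonneg _

theorem realForm_self_eq_zero {y : L} (h : B.realForm v y y = 0) (k : K) : B (v k) y = 0 := by
  rw [realForm_self, Finset.sum_eq_zero_iff_of_nonneg fun k _ => Complex.normSq_nonneg _] at h
  exact Complex.normSq_eq_zero.mp (h k (Finset.mem_univ k))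

/-- An operator acting on the family by a skew-Hermitian matrix is skew for the real form. -/
theorem realForm_skew (A : L → L) (M : K → K → ℂ) (hM : ∀ k l, starRingEnd ℂ (M k l) = -M l k)
    (hA : ∀ k y, B (v k) (A y) = -∑ l, M l k * B (v l) y) (y z : L) :
    B.realForm v (A y) z + B.realForm v y (A z) = 0 := by
  rw [realForm_apply, realForm_apply, ← Complex.add_re, ← Finset.sum_add_distrib]
  have h1 : ∑ k, starRingEnd ℂ (B (v k) (A y)) * B (v k) z =
      ∑ k, ∑ l, M k l * starRingEnd ℂ (B (v l) y) * B (v k) z := by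
    refine Finset.sum_congr rfl fun k _ => ?_
    rw [hA, map_neg, map_sum, ← Finset.sum_neg_distrib, Finset.sum_mul]
    refine Finset.sum_congr rfl fun l _ => ?_
    rw [map_mul, hM]
    ring
  have h2 : ∑ k, starRingEnd ℂ (B (v k) y) * B (v k) (A z) =
      -∑ k, ∑ l, M k l * starRingEnd ℂ (B (v l) y) * B (v k) z := by
    rw [Finset.sum_comm, ← Finset.sum_neg_distrib]
    refine Finset.sum_congr rfl fun k _ => ?_
    rw [hA, mul_neg, Finset.mul_sum]
    congr 1
    refine Finset.sum_congr rfl fun l _ => ?_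
    ring
  rw [Finset.sum_add_distrib, h1, h2, add_neg_cancel, Complex.zero_re]

end LinearMap.BilinForm

/-! ### Construction of the conjugation -/

namespace LieSuperalgebra

variable {L : Type*} [AddCommGroup L] [Module ℂ L] {g : LieSuperalgebra L}

namespace IsMinimalSetting

variable {B : LinearMap.BilinForm ℂ L} {e x f : L} (S : IsMinimalSetting g B e x f)
  [FiniteDimensional ℂ L] {I : Type} [Fintype I] [DecidableEq I] {u : I → L} {star : I → I}
  (R : IsRealBasis g B e x u star)
include S R

/-- A functional vanishing on all T(uᵢ, uⱼ) restricts to `g^♮` as pairing with some n in `g^♮`. That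
n is orthogonal to all curvatures, hence zero. -/
theorem natural_le_span : g.natural e x f ≤
    Submodule.span ℂ (Set.range fun p : I × I => curvature g B e x (u p.1) (u p.2)) := by
  intro a ha
  by_contra hna
  obtain ⟨ψ, hψa, hψ⟩ := Submodule.exists_le_ker_of_notMem hna
  obtain ⟨z, hz⟩ := S.form.nondegenerate.exists_eq ψ
  obtain ⟨α, β, γ, n, hn, w, hw, v, hv, rfl⟩ := S.exists_decomp z
  have hzn : ∀ c ∈ g.natural e x f, ψ c = B n c := by
    intro c hc
    have hodd : w + g.bracket e v ∈ g.odd :=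
      g.odd.add_mem (S.neg_half_odd hw) (S.half_odd (S.e_half hv))
    rw [← hz]
    simp only [map_add _ (α • e + β • x + γ • f + n), LinearMap.add_apply,
      S.form.odd_even hodd (natural_even hc), map_smul, map_add _ (α • e + β • x + γ • f),
      map_add _ (α • e + β • x), map_add _ (α • e), LinearMap.smul_apply, S.form_e_natural hc,
      S.form_x_natural hc, S.form_f_natural hc, smul_zero, zero_add, add_zero]
  have hn0 : n = 0 := by
    refine S.form_natural_eq_zero hn fun y hy z hz => ?_
    rw [expand R.star_star R.dual R.span hy, expand R.star_star R.dual R.span hz]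
    simp only [map_sum, map_smul, LinearMap.sum_apply, LinearMap.smul_apply]
    refine Finset.sum_eq_zero fun i _ => smul_eq_zero_of_right _ (Finset.sum_eq_zero fun j _ => ?_)
    rw [← hzn _ (S.curvature_mem (R.mem j) (R.mem i)), hψ (Submodule.subset_span ⟨(j, i), rfl⟩),
      smul_zero]
  exact hψa (by rw [hzn a ha, hn0, map_zero, LinearMap.zero_apply])

omit S R [FiniteDimensional ℂ L] [DecidableEq I] [Fintype I] in
theorem mem_of_smul_comp_mem {ε : ℂ} (hε : ε ≠ 0) {σ : I → I} (hσ : ∀ i, σ (σ i) = i)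
    {p : Submodule ℂ L} (hp : ∀ i, ε • u (σ i) ∈ p) (i : I) : u i ∈ p := by
  have := p.smul_mem ε⁻¹ (hp (σ i))
  rwa [hσ, inv_smul_smul₀ hε] at this

end IsMinimalSetting

/-- The family `e, x, f, T(uᵢ, uⱼ), ε uᵢ, ε [e, uᵢ]`. -/
noncomputable def adaptedFamily (g : LieSuperalgebra L) (B : LinearMap.BilinForm ℂ L) (e x f : L)
    {I : Type} (ε : ℂ) (u : I → L) : Fin 3 ⊕ (I × I) ⊕ I ⊕ I → L :=
  Sum.elim ![e, x, f] (Sum.elim (fun p => curvature g B e x (u p.1) (u p.2))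
    (Sum.elim (fun i => ε • u i) (fun i => ε • g.bracket e (u i))))

/-- A conjugate linear map acting on the elements attached to a real basis as the almost compact
involution does. -/
structure IsBasisConjugation (g : LieSuperalgebra L)
    (B : LinearMap.BilinForm ℂ L) (e x f : L) {I : Type} (u : I → L) (star : I → I)
    (φ : L →ₛₗ[starRingEnd ℂ] L) : Prop where
  map_e : φ e = e
  map_x : φ x = x
  map_f : φ f = f
  map_curvature : ∀ i j,
    φ (curvature g B e x (u i) (u j)) = curvature g B e x (u (star i)) (u (star j))
  map_basis : ∀ i, φ (u i) = -u (star i)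
  map_e_basis : ∀ i, φ (g.bracket e (u i)) = -g.bracket e (u (star i))
  form : ∀ y z, B (φ y) (φ z) = starRingEnd ℂ (B y z)

namespace IsMinimalSetting

variable {B : LinearMap.BilinForm ℂ L} {e x f : L} (S : IsMinimalSetting g B e x f)
  [FiniteDimensional ℂ L] {I : Type} [Fintype I] [DecidableEq I] {u : I → L} {star : I → I}
  (R : IsRealBasis g B e x u star)
include S R

/-- The parameters cover both the source family (ε = 1, σ = id) and its intended image (ε = -1, σ =
star). -/
theorem span_adaptedFamily {ε : ℂ} (hε : ε ≠ 0) {σ : I → I} (hσ : ∀ i, σ (σ i) = i) :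
    Submodule.span ℂ (Set.range (adaptedFamily g B e x f ε (u ∘ σ))) = ⊤ := by
  set p := Submodule.span ℂ (Set.range (adaptedFamily g B e x f ε (u ∘ σ)))
  have hmem : ∀ k, adaptedFamily g B e x f ε (u ∘ σ) k ∈ p := fun k =>
    Submodule.subset_span ⟨k, rfl⟩
  have he : e ∈ p := hmem (Sum.inl 0)
  have hx : x ∈ p := hmem (Sum.inl 1)
  have hf : f ∈ p := hmem (Sum.inl 2)
  have hu : ∀ i, u i ∈ p := mem_of_smul_comp_mem hε hσ fun i => hmem (Sum.inr (Sum.inr (Sum.inl i)))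
  have heu : ∀ i, g.bracket e (u i) ∈ p :=
    mem_of_smul_comp_mem (u := fun i => g.bracket e (u i)) hε hσ
    fun i => hmem (Sum.inr (Sum.inr (Sum.inr i)))
  have hT : ∀ i j, curvature g B e x (u i) (u j) ∈ p := fun i j => by
    have : curvature g B e x (u (σ (σ i))) (u (σ (σ j))) ∈ p :=
      hmem (Sum.inr (Sum.inl (σ i, σ j)))
    rwa [hσ, hσ] at this
  rw [← top_le_iff]
  intro y _
  obtain ⟨α, β, γ, a, ha, w, hw, v, hv, rfl⟩ := S.exists_decomp y
  have ha' : a ∈ p := by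
    refine (Submodule.span_le.mpr ?_ : _ ≤ p) (S.natural_le_span R ha)
    rintro _ ⟨q, rfl⟩
    exact hT _ _
  have hw' : w ∈ p := by
    refine (Submodule.span_le.mpr ?_ : _ ≤ p) (R.span hw)
    rintro _ ⟨i, rfl⟩
    exact hu i
  have hv' : g.bracket e v ∈ p := by
    rw [expand R.star_star R.dual R.span hv, map_sum]
    refine p.sum_mem fun i _ => ?_
    rw [map_smul]
    exact p.smul_mem _ (heu i)
  exact p.add_mem (p.add_mem (p.add_mem (p.add_mem (p.smul_mem _ he) (p.smul_mem _ hx))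
    (p.smul_mem _ hf)) ha') (p.add_mem hw' hv')

omit [FiniteDimensional ℂ L] in
-- Mixed blocks vanish by parity, degree, or orthogonality of `g^♮` to the `sl₂`. The sign ε cancels
-- in odd pairings. The curvature block is the four-tensor, the only place where the real basis
-- condition is needed.
theorem gram_adaptedFamily (k l : Fin 3 ⊕ (I × I) ⊕ I ⊕ I) :
    B (adaptedFamily g B e x f (-1) (u ∘ star) k) (adaptedFamily g B e x f (-1) (u ∘ star) l) =
      starRingEnd ℂ (B (adaptedFamily g B e x f 1 (u ∘ id) k)
        (adaptedFamily g B e x f 1 (u ∘ id) l)) := by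
  have hs : ∀ i : Fin 3, ![e, x, f] i ∈ Submodule.span ℂ {e, x, f} := by
    intro i
    fin_cases i <;> exact Submodule.subset_span (by simp)
  have hT : ∀ i j, curvature g B e x (u i) (u j) ∈ g.natural e x f := fun i j =>
    S.curvature_mem (R.mem i) (R.mem j)
  have huo : ∀ i, u i ∈ g.odd := fun i => S.neg_half_odd (R.mem i)
  have heuo : ∀ i, g.bracket e (u i) ∈ g.odd := fun i => S.half_odd (S.e_half (R.mem i))
  have hsu : ∀ i j, B (![e, x, f] i) (u j) = 0 := fun i j =>
    S.form.even_odd _ (S.span_even (hs i)) _ (huo j)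
  have hseu : ∀ i j, B (![e, x, f] i) (g.bracket e (u j)) = 0 := fun i j =>
    S.form.even_odd _ (S.span_even (hs i)) _ (heuo j)
  have hus : ∀ i j, B (u j) (![e, x, f] i) = 0 := fun i j =>
    S.form.odd_even (huo j) (S.span_even (hs i))
  have heus : ∀ i j, B (g.bracket e (u j)) (![e, x, f] i) = 0 := fun i j =>
    S.form.odd_even (heuo j) (S.span_even (hs i))
  have hsT : ∀ i j k, B (![e, x, f] i) (curvature g B e x (u j) (u k)) = 0 := fun i j k =>
    S.span_form_natural (hs i) (hT j k)
  have hTs : ∀ i j k, B (curvature g B e x (u j) (u k)) (![e, x, f] i) = 0 := fun i j k => by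
    rw [S.form.symm_even (natural_even (hT j k)), hsT]
  have hTu : ∀ i j k, B (curvature g B e x (u j) (u k)) (u i) = 0 := fun i j k =>
    S.form.even_odd _ (natural_even (hT j k)) _ (huo i)
  have hTeu : ∀ i j k, B (curvature g B e x (u j) (u k)) (g.bracket e (u i)) = 0 := fun i j k =>
    S.form.even_odd _ (natural_even (hT j k)) _ (heuo i)
  have huT : ∀ i j k, B (u i) (curvature g B e x (u j) (u k)) = 0 := fun i j k =>
    S.form.odd_even (huo i) (natural_even (hT j k))
  have heuT : ∀ i j k, B (g.bracket e (u i)) (curvature g B e x (u j) (u k)) = 0 := fun i j k =>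
    S.form.odd_even (heuo i) (natural_even (hT j k))
  have huu : ∀ i j, B (u i) (u j) = 0 := fun i j =>
    S.form.gr_orthogonal S.x_mem (R.mem i) (R.mem j) (by norm_num)
  have heueu : ∀ i j, B (g.bracket e (u i)) (g.bracket e (u j)) = 0 := fun i j =>
    S.form.gr_orthogonal S.x_mem (S.e_half (R.mem i)) (S.e_half (R.mem j)) (by norm_num)
  have heuu : ∀ i j, B (g.bracket e (u i)) (u j) = if j = star i then 1 else 0 := fun i j => by
    rw [← halfForm_eq S.form, R.dual]
  have hueu : ∀ i j, B (u i) (g.bracket e (u j)) = -if i = star j then 1 else 0 := fun i j => by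
    rw [S.form.antisymm_odd (huo i) (heuo j), heuu]
  have hst : ∀ i j, star i = star (star j) ↔ i = star j := fun i j => by
    constructor
    · intro h; rw [← R.star_star i, h, R.star_star]
    · rintro rfl; rfl
  have hTT : ∀ i j k l, B (curvature g B e x (u i) (u j)) (curvature g B e x (u k) (u l)) =
      g.halfForm B e (g.bracket (curvature g B e x (u i) (u j)) (u k)) (u l) := fun i j k l =>
    S.form_curvature (hT i j) _ _
  rcases k with k | k | k | k <;> rcases l with l | l | l | l <;>
    simp only [adaptedFamily, Sum.elim_inl, Sum.elim_inr, Function.comp_apply, id, map_smul,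
      LinearMap.smul_apply, hsu, hseu, hus, heus, hsT, hTs, hTu, hTeu, huT, heuT, huu, heueu,
      smul_zero, map_zero, heuu, hueu, hst, hTT, R.real]
  · fin_cases k <;> fin_cases l <;>
      simp [S.form_e_e, S.form_e_f, S.form_e_x, S.form_f_e, S.form_f_f, S.form_f_x, S.form_x_e,
        S.form_x_f, S.norm, Complex.conj_ofNat]
  · split_ifs <;> simp
  · split_ifs <;> simp

theorem exists_isBasisConjugation : ∃ φ : L →ₛₗ[starRingEnd ℂ] L,
    IsBasisConjugation g B e x f u star φ := by
  obtain ⟨φ, hφ, hB⟩ := LinearMap.BilinForm.exists_semilinear_of_gram S.form.nondegenerate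
    (adaptedFamily g B e x f 1 (u ∘ id)) (adaptedFamily g B e x f (-1) (u ∘ star))
    (S.span_adaptedFamily R one_ne_zero fun _ => rfl)
    (S.span_adaptedFamily R (by norm_num) R.star_star) (S.gram_adaptedFamily R)
  refine ⟨φ, hφ (Sum.inl 0), hφ (Sum.inl 1), hφ (Sum.inl 2),
    fun i j => hφ (Sum.inr (Sum.inl (i, j))), fun i => ?_, fun i => ?_, hB⟩
  · have := hφ (Sum.inr (Sum.inr (Sum.inl i)))
    simpa [adaptedFamily] using this
  · have := hφ (Sum.inr (Sum.inr (Sum.inr i)))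
    simpa [adaptedFamily] using this

end IsMinimalSetting

/-! ### Multiplicativity of the conjugation -/

/-- The elements on whose adjoint action the conjugate linear map `φ` is multiplicative. -/
def multipliers (g : LieSuperalgebra L) (φ : L →ₛₗ[starRingEnd ℂ] L) : Submodule ℂ L where
  carrier := {a | ∀ c, φ (g.bracket a c) = g.bracket (φ a) (φ c)}
  add_mem' ha hb c := by
    rw [map_add g.bracket, LinearMap.add_apply, map_add, ha c, hb c, map_add φ, map_add g.bracket,
      LinearMap.add_apply]
  zero_mem' c := by simp
  smul_mem' r a ha c := by
    rw [map_smul, LinearMap.smul_apply, map_smulₛₗ, ha c, map_smulₛₗ φ, map_smul,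
      LinearMap.smul_apply]

/-- Jacobi expresses `ad [a, b]` through `ad a` and `ad b`. The sign in it is real and depends only
on parities, so φ preserves it. -/
theorem bracket_mem_multipliers {φ : L →ₛₗ[starRingEnd ℂ] L}
    (hφ : ∀ i, ∀ a ∈ g.part i, φ a ∈ g.part i) {i j : ZMod 2} {a b : L} (ha : a ∈ g.part i)
    (hb : b ∈ g.part j) (ham : a ∈ g.multipliers φ) (hbm : b ∈ g.multipliers φ) :
    g.bracket a b ∈ g.multipliers φ := by
  intro c
  have h1 := g.jacobi ha hb c
  have h2 := g.jacobi (hφ i a ha) (hφ j b hb) (φ c)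
  rw [← sub_eq_iff_eq_add] at h1 h2
  rw [← h1, map_sub, map_smulₛₗ, ham, hbm, hbm, ham, ham b, ← h2, map_pow, map_neg, map_one]

namespace IsMinimalSetting

variable {B : LinearMap.BilinForm ℂ L} {e x f : L} (S : IsMinimalSetting g B e x f)
  {I : Type} [Fintype I] [DecidableEq I] {u : I → L} {star : I → I}
  (R : IsRealBasis g B e x u star) {φ : L →ₛₗ[starRingEnd ℂ] L}
  (hφ : IsBasisConjugation g B e x f u star φ)

section
include R hφ

theorem conj_mem {w : L} (hw : w ∈ g.gr x (-1 / 2)) : φ w ∈ g.gr x (-1 / 2) := by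
  rw [expand R.star_star R.dual R.span hw, map_sum]
  refine Submodule.sum_mem _ fun i _ => ?_
  rw [map_smulₛₗ, hφ.map_basis]
  exact Submodule.smul_mem _ _ (Submodule.neg_mem _ (R.mem _))

theorem conj_e_bracket {w : L} (hw : w ∈ g.gr x (-1 / 2)) :
    φ (g.bracket e w) = g.bracket e (φ w) := by
  rw [expand R.star_star R.dual R.span hw]
  simp only [map_sum, map_smul, map_smulₛₗ, hφ.map_basis, hφ.map_e_basis, map_neg]

theorem conj_conj_neg_half {w : L} (hw : w ∈ g.gr x (-1 / 2)) : φ (φ w) = w := by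
  rw [expand R.star_star R.dual R.span hw]
  simp only [map_sum, map_smulₛₗ, hφ.map_basis, map_neg, R.star_star, neg_neg, Complex.conj_conj]

theorem conj_curvature {w v : L} (hw : w ∈ g.gr x (-1 / 2)) (hv : v ∈ g.gr x (-1 / 2)) :
    φ (curvature g B e x w v) = curvature g B e x (φ w) (φ v) := by
  rw [expand R.star_star R.dual R.span hw, expand R.star_star R.dual R.span hv]
  simp only [map_sum, map_smul, LinearMap.sum_apply, LinearMap.smul_apply, map_smulₛₗ,
    hφ.map_basis, hφ.map_curvature, map_neg, LinearMap.neg_apply, smul_neg,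
    Finset.sum_neg_distrib, neg_neg]

end

include S R hφ

theorem conj_halfForm {w v : L} (hw : w ∈ g.gr x (-1 / 2)) :
    g.halfForm B e (φ w) (φ v) = starRingEnd ℂ (g.halfForm B e w v) := by
  rw [halfForm_eq S.form, halfForm_eq S.form, ← conj_e_bracket R hφ hw, hφ.form]

variable [FiniteDimensional ℂ L]

theorem conj_natural {a : L} (ha : a ∈ g.natural e x f) : φ a ∈ g.natural e x f := by
  have hle : g.natural e x f ≤ (g.natural e x f).comap φ := by
    refine (S.natural_le_span R).trans (Submodule.span_le.mpr ?_)
    rintro _ ⟨p, rfl⟩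
    change φ (curvature g B e x (u p.1) (u p.2)) ∈ g.natural e x f
    rw [hφ.map_curvature]
    exact S.curvature_mem (R.mem _) (R.mem _)
  exact hle ha

theorem conj_conj_natural {a : L} (ha : a ∈ g.natural e x f) : φ (φ a) = a := by
  have hle : g.natural e x f ≤ LinearMap.eqLocus (φ.comp φ) LinearMap.id := by
    refine (S.natural_le_span R).trans (Submodule.span_le.mpr ?_)
    rintro _ ⟨p, rfl⟩
    change φ (φ (curvature g B e x (u p.1) (u p.2))) = curvature g B e x (u p.1) (u p.2)
    rw [hφ.map_curvature, hφ.map_curvature, R.star_star, R.star_star]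
  exact hle ha

/-- Both sides are compared by pairing with φ v, through ⟨[a, w], v⟩ = (a|T(w, v)), the
compatibility of φ with the form, and φ T(w, v) = T(φ w, φ v). -/
theorem conj_natural_bracket {a w : L} (ha : a ∈ g.natural e x f) (hw : w ∈ g.gr x (-1 / 2)) :
    φ (g.bracket a w) = g.bracket (φ a) (φ w) := by
  have ha' := S.conj_natural R hφ ha
  rw [← sub_eq_zero]
  refine S.eq_zero_of_halfForm (Submodule.sub_mem _ (conj_mem R hφ (S.natural_gr ha hw))
    (S.natural_gr ha' (conj_mem R hφ hw))) fun v hv => ?_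
  rw [← conj_conj_neg_half R hφ hv, halfForm_compr, map_sub, LinearMap.sub_apply, ← halfForm_compr,
    ← halfForm_compr, S.conj_halfForm R hφ (S.natural_gr ha hw), ← S.form_curvature ha,
    ← S.form_curvature ha', ← conj_curvature R hφ hw (conj_mem R hφ hv), hφ.form, sub_self]

theorem conj_part (i : ZMod 2) (a : L) (ha : a ∈ g.part i) : φ a ∈ g.part i := by
  have hi : ∀ i : ZMod 2, i = 0 ∨ i = 1 := by decide
  rcases hi i with rfl | rfl
  · obtain ⟨α, β, γ, n, hn, rfl⟩ := S.even_decomp ha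
    simp only [map_add, map_smulₛₗ, hφ.map_e, hφ.map_x, hφ.map_f]
    exact Submodule.add_mem _ (Submodule.add_mem _ (Submodule.add_mem _
      (Submodule.smul_mem _ _ S.e_mem) (Submodule.smul_mem _ _ S.x_mem))
      (Submodule.smul_mem _ _ S.f_mem)) (natural_even (S.conj_natural R hφ hn))
  · obtain ⟨w, hw, v, hv, rfl⟩ := S.odd_decomp' ha
    rw [map_add, conj_e_bracket R hφ hv]
    exact Submodule.add_mem _ (S.neg_half_odd (conj_mem R hφ hw))
      (S.half_odd (S.e_half (conj_mem R hφ hv)))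

theorem conj_conj (y : L) : φ (φ y) = y := by
  obtain ⟨α, β, γ, n, hn, w, hw, v, hv, rfl⟩ := S.exists_decomp y
  simp only [map_add, map_smulₛₗ, hφ.map_e, hφ.map_x, hφ.map_f, Complex.conj_conj,
    S.conj_conj_natural R hφ hn, conj_conj_neg_half R hφ hw, conj_e_bracket R hφ hv,
    conj_e_bracket R hφ (conj_mem R hφ hv), conj_conj_neg_half R hφ hv]

theorem e_mem_multipliers : e ∈ g.multipliers φ := by
  intro c
  obtain ⟨α, β, γ, n, hn, w, hw, v, hv, rfl⟩ := S.exists_decomp c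
  simp only [map_add, map_smul, map_smulₛₗ, map_neg, hφ.map_e, hφ.map_x, hφ.map_f, S.e_e, S.e_x,
    S.e_f, conj_e_bracket R hφ hw, conj_e_bracket R hφ hv, S.e_pos_half (S.e_half hv),
    S.e_pos_half (S.e_half (conj_mem R hφ hv)), (mem_natural.mp hn).2.1,
    (mem_natural.mp (S.conj_natural R hφ hn)).2.1, map_zero, smul_zero]

theorem f_mem_multipliers : f ∈ g.multipliers φ := by
  intro c
  obtain ⟨α, β, γ, n, hn, w, hw, v, hv, rfl⟩ := S.exists_decomp c
  simp only [map_add, map_smul, map_smulₛₗ, map_neg, hφ.map_e, hφ.map_x, hφ.map_f, S.f_e, S.f_x,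
    S.f_f, conj_e_bracket R hφ hv, S.f_neg_half hw, S.f_neg_half (conj_mem R hφ hw),
    S.f_e_neg_half hv, S.f_e_neg_half (conj_mem R hφ hv), (mem_natural.mp hn).2.2.2,
    (mem_natural.mp (S.conj_natural R hφ hn)).2.2.2, map_zero, smul_zero, map_div₀, map_one,
    Complex.conj_ofNat]

theorem neg_half_mem_multipliers {y : L} (hy : y ∈ g.gr x (-1 / 2)) : y ∈ g.multipliers φ := by
  intro c
  obtain ⟨α, β, γ, n, hn, w, hw, v, hv, rfl⟩ := S.exists_decomp c
  have hn' := S.conj_natural R hφ hn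
  have hy' := conj_mem R hφ hy
  have hv' := conj_mem R hφ hv
  have hw' := conj_mem R hφ hw
  have key : ∀ {y v : L}, y ∈ g.gr x (-1 / 2) → v ∈ g.gr x (-1 / 2) →
      g.bracket y (g.bracket e v) = g.halfForm B e v y • x + curvature g B e x v y := by
    intro y v hy hv
    rw [skew_odd (S.neg_half_odd hy) (S.half_odd (S.e_half hv)), e_bracket_eq]
  simp only [map_add, map_smul, map_smulₛₗ, map_neg, hφ.map_e, hφ.map_x, hφ.map_f,
    skew_even_right S.e_mem, skew_even_right S.x_mem, skew_even_right S.f_mem,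
    skew_even_right (natural_even hn), skew_even_right (natural_even hn'), mem_gr.mp hy,
    mem_gr.mp hy', S.f_neg_half hy, S.f_neg_half hy', S.conj_natural_bracket R hφ hn hy,
    conj_e_bracket R hφ hy, conj_e_bracket R hφ hv, S.bracket_neg_half hy hw,
    S.bracket_neg_half hy' hw', key hy hv, key hy' hv', S.conj_halfForm R hφ hy,
    S.conj_halfForm R hφ hv, conj_curvature R hφ hv hy, map_zero, map_div₀, map_one,
    map_mul, Complex.conj_ofNat]

/-- Multipliers are closed under brackets of homogeneous elements, so e, f and `g_{-1/2}` suffice: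
they generate x, [e, V] and all curvatures. -/
theorem conj_bracket (a b : L) : φ (g.bracket a b) = g.bracket (φ a) (φ b) := by
  have hpart := S.conj_part R hφ
  have he := S.e_mem_multipliers R hφ
  have hf := S.f_mem_multipliers R hφ
  have hx : x ∈ g.multipliers φ := by
    rw [← S.e_f]
    exact bracket_mem_multipliers hpart S.e_mem S.f_mem he hf
  have hV : ∀ y ∈ g.gr x (-1 / 2), y ∈ g.multipliers φ := fun y hy =>
    S.neg_half_mem_multipliers R hφ hy
  have heV : ∀ y ∈ g.gr x (-1 / 2), g.bracket e y ∈ g.multipliers φ := fun y hy =>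
    bracket_mem_multipliers hpart S.e_mem (S.neg_half_odd hy) he (hV y hy)
  have hnat : g.natural e x f ≤ g.multipliers φ := by
    refine (S.natural_le_span R).trans (Submodule.span_le.mpr ?_)
    rintro _ ⟨p, rfl⟩
    have h1 := R.mem p.1
    have h2 := R.mem p.2
    exact Submodule.sub_mem _ (bracket_mem_multipliers hpart (S.half_odd (S.e_half h1))
      (S.neg_half_odd h2) (heV _ h1) (hV _ h2)) (Submodule.smul_mem _ _ hx)
  suffices h : a ∈ g.multipliers φ from h b
  obtain ⟨α, β, γ, n, hn, w, hw, v, hv, rfl⟩ := S.exists_decomp a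
  exact Submodule.add_mem _ (Submodule.add_mem _ (Submodule.add_mem _ (Submodule.add_mem _
    (Submodule.smul_mem _ _ he) (Submodule.smul_mem _ _ hx)) (Submodule.smul_mem _ _ hf))
    (hnat hn)) (Submodule.add_mem _ (hV w hw) (heV v hv))

theorem isConjInvolution : g.IsConjInvolution φ :=
  ⟨S.conj_conj R hφ, S.conj_part R hφ, S.conj_bracket R hφ⟩

/-! ### Compactness and positivity -/

omit [FiniteDimensional ℂ L] in
/-- The matrix of an element of the real form of `g^♮` in a real basis is skew-Hermitian. -/
theorem matrix_skewHermitian {a : L} (ha : a ∈ g.natural e x f)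
    (haw : ∀ w ∈ g.gr x (-1 / 2), φ (g.bracket a w) = g.bracket a (φ w)) (k l : I) :
    starRingEnd ℂ (g.halfForm B e (g.bracket a (u l)) (u (star k))) =
      -g.halfForm B e (g.bracket a (u k)) (u (star l)) := by
  rw [← S.conj_halfForm R hφ (S.natural_gr ha (R.mem l)), haw _ (R.mem l), hφ.map_basis,
    hφ.map_basis, R.star_star, S.halfForm_skew ha,
    S.halfForm_symm (Submodule.neg_mem _ (R.mem _))
      (S.natural_gr ha (Submodule.neg_mem _ (R.mem k)))]
  simp only [halfForm_compr, map_neg, LinearMap.neg_apply, neg_neg]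

/-- The inner product is the real part of ∑ |B(v, ·)|² over the spanning family. A φ-fixed element
of `g^♮` acts on that family by skew-Hermitian matrices, which is invariance. -/
theorem isCompactOn : g.IsCompactOn φ (g.natural e x f) := by
  let v₁ : Fin 3 → L := ![e, x, f]
  let v₂ : I × I → L := fun p => curvature g B e x (u p.1) (u p.2)
  let v₄ : I → L := fun i => g.bracket e (u i)
  refine ⟨B.realForm v₁ + B.realForm v₂ + B.realForm u + B.realForm v₄, fun y z => ?_,
    fun y hy => ?_, fun a ha hfix y z => ?_⟩
  · simp only [LinearMap.add_apply]
    rw [B.realForm_symm v₁ y, B.realForm_symm v₂ y, B.realForm_symm u y, B.realForm_symm v₄ y]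
  · have h₁ := B.realForm_self_nonneg v₁ y
    have h₂ := B.realForm_self_nonneg v₂ y
    have h₃ := B.realForm_self_nonneg u y
    have h₄ := B.realForm_self_nonneg v₄ y
    simp only [LinearMap.add_apply]
    -- If the sum of the four nonnegative terms is not positive, each is zero. Then y is orthogonal
    -- to a spanning family.
    by_contra hneg
    refine hy (S.form.nondegenerate.2 y fun z => ?_)
    have hle : Submodule.span ℂ (Set.range (adaptedFamily g B e x f 1 (u ∘ id))) ≤
        LinearMap.ker (B.flip y) := by
      refine Submodule.span_le.mpr ?_
      rintro _ ⟨k | k | k | k, rfl⟩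
      · exact B.realForm_self_eq_zero v₁ (by linarith) k
      · exact B.realForm_self_eq_zero v₂ (by linarith) k
      · change B ((1 : ℂ) • u k) y = 0
        rw [one_smul]
        exact B.realForm_self_eq_zero u (by linarith) k
      · change B ((1 : ℂ) • g.bracket e (u k)) y = 0
        rw [one_smul]
        exact B.realForm_self_eq_zero v₄ (by linarith) k
    rw [S.span_adaptedFamily R one_ne_zero fun _ => rfl] at hle
    exact hle (Submodule.mem_top : z ∈ ⊤)
  · let M : I → I → ℂ := fun k l => g.halfForm B e (g.bracket a (u l)) (u (star k))
    have hM : ∀ k l, starRingEnd ℂ (M k l) = -M l k := S.matrix_skewHermitian R hφ ha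
      fun w hw => by rw [S.conj_natural_bracket R hφ ha hw, hfix]
    have hau : ∀ k, g.bracket a (u k) = ∑ l, M l k • u l := fun k =>
      expand R.star_star R.dual R.span (S.natural_gr ha (R.mem k))
    have hskew : ∀ b y, B b (g.bracket a y) = -B (g.bracket a b) y := fun b y => by
      rw [S.form.even_skew (natural_even ha), neg_neg]
    have e₁ := B.realForm_skew v₁ (g.bracket a) 0 (fun k l => by simp) (fun k y => by
      rw [hskew]
      fin_cases k <;> simp [v₁, natural_e ha, natural_x ha, natural_f ha]) y z
    -- On curvatures a acts as a derivation in both arguments, with matrix M ⊗ 1 + 1 ⊗ M.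
    have e₂ := B.realForm_skew v₂ (g.bracket a)
      (fun p q => M p.1 q.1 * (if p.2 = q.2 then 1 else 0) +
        (if p.1 = q.1 then 1 else 0) * M p.2 q.2)
      (fun p q => by
        simp only [map_add, map_mul, hM, apply_ite (starRingEnd ℂ), map_one, map_zero,
          eq_comm (a := q.1), eq_comm (a := q.2)]
        ring)
      (fun p y => by
        rw [hskew, S.bracket_curvature ha, hau, hau]
        simp only [map_add, map_sum, map_smul, LinearMap.add_apply, LinearMap.sum_apply,
          LinearMap.smul_apply, smul_eq_mul, Fintype.sum_prod_type, add_mul,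
          Finset.sum_add_distrib, v₂]
        simp) y z
    have e₃ := B.realForm_skew u (g.bracket a) M hM (fun k y => by
      rw [hskew, hau]
      simp only [map_sum, map_smul, LinearMap.sum_apply, LinearMap.smul_apply, smul_eq_mul]) y z
    have e₄ := B.realForm_skew v₄ (g.bracket a) M hM (fun k y => by
      rw [hskew, natural_e_bracket ha, hau]
      simp only [map_sum, map_smul, LinearMap.sum_apply, LinearMap.smul_apply, smul_eq_mul,
        v₄]) y z
    simp only [LinearMap.add_apply]
    linarith

omit [FiniteDimensional ℂ L] in
theorem isPosDefOn :
    IsPosDefOn (g.halfForm B e) {u : L | u ∈ g.gr x (-1 / 2) ∧ φ u = -u} := by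
  have hconj : ∀ {w v : L}, w ∈ g.gr x (-1 / 2) → φ w = -w → ∀ v', φ v = -v' →
      starRingEnd ℂ (g.halfForm B e w v) = g.halfForm B e w v' := by
    intro w v hw hφw v' hφv
    rw [← S.conj_halfForm R hφ hw, hφw, hφv]
    simp only [halfForm_compr, map_neg, LinearMap.neg_apply, neg_neg]
  refine ⟨fun w hw v hv => Complex.conj_eq_iff_im.mp (hconj hw.1 hw.2 v hv.2),
    fun w hw v hv => S.halfForm_symm hw.1 hv.1, fun w hw hw0 => ?_⟩
  have hexp := expand R.star_star R.dual R.span hw.1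
  -- The two sign changes, in φ w = -w and in φ uᵢ = -u_{star i}, cancel. So conjugation exchanges
  -- the coordinates at i and `star i`, and ⟨w, w⟩ becomes a sum of squared moduli.
  have hterm : ∀ i, g.halfForm B e w (u i) =
      starRingEnd ℂ (g.halfForm B e w (u (star i))) := fun i =>
    (hconj hw.1 hw.2 _ (by rw [hφ.map_basis, R.star_star])).symm
  have hsum : g.halfForm B e w w =
      ((∑ i, Complex.normSq (g.halfForm B e w (u (star i))) : ℝ) : ℂ) := by
    have h1 := congrArg (g.halfForm B e w) hexp
    rw [halfForm_sum_right] at h1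
    rw [h1, Complex.ofReal_sum]
    refine Finset.sum_congr rfl fun i _ => ?_
    rw [hterm i, Complex.mul_conj]
  rw [hsum, Complex.ofReal_re]
  have hnonneg : ∀ i ∈ Finset.univ, 0 ≤ Complex.normSq (g.halfForm B e w (u (star i))) :=
    fun i _ => Complex.normSq_nonneg _
  refine lt_of_le_of_ne (Finset.sum_nonneg hnonneg) fun h0 => hw0 ?_
  rw [hexp]
  refine Finset.sum_eq_zero fun i hi => ?_
  rw [Complex.normSq_eq_zero.mp ((Finset.sum_eq_zero_iff_of_nonneg hnonneg).mp h0.symm i hi),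
    zero_smul]

end IsMinimalSetting

end LieSuperalgebra

/-- In the setting of a basic simple Lie superalgebra with a minimal datum, whose even part is
`span {e, x, f} ⊕ g^♮` with `g^♮` not abelian, and with real scalar products of roots, there is an
almost compact conjugate linear involution `φ` such that `⟨u, v⟩ = (e|[u, v])` is positive definite
on `{u ∈ g_{-1/2} | φ u = -u}`. The condition `(x|x) = 1/2` is the normalization `(θ|θ) = 2` of the
form, since `θ` is represented by `2 x` up to sign. -/
theorem proposition5p1 {L : Type*} [AddCommGroup L] [Module ℂ L] [FiniteDimensional ℂ L]
    (g : LieSuperalgebra L) (B : LinearMap.BilinForm ℂ L) (hg : g.IsBasicSimple B)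
    (e x f : L) (hmin : g.IsMinimalDatum e x f) (hdec : g.EvenDecomposes e x f)
    (hnorm : B x x = 1 / 2)
    (hnonab : ∃ a ∈ g.natural e x f, ∃ b ∈ g.natural e x f, g.bracket a b ≠ 0)
    (H : Submodule ℂ L) (hH : g.IsCartan H) (hreal : g.RealRoots B H) :
    ∃ φ : L →ₛₗ[starRingEnd ℂ] L, g.IsAlmostCompact e x f φ ∧
      IsPosDefOn (g.halfForm B e) {u : L | u ∈ g.gr x (-1 / 2) ∧ φ u = -u} := by
  have S : LieSuperalgebra.IsMinimalSetting g B e x f := ⟨hg.simple, hg.form, hmin, hdec, hnorm⟩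
  obtain ⟨I, _, _, u, star, R⟩ := S.exists_real_basis hH hreal
  obtain ⟨φ, hφ⟩ := S.exists_isBasisConjugation R
  exact ⟨φ, ⟨S.isConjInvolution R hφ, hφ.map_e, hφ.map_x, hφ.map_f, S.isCompactOn R hφ⟩,
    S.isPosDefOn R hφ⟩
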